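/- Let $\hat K=\{(\xi,\eta,\zeta): 0\le\zeta\le 1,\ 0\le\xi,\eta\le 1-\zeta\}$ be the reference pyramid, $K_\infty=\{(x,y,z): 0\le x,y\le 1,\ z\ge 0\}$ the infinite pyramid, and $\phi:K_\infty\to\hat K$, $\phi(x,y,z)=\left(\frac{x}{1+z},\frac{y}{1+z},\frac{z}{1+z}\right)$. An affine pyramid is $K=\phi_K(\hat K)$ with $\phi_K:\mathbb R^3\to\mathbb R^3$ an invertible affine map; $|D\phi_K|$ is the absolute value of its Jacobian determinant. All fields below are considered in the interiors of these sets. For $s\in\{0,1,2,3\}$, an $s$-form is given by its proxy field with $\binom3s$ components. Under a coordinate change $x=\psi(x')$ the components satisfy $u=w^{(s)}_\psi u'$ with $w^{(0)}_\psi=1$, $w^{(1)}_\psi=(D\psi^{-1})^t$, $w^{(2)}_\psi=\det(D\psi)^{-1}D\psi$, $w^{(3)}_\psi=\det(D\psi)^{-1}$; a tensor $A=(A^{ij})$ acts on pairs of $s$-forms by $A(v,w)=\sum_{i,j}A^{ij}v_iw_j$ and its components transform as $A'=(w^{(s)}_\psi)^tAw^{(s)}_\psi$. For fields on $K$, hats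 denote components in the reference coordinates $\hat x=\phi_K^{-1}(x)$, and tildes those in the coordinates $\tilde x=\phi^{-1}(\hat x)$. Let $Q_k^{l,m,n}=\operatorname{span}\{\frac{x^ay^bz^c}{(1+z)^k}: 0\le a\le l,\,0\le b\le m,\,0\le c\le n\}$ and $Q_k^{[l,m]}=\operatorname{span}\{\frac{x^ay^b}{(1+z)^c}: a,b,c\ge 0,\ c\le k,\ a\le c+l-k,\ b\le c+m-k\}$, and put $N_k=Q_{k+1}^{[k-1,k]}\times Q_{k+1}^{[k,k-1]}\times\{0\}$, $$\mathcal P^{(0)}_k=Q_k^{[k,k]},\quad \mathcal P^{(1)}_k=N_k+\nabla Q_k^{[k,k]},\quad \mathcal P^{(2)}_k=\bigl(\{0\}\times\{0\}\times Q_{k+2}^{[k-1,k-1]}\bigr)+\nabla\times N_k,\quad \mathcal P^{(3)}_k=Q_{k+3}^{[k-1,k-1]}.$$ Let $\mathcal P^{(s)}_k(K)$ be the space of smooth $s$-forms $u$ on $K$ with $\tilde u\in\mathcal P^{(s)}_k$, and let $\mathcal X^{(s)}_{r,k}(K)$ be the space of those $v\in\mathcal P^{(s)}_k(K)$ whose reference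 components satisfy $v_{\hat\imath}\circ\phi\in Q_r^{r+1,r+1,0}$ for all $\hat\imath$. Let $\xi_i,\lambda_i$ be the nodes and weights of the $(k+1)$-point Gauss–Legendre rule on $[0,1]$, and $\zeta_l,\mu_l$ those of the $(k+1)$-point Gauss–Jacobi rule on $[0,1]$ for the weight $(1-t)^2$. Set $S_{k,\hat K}(f)=\sum_{i,j,l}f(\xi_i(1-\zeta_l),\xi_j(1-\zeta_l),\zeta_l)\lambda_i\lambda_j\mu_l$, $S_{k,K}(f)=S_{k,\hat K}(|D\phi_K|\,f\circ\phi_K)$ and $E_{k,K}(f)=S_{k,K}(f)-\int_Kf\,dx$. Finally, let $|u|_{m,\hat K}=\sum_{\hat\imath}|u_{\hat\imath}|_{H^m(\hat K)}$, $\|u\|_{0,\hat K}=|u|_{0,\hat K}$ and $|A|_{m,\infty,\hat K}=\sum_{\hat\imath,\hat\jmath}|A^{\hat\imath\hat\jmath}|_{W^{m,\infty}(\hat K)}$. **Lemma.** For every integer $k\ge 0$ there is a constant $C=C(k)$, depending only on $k$, such that for all $s\in\{0,1,2,3\}$, all $r\in\{0,\dots,k\}$, all affine pyramids $K$, all $v\in\mathcal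 X^{(s)}_{r,k}(K)$, all $w\in\mathcal P^{(s)}_k(K)$ and all tensors $A$ on $K$ with components in $W^{k+1,\infty}(K)$ (taken with their continuous representatives), $$|E_{k,K}(A(v,w))|\le C\,|D\phi_K|\,|A|_{k-r+1,\infty,\hat K}\,|v|_{r,\hat K}\,\|w\|_{0,\hat K}.$$ -/

import Mathlib

open scoped ContDiff Matrix Polynomial

noncomputable section

namespace PyramidFE

/-! ### Domains and coordinate systems -/

/-- Three-dimensional coordinate space. Its `volume` is Lebesgue measure. -/
abbrev R3 : Type := Fin 3 → ℝ

/-- The (open) reference pyramid with base `[0,1]²` in the plane `ζ = 0` and apex `(0,0,1)`.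
All fields live on the open pyramid: the rational shape functions may be singular at the apex,
the quadrature nodes are interior points, and the boundary is a null set. -/
def refPyramid : Set R3 :=
  {p | 0 < p 2 ∧ 0 < p 0 ∧ p 0 < 1 - p 2 ∧ 0 < p 1 ∧ p 1 < 1 - p 2}

/-- The (open) infinite pyramid. -/
def infPyramid : Set R3 :=
  {p | 0 < p 0 ∧ p 0 < 1 ∧ 0 < p 1 ∧ p 1 < 1 ∧ 0 < p 2}

/-- The projective map from the infinite pyramid to the reference pyramid. -/
def projMap (p : R3) : R3 := ![p 0 / (1 + p 2), p 1 / (1 + p 2), p 2 / (1 + p 2)]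

/-- The affine (parallelogram-based) pyramid `K = φK(K̂)`, for an affine bijection `φK`. -/
def affinePyramid (φK : R3 ≃ᵃ[ℝ] R3) : Set R3 := φK '' refPyramid

/-- The Jacobian matrix of a map at a point. -/
def jacobian (φ : R3 → R3) (x : R3) : Matrix (Fin 3) (Fin 3) ℝ :=
  Matrix.of fun i j => fderiv ℝ φ x (Pi.single j 1) i

/-! ### Proxy fields of differential forms and their transformation -/

/-- The number `binom(3, s)` of components of (the proxy field of) an `s`-form. -/
abbrev proxyDim : Fin 4 → ℕ
  | 0 => 1
  | 1 => 3
  | 2 => 3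
  | 3 => 1

/-- A proxy field of an `s`-form, by its components in some coordinate system. -/
abbrev Proxy (s : Fin 4) : Type := R3 → Fin (proxyDim s) → ℝ

/-- The weight matrix of a coordinate change with Jacobian matrix `J = Dφ`, `x = φ(x')`: the
components of an `s`-form satisfy `u_i = ∑_{i'} weight_{i,i'} u_{i'}`. -/
def weight : (s : Fin 4) → Matrix (Fin 3) (Fin 3) ℝ →
    Matrix (Fin (proxyDim s)) (Fin (proxyDim s)) ℝ
  | 0, _ => Matrix.of fun _ _ => 1
  | 1, J => (J⁻¹)ᵀ
  | 2, J => J.det⁻¹ • J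
  | 3, J => Matrix.of fun _ _ => J.det⁻¹

/-- The components of the form `u` in the coordinate system `x'`, where `x = φ(x')`,
as functions of `x'`. -/
def changeCoords (s : Fin 4) (φ : R3 → R3) (u : Proxy s) : Proxy s :=
  fun x' => (weight s (jacobian φ x'))⁻¹ *ᵥ u (φ x')

/-- Gradient of a scalar field. -/
def grad (f : R3 → ℝ) (x : R3) : Fin 3 → ℝ := fun i => fderiv ℝ f x (Pi.single i 1)

/-- Curl of a vector field. -/
def curl (u : R3 → Fin 3 → ℝ) (x : R3) : Fin 3 → ℝ :=
  ![grad (fun y => u y 2) x 1 - grad (fun y => u y 1) x 2,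
    grad (fun y => u y 0) x 2 - grad (fun y => u y 2) x 0,
    grad (fun y => u y 1) x 0 - grad (fun y => u y 0) x 1]

/-! ### Weighted polynomials on the infinite pyramid and the approximation spaces -/

/-- `Q_k^{l,m,n}`: the `k`-weighted tensor product polynomials. -/
def weightedQ (k l m n : ℕ) : Submodule ℝ (R3 → ℝ) :=
  Submodule.span ℝ {f | ∃ a b c : ℕ, a ≤ l ∧ b ≤ m ∧ c ≤ n ∧
    f = fun p => p 0 ^ a * p 1 ^ b * p 2 ^ c / (1 + p 2) ^ k}

/-- `Q_k^{[l,m]}`: the span of `x^a y^b / (1+z)^c` with `c ≤ k`, `a ≤ c + l - k`,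
`b ≤ c + m - k`. -/
def bracketQ (k : ℕ) (l m : ℤ) : Submodule ℝ (R3 → ℝ) :=
  Submodule.span ℝ {f | ∃ a b c : ℕ, c ≤ k ∧ (a : ℤ) ≤ c + l - k ∧ (b : ℤ) ≤ c + m - k ∧
    f = fun p => p 0 ^ a * p 1 ^ b / (1 + p 2) ^ c}

/-- The spaces `𝒫^{(s)}_k` on the infinite pyramid (as fields determined on `infPyramid`). -/
def spaceP : (s : Fin 4) → (k : ℕ) → Set (Proxy s)
  | 0, k => {u | ∃ q ∈ bracketQ k k k, ∀ p ∈ infPyramid, u p = ![q p]}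
  | 1, k => {u | ∃ q₁ ∈ bracketQ (k + 1) (k - 1) k, ∃ q₂ ∈ bracketQ (k + 1) k (k - 1),
      ∃ q ∈ bracketQ k k k, ∀ p ∈ infPyramid, u p = ![q₁ p, q₂ p, 0] + grad q p}
  | 2, k => {u | ∃ q₃ ∈ bracketQ (k + 2) (k - 1) (k - 1),
      ∃ q₁ ∈ bracketQ (k + 1) (k - 1) k, ∃ q₂ ∈ bracketQ (k + 1) k (k - 1),
      ∀ p ∈ infPyramid, u p = ![0, 0, q₃ p] + curl (fun y => ![q₁ y, q₂ y, 0]) p}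
  | 3, k => {u | ∃ q ∈ bracketQ (k + 3) (k - 1) (k - 1), ∀ p ∈ infPyramid, u p = ![q p]}

/-- The approximation space `𝒫^{(s)}_k(K)`: smooth `s`-forms on `K` whose components in the
infinite pyramid coordinate system lie in `𝒫^{(s)}_k`. -/
def approxP (s : Fin 4) (k : ℕ) (φK : R3 ≃ᵃ[ℝ] R3) : Set (Proxy s) :=
  {u | ContDiffOn ℝ ∞ u (affinePyramid φK) ∧
    changeCoords s projMap (changeCoords s φK u) ∈ spaceP s k}

/-- `𝒳^{(s)}_{r,k}(K)`: the forms in `𝒫^{(s)}_k(K)` whose reference components are exactly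
`r`-weighted when composed with the projective map. -/
def approxX (s : Fin 4) (r k : ℕ) (φK : R3 ≃ᵃ[ℝ] R3) : Set (Proxy s) :=
  {v | v ∈ approxP s k φK ∧ ∀ i, ∃ q ∈ weightedQ r (r + 1) (r + 1) 0,
    ∀ p ∈ infPyramid, changeCoords s φK v (projMap p) i = q p}

/-! ### Tensors -/

/-- A tensor acting on pairs of `s`-forms, by its components `A^{ij}` in some coordinate system. -/
abbrev Tensor (s : Fin 4) : Type := R3 → Matrix (Fin (proxyDim s)) (Fin (proxyDim s)) ℝ

/-- The function `A(v,w) = ∑_{i,j} A^{ij} v_i w_j`. -/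
def tensorApply {s : Fin 4} (A : Tensor s) (v w : Proxy s) (x : R3) : ℝ :=
  ∑ i, ∑ j, A x i j * v x i * w x j

/-- The components of a tensor in the coordinate system `x'`, where `x = φ(x')`, as functions
of `x'`; this is the rule under which `A(v,w)` is a scalar. -/
def tensorChangeCoords (s : Fin 4) (φ : R3 → R3) (A : Tensor s) : Tensor s :=
  fun x' => (weight s (jacobian φ x'))ᵀ * A (φ x') * weight s (jacobian φ x')

/-! ### Sobolev spaces and (semi-)norms -/

/-- The `i`-th partial derivative. -/
def pderiv (i : Fin 3) (f : R3 → ℝ) : R3 → ℝ := fun x => fderiv ℝ f x (Pi.single i 1)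

/-- The classical partial derivative `∂^α f` for a multi-index `α`. -/
def multiDeriv (α : Fin 3 → ℕ) (f : R3 → ℝ) : R3 → ℝ :=
  (pderiv 0)^[α 0] ((pderiv 1)^[α 1] ((pderiv 2)^[α 2] f))

/-- The finite set of multi-indices of order `m`. -/
def multiIdx (m : ℕ) : Finset (Fin 3 → ℕ) := Finset.piAntidiag Finset.univ m

/-- `g` is the weak derivative `∂^α f` on the open set `U`. -/
def HasWeakDeriv (α : Fin 3 → ℕ) (f g : R3 → ℝ) (U : Set R3) : Prop :=
  MeasureTheory.LocallyIntegrableOn f U ∧ MeasureTheory.LocallyIntegrableOn g U ∧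
    ∀ ψ : R3 → ℝ, ContDiff ℝ ∞ ψ → HasCompactSupport ψ → tsupport ψ ⊆ U →
      ∫ x in U, f x * multiDeriv α ψ x = (-1) ^ (∑ i, α i) * ∫ x in U, g x * ψ x

/-- Membership in the Sobolev space `W^{m,∞}(U)`. -/
def MemWInf (m : ℕ) (f : R3 → ℝ) (U : Set R3) : Prop :=
  ∀ α : Fin 3 → ℕ, ∑ i, α i ≤ m →
    ∃ g, HasWeakDeriv α f g U ∧ MeasureTheory.MemLp g ⊤ (MeasureTheory.volume.restrict U)

open Classical in
/-- The weak derivative `∂^α f` on `U`, unique almost everywhere (and `0` if there is none). -/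
def weakDeriv (α : Fin 3 → ℕ) (f : R3 → ℝ) (U : Set R3) : R3 → ℝ :=
  if h : ∃ g, HasWeakDeriv α f g U then h.choose else 0

/-- The seminorm `|f|_{W^{m,∞}(U)} = max_{|α| = m} ‖∂^α f‖_{L^∞(U)}`. -/
def wInfSeminorm (m : ℕ) (f : R3 → ℝ) (U : Set R3) : ℝ :=
  ((multiIdx m).sup fun α =>
    MeasureTheory.eLpNorm (weakDeriv α f U) ⊤ (MeasureTheory.volume.restrict U)).toReal

/-- The seminorm `|f|_{H^m(U)}` of a function that is smooth on the open set `U`: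
the square root of `∑_{|α| = m} ‖∂^α f‖²_{L²(U)}`. -/
def hSeminorm (m : ℕ) (f : R3 → ℝ) (U : Set R3) : ℝ :=
  Real.sqrt (∑ α ∈ multiIdx m,
    MeasureTheory.eLpNorm (multiDeriv α f) 2 (MeasureTheory.volume.restrict U) ^ 2).toReal

/-- `A ∈ W^{m,∞}Θ^{(s)}(U)`; `A` is the continuous representative, so that it has point values. -/
def MemWInfTensor {s : Fin 4} (m : ℕ) (A : Tensor s) (U : Set R3) : Prop :=
  ∀ i j, MemWInf m (fun x => A x i j) U ∧ ContinuousOn (fun x => A x i j) U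

/-- The reference seminorm `|u|_{m,K̂}` of an `s`-form on `K = φK(K̂)`; for `m = 0` this is the
norm `‖u‖_{0,K̂}`. -/
def refSeminorm {s : Fin 4} (m : ℕ) (φK : R3 ≃ᵃ[ℝ] R3) (u : Proxy s) : ℝ :=
  ∑ i, hSeminorm m (fun x => changeCoords s φK u x i) refPyramid

/-- The reference seminorm `|A|_{m,∞,K̂}` of a tensor on `K = φK(K̂)`. -/
def refTensorSeminorm {s : Fin 4} (m : ℕ) (φK : R3 ≃ᵃ[ℝ] R3) (A : Tensor s) : ℝ :=
  ∑ i, ∑ j, wInfSeminorm m (fun x => tensorChangeCoords s φK A x i j) refPyramid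

/-! ### Quadrature -/

/-- The Jacobi polynomial `P_n^{(a,b)}(2t - 1)`, orthogonal on `[0,1]` for `(1-t)^a t^b`. -/
def jacobiPoly (n a b : ℕ) : ℝ[X] :=
  ∑ j ∈ Finset.range (n + 1),
    Polynomial.C (((n + a).choose (n - j) * (n + b).choose j : ℕ) : ℝ) *
      (Polynomial.X - 1) ^ j * Polynomial.X ^ (n - j)

/-- The nodes of the `n`-point Gauss–Jacobi rule on `[0,1]`. -/
def gaussNodes (n a b : ℕ) : Finset ℝ := (jacobiPoly n a b).roots.toFinset

/-- The weights of the `n`-point Gauss–Jacobi rule on `[0,1]`: the weighted integrals of the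
Lagrange basis polynomials of the nodes. -/
def gaussWeight (n a b : ℕ) (x : ℝ) : ℝ :=
  ∫ t in (0 : ℝ)..1, (1 - t) ^ a * t ^ b * (Lagrange.basis (gaussNodes n a b) id x).eval t

/-- The conical product rule `S_{k,K̂}`, from the `k+1` point Gauss–Legendre rule and the
`k+1` point Gauss–Jacobi rule for the weight `(1-t)²`. -/
def quadRef (k : ℕ) (f : R3 → ℝ) : ℝ :=
  ∑ x ∈ gaussNodes (k + 1) 0 0, ∑ y ∈ gaussNodes (k + 1) 0 0, ∑ z ∈ gaussNodes (k + 1) 2 0,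
    f ![x * (1 - z), y * (1 - z), z] *
      (gaussWeight (k + 1) 0 0 x * gaussWeight (k + 1) 0 0 y * gaussWeight (k + 1) 2 0 z)

/-- The quadrature error `E_{k,K̂}` on the reference pyramid. -/
def errRef (k : ℕ) (f : R3 → ℝ) : ℝ := quadRef k f - ∫ x in refPyramid, f x

/-- The factor `|Dφ_K|`: the absolute value of the (constant) Jacobian determinant of `φK`. -/
def jacDet (φK : R3 ≃ᵃ[ℝ] R3) : ℝ := |LinearMap.det (φK.linear : R3 →ₗ[ℝ] R3)|

/-- The quadrature scheme `S_{k,K}` on `K = φK(K̂)`. -/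
def quad (k : ℕ) (φK : R3 ≃ᵃ[ℝ] R3) (f : R3 → ℝ) : ℝ :=
  quadRef k fun x => jacDet φK * f (φK x)

/-- The quadrature error `E_{k,K}(f) = S_{k,K}(f) - ∫_K f` on `K = φK(K̂)`. -/
def err (k : ℕ) (φK : R3 ≃ᵃ[ℝ] R3) (f : R3 → ℝ) : ℝ :=
  quad k φK f - ∫ x in affinePyramid φK, f x

end PyramidFE

end

namespace PyramidFE

/-! ### Calculus of classical partial derivatives on open sets -/

variable {U : Set R3}

/-! Since `A(v,w)` is a scalar, the error on `K` is `jacDet φK` times the error on the reference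
pyramid of a sum of products `a * v * w` of reference components (`tensorApply_affine`,
`err_eq_errRef`). All constants are therefore found on one fixed domain, component by component.

Write `X = ξ/(1-ζ)` and `Y = η/(1-ζ)`. Every reference component of a form in `approxP` is a
combination of `X^a Y^b (1-ζ)^d` with `a, b, d ≤ k` (`weight_mulVec_spaceP_mem`); a component of a
form in `approxX` uses only `d = r` and `a, b ≤ r+1`. In the cube coordinates `(X, Y, ζ)` these are
polynomials. Multiplied by a polynomial of total degree at most `k-r`, a product `v * w` has degree
at most `2k+1` in `X` and in `Y` and at most `2k` in `ζ`. The volume element is `(1-ζ)^2`, the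
Gauss–Jacobi weight, so the conical rule is exact on it (`gauss_exact`, `errRef_eq_zero`,
`errRef_polyFun_mul_eq_zero`).

Hence `a` may be replaced by `a - p` with `p` of degree at most `k-r`, and the error is at most a
constant times the product of the sup norms of `a - p`, `v` and `w` (`exists_errRef_bound`).
Taylor's formula bounds `a - p` by the derivatives of order `k-r+1` (`exists_polyFun_approx`). As
`a` is only a Sobolev function, this is done for smooth approximants that respect the bounds on `a`
and on its weak derivatives (`exists_smooth_approx`), followed by a limit in the error
(`errRef_tendsto`).

The sup norm of `w` is controlled by its `L²` norm because the space is finite-dimensional. For `v`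
the seminorm of order `r` suffices: `v` is homogeneous of degree `r` about the apex, each derivative
lowers the degree by one, and a homogeneous function of positive degree with zero gradient vanishes.
So the seminorm is a norm on this space (`conicHom_eq_zero`, `exists_conicWeighted_bound`). -/

lemma pderiv_contDiffOn (hU : IsOpen U) {f : R3 → ℝ} (hf : ContDiffOn ℝ ∞ f U) (i : Fin 3) :
    ContDiffOn ℝ ∞ (pderiv i f) U := by
  have h : ContDiffOn ℝ ∞ (fderiv ℝ f) U := hf.fderiv_of_isOpen hU (by simp)
  exact h.clm_apply contDiffOn_const

lemma pderiv_congr (hU : IsOpen U) {f g : R3 → ℝ} (h : Set.EqOn f g U) (i : Fin 3) :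
    Set.EqOn (pderiv i f) (pderiv i g) U := by
  intro x hx
  have : f =ᶠ[nhds x] g := Filter.eventuallyEq_of_mem (hU.mem_nhds hx) h
  simp only [pderiv, this.fderiv_eq]

lemma differentiableAt_of_contDiffOn (hU : IsOpen U) {f : R3 → ℝ} (hf : ContDiffOn ℝ ∞ f U)
    {x : R3} (hx : x ∈ U) : DifferentiableAt ℝ f x :=
  (hf.contDiffAt (hU.mem_nhds hx)).differentiableAt (by simp)

lemma pderiv_add (hU : IsOpen U) {f g : R3 → ℝ} (hf : ContDiffOn ℝ ∞ f U)
    (hg : ContDiffOn ℝ ∞ g U) (i : Fin 3) :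
    Set.EqOn (pderiv i (f + g)) (pderiv i f + pderiv i g) U := by
  intro x hx
  simp [pderiv, fderiv_add (differentiableAt_of_contDiffOn hU hf hx)
    (differentiableAt_of_contDiffOn hU hg hx)]

lemma pderiv_smul (hU : IsOpen U) {f : R3 → ℝ} (hf : ContDiffOn ℝ ∞ f U) (c : ℝ) (i : Fin 3) :
    Set.EqOn (pderiv i (c • f)) (c • pderiv i f) U := by
  intro x hx
  simp [pderiv, fderiv_const_smul (differentiableAt_of_contDiffOn hU hf hx)]

lemma pderiv_comm (hU : IsOpen U) {f : R3 → ℝ} (hf : ContDiffOn ℝ ∞ f U) (i j : Fin 3) :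
    Set.EqOn (pderiv i (pderiv j f)) (pderiv j (pderiv i f)) U := by
  intro x hx
  have hx' := hf.contDiffAt (hU.mem_nhds hx)
  have hd : DifferentiableAt ℝ (fderiv ℝ f) x :=
    ((hx'.fderiv_right (m := ∞) (by simp)).differentiableAt (by simp))
  have key : ∀ i j : Fin 3, pderiv i (pderiv j f) x =
      fderiv ℝ (fderiv ℝ f) x (Pi.single i 1) (Pi.single j 1) := by
    intro i j
    unfold pderiv
    rw [fderiv_clm_apply hd (differentiableAt_const _)]
    simp
  rw [key, key]
  exact (hx'.isSymmSndFDerivAt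
    (by simp only [minSmoothness_of_isRCLikeNormedField]; exact ENat.LEInfty.out)).eq _ _

lemma iterate_pderiv_contDiffOn (hU : IsOpen U) {f : R3 → ℝ} (hf : ContDiffOn ℝ ∞ f U)
    (i : Fin 3) (n : ℕ) : ContDiffOn ℝ ∞ ((pderiv i)^[n] f) U := by
  induction n with
  | zero => exact hf
  | succ n ih => rw [Function.iterate_succ_apply']; exact pderiv_contDiffOn hU ih i

lemma iterate_pderiv_congr (hU : IsOpen U) {f g : R3 → ℝ} (h : Set.EqOn f g U)
    (i : Fin 3) (n : ℕ) : Set.EqOn ((pderiv i)^[n] f) ((pderiv i)^[n] g) U := by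
  induction n with
  | zero => exact h
  | succ n ih =>
    rw [Function.iterate_succ_apply', Function.iterate_succ_apply']
    exact pderiv_congr hU ih i

lemma iterate_pderiv_add (hU : IsOpen U) {f g : R3 → ℝ} (hf : ContDiffOn ℝ ∞ f U)
    (hg : ContDiffOn ℝ ∞ g U) (i : Fin 3) (n : ℕ) :
    Set.EqOn ((pderiv i)^[n] (f + g)) ((pderiv i)^[n] f + (pderiv i)^[n] g) U := by
  induction n with
  | zero => exact Set.eqOn_refl _ _
  | succ n ih =>
    simp only [Function.iterate_succ_apply']
    exact (pderiv_congr hU ih i).trans (pderiv_add hU (iterate_pderiv_contDiffOn hU hf i n)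
      (iterate_pderiv_contDiffOn hU hg i n) i)

lemma iterate_pderiv_smul (hU : IsOpen U) {f : R3 → ℝ} (hf : ContDiffOn ℝ ∞ f U) (c : ℝ)
    (i : Fin 3) (n : ℕ) :
    Set.EqOn ((pderiv i)^[n] (c • f)) (c • (pderiv i)^[n] f) U := by
  induction n with
  | zero => exact Set.eqOn_refl _ _
  | succ n ih =>
    simp only [Function.iterate_succ_apply']
    exact (pderiv_congr hU ih i).trans
      (pderiv_smul hU (iterate_pderiv_contDiffOn hU hf i n) c i)

lemma pderiv_iterate_pderiv_comm (hU : IsOpen U) {f : R3 → ℝ} (hf : ContDiffOn ℝ ∞ f U)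
    (i j : Fin 3) (n : ℕ) :
    Set.EqOn (pderiv i ((pderiv j)^[n] f)) ((pderiv j)^[n] (pderiv i f)) U := by
  induction n with
  | zero => exact Set.eqOn_refl _ _
  | succ n ih =>
    simp only [Function.iterate_succ_apply']
    exact (pderiv_comm hU (iterate_pderiv_contDiffOn hU hf j n) i j).trans
      (pderiv_congr hU ih j)

lemma multiDeriv_contDiffOn (hU : IsOpen U) {f : R3 → ℝ} (hf : ContDiffOn ℝ ∞ f U)
    (α : Fin 3 → ℕ) : ContDiffOn ℝ ∞ (multiDeriv α f) U :=
  iterate_pderiv_contDiffOn hU (iterate_pderiv_contDiffOn hU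
    (iterate_pderiv_contDiffOn hU hf _ _) _ _) _ _

lemma multiDeriv_contDiff {f : R3 → ℝ} (hf : ContDiff ℝ ∞ f) (α : Fin 3 → ℕ) :
    ContDiff ℝ ∞ (multiDeriv α f) :=
  contDiffOn_univ.1 (multiDeriv_contDiffOn isOpen_univ hf.contDiffOn α)

lemma multiDeriv_congr (hU : IsOpen U) {f g : R3 → ℝ} (h : Set.EqOn f g U) (α : Fin 3 → ℕ) :
    Set.EqOn (multiDeriv α f) (multiDeriv α g) U :=
  iterate_pderiv_congr hU (iterate_pderiv_congr hU (iterate_pderiv_congr hU h _ _) _ _) _ _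

lemma multiDeriv_add (hU : IsOpen U) {f g : R3 → ℝ} (hf : ContDiffOn ℝ ∞ f U)
    (hg : ContDiffOn ℝ ∞ g U) (α : Fin 3 → ℕ) :
    Set.EqOn (multiDeriv α (f + g)) (multiDeriv α f + multiDeriv α g) U := by
  have h2f := iterate_pderiv_contDiffOn hU hf 2 (α 2)
  have h2g := iterate_pderiv_contDiffOn hU hg 2 (α 2)
  refine (iterate_pderiv_congr hU ((iterate_pderiv_congr hU
    (iterate_pderiv_add hU hf hg 2 _) 1 _).trans (iterate_pderiv_add hU h2f h2g 1 _)) 0 _).trans ?_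
  exact iterate_pderiv_add hU (iterate_pderiv_contDiffOn hU h2f 1 _)
    (iterate_pderiv_contDiffOn hU h2g 1 _) 0 _

lemma multiDeriv_smul (hU : IsOpen U) {f : R3 → ℝ} (hf : ContDiffOn ℝ ∞ f U) (c : ℝ)
    (α : Fin 3 → ℕ) : Set.EqOn (multiDeriv α (c • f)) (c • multiDeriv α f) U := by
  have h2f := iterate_pderiv_contDiffOn hU hf 2 (α 2)
  refine (iterate_pderiv_congr hU ((iterate_pderiv_congr hU
    (iterate_pderiv_smul hU hf c 2 _) 1 _).trans (iterate_pderiv_smul hU h2f c 1 _)) 0 _).trans ?_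
  exact iterate_pderiv_smul hU (iterate_pderiv_contDiffOn hU h2f 1 _) c 0 _

/-- `multiDeriv` applies the partial derivatives in a fixed order, so an extra inner one has to be
commuted into its own slot. -/
lemma multiDeriv_pderiv (hU : IsOpen U) {f : R3 → ℝ} (hf : ContDiffOn ℝ ∞ f U)
    (α : Fin 3 → ℕ) (i : Fin 3) :
    Set.EqOn (multiDeriv α (pderiv i f)) (multiDeriv (α + Pi.single i 1) f) U := by
  have h2f := iterate_pderiv_contDiffOn hU hf 2 (α 2)
  have h1f := iterate_pderiv_contDiffOn hU h2f 1 (α 1)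
  unfold multiDeriv
  fin_cases i
  · simp only [Fin.zero_eta, Pi.add_apply, Pi.single_eq_same, ne_eq, Fin.reduceEq,
      not_false_eq_true, Pi.single_eq_of_ne, add_zero]
    rw [Function.iterate_succ_apply]
    refine iterate_pderiv_congr hU ?_ 0 _
    exact (iterate_pderiv_congr hU (pderiv_iterate_pderiv_comm hU hf 0 2 _).symm 1 _).trans
      (pderiv_iterate_pderiv_comm hU h2f 0 1 _).symm
  · simp only [Fin.mk_one, Pi.add_apply, Pi.single_eq_same, ne_eq, Fin.reduceEq,
      not_false_eq_true, Pi.single_eq_of_ne, add_zero]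
    rw [Function.iterate_succ_apply (pderiv 1)]
    exact iterate_pderiv_congr hU (iterate_pderiv_congr hU
      (pderiv_iterate_pderiv_comm hU hf 1 2 _).symm 1 _) 0 _
  · simp only [Fin.reduceFinMk, Pi.add_apply, Pi.single_eq_same, ne_eq, Fin.reduceEq,
      not_false_eq_true, Pi.single_eq_of_ne, add_zero]
    rw [Function.iterate_succ_apply (pderiv 2)]
    exact Set.eqOn_refl _ _

lemma pderiv_multiDeriv (hU : IsOpen U) {f : R3 → ℝ} (hf : ContDiffOn ℝ ∞ f U)
    (α : Fin 3 → ℕ) (i : Fin 3) :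
    Set.EqOn (pderiv i (multiDeriv α f)) (multiDeriv (α + Pi.single i 1) f) U := by
  refine Set.EqOn.trans ?_ (multiDeriv_pderiv hU hf α i)
  have h2f := iterate_pderiv_contDiffOn hU hf 2 (α 2)
  have h1f := iterate_pderiv_contDiffOn hU h2f 1 (α 1)
  exact (pderiv_iterate_pderiv_comm hU h1f i 0 _).trans (iterate_pderiv_congr hU
    ((pderiv_iterate_pderiv_comm hU h2f i 1 _).trans (iterate_pderiv_congr hU
      (pderiv_iterate_pderiv_comm hU hf i 2 _) 1 _)) 0 _)

lemma multiDeriv_zero (f : R3 → ℝ) : multiDeriv 0 f = f := rfl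

lemma mem_multiIdx {m : ℕ} {α : Fin 3 → ℕ} : α ∈ multiIdx m ↔ ∑ i, α i = m := by
  simp [multiIdx]

lemma sum_add_single (α : Fin 3 → ℕ) (i : Fin 3) :
    ∑ j, (α + Pi.single i 1 : Fin 3 → ℕ) j = ∑ j, α j + 1 := by
  simp [Finset.sum_add_distrib]

/-- Every multi-index of positive order is a successor. -/
lemma exists_eq_add_single {m : ℕ} {α : Fin 3 → ℕ} (h : ∑ i, α i = m + 1) :
    ∃ (β : Fin 3 → ℕ) (i : Fin 3), α = β + Pi.single i 1 ∧ ∑ j, β j = m := by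
  obtain ⟨i, hi⟩ : ∃ i, α i ≠ 0 := by
    by_contra! hc
    simp [hc] at h
  have hα : α = (α - Pi.single i 1) + Pi.single i 1 := by
    ext j
    by_cases hj : j = i
    · subst hj; simp; omega
    · simp [hj]
  refine ⟨α - Pi.single i 1, i, hα, ?_⟩
  have := sum_add_single (α - Pi.single i 1) i
  rw [← hα] at this
  omega

/-- Derivatives of a function precomposed with `y ↦ b + c • y`. -/
lemma multiDeriv_comp_homothety {f : R3 → ℝ} (hf : ContDiff ℝ ∞ f) (b : R3) (c : ℝ)
    (α : Fin 3 → ℕ) (y : R3) :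
    multiDeriv α (fun y => f (b + c • y)) y = c ^ (∑ i, α i) * multiDeriv α f (b + c • y) := by
  have hh : ContDiff ℝ ∞ (fun y : R3 => b + c • y) := by fun_prop
  induction hm : ∑ i, α i generalizing α y with
  | zero =>
    have : α = 0 := by
      ext i
      simpa using (Finset.sum_eq_zero_iff.1 hm) i (Finset.mem_univ i)
    subst this
    simp [multiDeriv_zero]
  | succ m ih =>
    obtain ⟨β, i, rfl, hβ⟩ := exists_eq_add_single hm
    change multiDeriv _ (f ∘ fun y : R3 => b + c • y) y = _
    rw [← pderiv_multiDeriv isOpen_univ (hf.comp hh).contDiffOn β i (Set.mem_univ y),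
      ← pderiv_multiDeriv isOpen_univ hf.contDiffOn β i (Set.mem_univ _)]
    have h1 : multiDeriv β (f ∘ fun y : R3 => b + c • y) =
        fun y => c ^ m * multiDeriv β f (b + c • y) := by
      funext z; exact ih β z hβ
    have hd : DifferentiableAt ℝ (multiDeriv β f) (b + c • y) :=
      (multiDeriv_contDiff hf β).differentiable (by simp) _
    have h2 : HasFDerivAt (fun y : R3 => b + c • y) (c • ContinuousLinearMap.id ℝ R3) y :=
      ((hasFDerivAt_id y).const_smul c).const_add b
    have h3 := (hd.hasFDerivAt.comp y h2).const_mul (c ^ m)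
    rw [h1]
    unfold pderiv
    erw [h3.fderiv]
    simp [pow_succ, mul_assoc]

end PyramidFE

namespace PyramidFE

open MeasureTheory

/-! ### Affine changes of variables -/

lemma affine_apply (φ : R3 ≃ᵃ[ℝ] R3) (x : R3) : φ x = φ.linear x + φ 0 :=
  congrFun (AffineMap.decomp (φ : R3 →ᵃ[ℝ] R3)) x

lemma affine_hasFDerivAt (φ : R3 ≃ᵃ[ℝ] R3) (x : R3) :
    HasFDerivAt φ (LinearMap.toContinuousLinearMap (φ.linear : R3 →ₗ[ℝ] R3)) x := by
  have h : (φ : R3 → R3) =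
      fun x => LinearMap.toContinuousLinearMap (φ.linear : R3 →ₗ[ℝ] R3) x + φ 0 :=
    funext fun x => affine_apply φ x
  rw [h]
  exact (ContinuousLinearMap.hasFDerivAt _).add_const _

lemma affine_contDiff (φ : R3 ≃ᵃ[ℝ] R3) : ContDiff ℝ ∞ φ := by
  have h : (φ : R3 → R3) =
      fun x => LinearMap.toContinuousLinearMap (φ.linear : R3 →ₗ[ℝ] R3) x + φ 0 :=
    funext fun x => affine_apply φ x
  rw [h]
  exact (ContinuousLinearMap.contDiff _).add contDiff_const

/-- An affine bijection as a homeomorphism. -/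
noncomputable def affineHomeo (φ : R3 ≃ᵃ[ℝ] R3) : R3 ≃ₜ R3 where
  toEquiv := φ.toEquiv
  continuous_toFun := (affine_contDiff φ).continuous
  continuous_invFun := (affine_contDiff φ.symm).continuous

lemma affine_det_ne_zero (φ : R3 ≃ᵃ[ℝ] R3) :
    LinearMap.det (φ.linear : R3 →ₗ[ℝ] R3) ≠ 0 :=
  (LinearEquiv.isUnit_det' φ.linear).ne_zero

lemma jacDet_pos (φ : R3 ≃ᵃ[ℝ] R3) : 0 < jacDet φ := abs_pos.2 (affine_det_ne_zero φ)

lemma affine_image_isOpen (φ : R3 ≃ᵃ[ℝ] R3) {V : Set R3} (hV : IsOpen V) : IsOpen (φ '' V) :=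
  (affineHomeo φ).isOpenMap V hV

lemma setIntegral_affine_image (φ : R3 ≃ᵃ[ℝ] R3) {V : Set R3} (hV : IsOpen V) (F : R3 → ℝ) :
    ∫ y in φ '' V, F y = jacDet φ * ∫ x in V, F (φ x) := by
  rw [integral_image_eq_integral_abs_det_fderiv_smul volume hV.measurableSet
    (fun x _ => (affine_hasFDerivAt φ x).hasFDerivWithinAt) φ.injective.injOn]
  rw [← integral_const_mul]
  rfl

/-- Null sets pull back to null sets, which is what carries almost-everywhere bounds from `φ '' V`
to `V`. -/
lemma affine_quasiMeasurePreserving (φ : R3 ≃ᵃ[ℝ] R3) (V : Set R3) :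
    Measure.QuasiMeasurePreserving φ (volume.restrict V) (volume.restrict (φ '' V)) := by
  refine Measure.QuasiMeasurePreserving.restrict ?_ (Set.mapsTo_image _ _)
  have h1 : Measure.QuasiMeasurePreserving (φ.linear : R3 →ₗ[ℝ] R3) volume volume := by
    refine ⟨(LinearMap.continuous_of_finiteDimensional _).measurable, ?_⟩
    rw [Measure.map_linearMap_addHaar_eq_smul_addHaar volume (affine_det_ne_zero φ)]
    exact Measure.smul_absolutelyContinuous
  have h2 := (quasiMeasurePreserving_add_right (volume : Measure R3) (φ 0)).comp h1
  have h : (φ : R3 → R3) = (fun h => h + φ 0) ∘ (φ.linear : R3 →ₗ[ℝ] R3) :=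
    funext fun x => affine_apply φ x
  rw [h]
  exact h2

/-- A partial derivative pulled back by an affine bijection. -/
lemma pderiv_affine (φ : R3 ≃ᵃ[ℝ] R3) {h : R3 → ℝ} (hh : ContDiff ℝ ∞ h) (i : Fin 3) (y : R3) :
    pderiv i h (φ.symm y) =
      ∑ j, φ.linear (Pi.single i 1) j * pderiv j (fun z => h (φ.symm z)) y := by
  have hd : DifferentiableAt ℝ h (φ.symm y) := hh.differentiable (by simp) _
  have h1 := hd.hasFDerivAt.comp y (affine_hasFDerivAt φ.symm y)
  have h2 : ∀ v, fderiv ℝ (fun z => h (φ.symm z)) y v =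
      fderiv ℝ h (φ.symm y) (φ.symm.linear v) := by
    intro v
    erw [h1.fderiv]
    rfl
  have h3 : pderiv i h (φ.symm y) =
      fderiv ℝ (fun z => h (φ.symm z)) y (φ.linear (Pi.single i 1)) := by
    rw [h2]
    simp [pderiv]
  rw [h3]
  conv_lhs => rw [pi_eq_sum_univ' (φ.linear (Pi.single i 1))]
  rw [map_sum]
  refine Finset.sum_congr rfl fun j _ => ?_
  rw [map_smul, smul_eq_mul, pderiv]

/-- A partial derivative of order `m` pulled back by an affine bijection is a linear combination
of partial derivatives of order `m`. -/
lemma exists_multiDeriv_affine (φ : R3 ≃ᵃ[ℝ] R3) (m : ℕ) (α : Fin 3 → ℕ) (hα : ∑ i, α i = m) :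
    ∃ c : (Fin 3 → ℕ) → ℝ, ∀ ψ : R3 → ℝ, ContDiff ℝ ∞ ψ → ∀ y,
      multiDeriv α ψ (φ.symm y) =
        ∑ β ∈ multiIdx m, c β * multiDeriv β (fun z => ψ (φ.symm z)) y := by
  induction m generalizing α with
  | zero =>
    have hα0 : α = 0 := by
      ext i
      simpa using (Finset.sum_eq_zero_iff.1 hα) i (Finset.mem_univ i)
    subst hα0
    refine ⟨fun _ => 1, fun ψ _ y => ?_⟩
    have : multiIdx 0 = {0} := by
      ext β
      rw [mem_multiIdx, Finset.mem_singleton]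
      refine ⟨fun h => ?_, fun h => by simp [h]⟩
      ext i
      simpa using (Finset.sum_eq_zero_iff.1 h) i (Finset.mem_univ i)
    simp [this, multiDeriv_zero]
  | succ m ih =>
    obtain ⟨β, i, rfl, hβ⟩ := exists_eq_add_single hα
    obtain ⟨c, hc⟩ := ih β hβ
    classical
    -- The chain rule adds one index `j` to each `δ`. Different pairs `(δ, j)` can give the same
    -- `γ`, so the coefficient of `γ` collects all of them.
    refine ⟨fun γ => ∑ δ ∈ multiIdx m, ∑ j, if δ + Pi.single j 1 = γ then
      φ.linear (Pi.single i 1) j * c δ else 0, fun ψ hψ y => ?_⟩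
    have hψ' : ContDiff ℝ ∞ (fun z => ψ (φ.symm z)) := hψ.comp (affine_contDiff φ.symm)
    rw [← pderiv_multiDeriv isOpen_univ hψ.contDiffOn β i (Set.mem_univ _),
      pderiv_affine φ (multiDeriv_contDiff hψ β)]
    have h1 : (fun z => multiDeriv β ψ (φ.symm z)) =
        fun z => ∑ δ ∈ multiIdx m, c δ * multiDeriv δ (fun z => ψ (φ.symm z)) z :=
      funext fun z => hc ψ hψ z
    have h2 : ∀ j, pderiv j (fun z => multiDeriv β ψ (φ.symm z)) y =
        ∑ δ ∈ multiIdx m, c δ * multiDeriv (δ + Pi.single j 1) (fun z => ψ (φ.symm z)) y := by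
      intro j
      rw [h1]
      unfold pderiv
      have hd : ∀ δ ∈ multiIdx m, HasFDerivAt
          (fun z => c δ * multiDeriv δ (fun z => ψ (φ.symm z)) z)
          (c δ • fderiv ℝ (multiDeriv δ (fun z => ψ (φ.symm z))) y) y := fun δ _ =>
        ((multiDeriv_contDiff hψ' δ).differentiable (by simp) y).hasFDerivAt.const_mul _
      rw [(HasFDerivAt.fun_sum hd).fderiv, _root_.sum_apply]
      refine Finset.sum_congr rfl fun δ _ => ?_
      rw [← pderiv_multiDeriv isOpen_univ hψ'.contDiffOn δ j (Set.mem_univ _)]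
      rfl
    simp only [h2, Finset.mul_sum, Finset.sum_mul, ite_mul, zero_mul]
    rw [Finset.sum_comm]
    conv_rhs => rw [Finset.sum_comm]
    refine Finset.sum_congr rfl fun δ hδ => ?_
    rw [Finset.sum_comm]
    refine Finset.sum_congr rfl fun j _ => ?_
    rw [Finset.sum_ite_eq, if_pos]
    · ring
    · rw [mem_multiIdx] at hδ ⊢
      rw [sum_add_single, hδ]

/-! ### Weak derivatives -/

lemma integrable_mul_of_tsupport_subset {U : Set R3} {g ψ : R3 → ℝ}
    (hg : LocallyIntegrableOn g U) (hψ : Continuous ψ) (hc : HasCompactSupport ψ)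
    (hs : tsupport ψ ⊆ U) : Integrable (fun x => g x * ψ x) := by
  have h1 := (hg.integrableOn_compact_subset hs hc).mul_continuousOn hψ.continuousOn hc
  refine (integrableOn_iff_integrable_of_support_subset ?_).1 h1
  exact (Function.support_mul_subset_right g ψ).trans (subset_tsupport ψ)

/-- Keeps derivatives of test functions admissible as factors against locally integrable functions
on `U`. -/
lemma multiDeriv_tsupport_subset (ψ : R3 → ℝ) (α : Fin 3 → ℕ) :
    tsupport (multiDeriv α ψ) ⊆ tsupport ψ := by
  have h1 : ∀ (i : Fin 3) (f : R3 → ℝ), tsupport (pderiv i f) ⊆ tsupport f := fun i f =>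
    (closure_mono fun x hx => by
      rw [Function.mem_support] at hx ⊢
      intro h0
      exact hx (by simp [pderiv, h0])).trans (tsupport_fderiv_subset ℝ (f := f))
  have h2 : ∀ (i : Fin 3) (f : R3 → ℝ) (n : ℕ), tsupport ((pderiv i)^[n] f) ⊆ tsupport f := by
    intro i f n
    induction n with
    | zero => exact subset_rfl
    | succ n ih => rw [Function.iterate_succ_apply']; exact (h1 i _).trans ih
  exact (h2 _ _ _).trans ((h2 _ _ _).trans (h2 _ _ _))

lemma multiDeriv_hasCompactSupport {ψ : R3 → ℝ} (h : HasCompactSupport ψ) (α : Fin 3 → ℕ) :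
    HasCompactSupport (multiDeriv α ψ) :=
  h.of_isClosed_subset (isClosed_tsupport _) (multiDeriv_tsupport_subset ψ α)

lemma setIntegral_mul_of_tsupport_subset {U : Set R3} {ψ : R3 → ℝ} (g : R3 → ℝ)
    (hs : tsupport ψ ⊆ U) : ∫ x in U, g x * ψ x = ∫ x, g x * ψ x := by
  refine setIntegral_eq_integral_of_forall_compl_eq_zero fun x hx => ?_
  rw [image_eq_zero_of_notMem_tsupport fun h => hx (hs h), mul_zero]

/-- Weak derivatives are unique almost everywhere. -/
lemma HasWeakDeriv.ae_eq {U : Set R3} (hU : IsOpen U) {α : Fin 3 → ℕ} {f g g' : R3 → ℝ}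
    (h : HasWeakDeriv α f g U) (h' : HasWeakDeriv α f g' U) :
    g =ᵐ[volume.restrict U] g' := by
  have key : ∀ᵐ x, x ∈ U → (g - g') x = 0 := by
    refine hU.ae_eq_zero_of_integral_contDiff_smul_eq_zero (h.2.1.sub h'.2.1) ?_
    intro ψ hψ hc hs
    have e := (h.2.2 ψ hψ hc hs).symm.trans (h'.2.2 ψ hψ hc hs)
    have e' := mul_left_cancel₀ (pow_ne_zero _ (by norm_num)) e
    rw [setIntegral_mul_of_tsupport_subset g hs, setIntegral_mul_of_tsupport_subset g' hs] at e'
    have := integral_sub (integrable_mul_of_tsupport_subset h.2.1 hψ.continuous hc hs)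
      (integrable_mul_of_tsupport_subset h'.2.1 hψ.continuous hc hs)
    rw [e', sub_self] at this
    rw [← this]
    congr 1
    ext x
    simp only [Pi.sub_apply, smul_eq_mul]
    ring
  rw [Filter.EventuallyEq, ae_restrict_iff' hU.measurableSet]
  filter_upwards [key] with x hx hxU
  exact sub_eq_zero.1 (hx hxU)

lemma HasWeakDeriv.add {U : Set R3} {α : Fin 3 → ℕ} {f₁ f₂ g₁ g₂ : R3 → ℝ}
    (h₁ : HasWeakDeriv α f₁ g₁ U) (h₂ : HasWeakDeriv α f₂ g₂ U) :
    HasWeakDeriv α (f₁ + f₂) (g₁ + g₂) U := by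
  refine ⟨h₁.1.add h₂.1, h₁.2.1.add h₂.2.1, fun ψ hψ hc hs => ?_⟩
  have i : ∀ f : R3 → ℝ, LocallyIntegrableOn f U →
      IntegrableOn (fun x => f x * multiDeriv α ψ x) U := fun f hf =>
    (integrable_mul_of_tsupport_subset hf (multiDeriv_contDiff hψ α).continuous
      (multiDeriv_hasCompactSupport hc α)
      ((multiDeriv_tsupport_subset ψ α).trans hs)).integrableOn
  have j : ∀ f : R3 → ℝ, LocallyIntegrableOn f U → IntegrableOn (fun x => f x * ψ x) U :=
    fun f hf => (integrable_mul_of_tsupport_subset hf hψ.continuous hc hs).integrableOn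
  simp only [Pi.add_apply, add_mul]
  rw [integral_add (i _ h₁.1) (i _ h₂.1), integral_add (j _ h₁.2.1) (j _ h₂.2.1),
    h₁.2.2 ψ hψ hc hs, h₂.2.2 ψ hψ hc hs, mul_add]

lemma HasWeakDeriv.const_smul {U : Set R3} {α : Fin 3 → ℕ} {f g : R3 → ℝ}
    (h : HasWeakDeriv α f g U) (c : ℝ) : HasWeakDeriv α (c • f) (c • g) U := by
  refine ⟨h.1.smul c, h.2.1.smul c, fun ψ hψ hc hs => ?_⟩
  simp only [Pi.smul_apply, smul_eq_mul, mul_assoc]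
  rw [integral_const_mul, integral_const_mul, h.2.2 ψ hψ hc hs]
  ring

lemma MemWInf.add {m : ℕ} {U : Set R3} {f g : R3 → ℝ} (hf : MemWInf m f U)
    (hg : MemWInf m g U) : MemWInf m (f + g) U := fun α hα => by
  obtain ⟨f', h1, h2⟩ := hf α hα
  obtain ⟨g', h3, h4⟩ := hg α hα
  exact ⟨f' + g', h1.add h3, h2.add h4⟩

lemma MemWInf.const_smul {m : ℕ} {U : Set R3} {f : R3 → ℝ} (hf : MemWInf m f U) (c : ℝ) :
    MemWInf m (c • f) U := fun α hα => by
  obtain ⟨f', h1, h2⟩ := hf α hα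
  exact ⟨c • f', h1.const_smul c, h2.const_smul c⟩

lemma MemWInf.zero (m : ℕ) (U : Set R3) : MemWInf m 0 U := fun α _ =>
  ⟨0, ⟨locallyIntegrableOn_zero, locallyIntegrableOn_zero, fun ψ _ _ _ => by simp⟩,
    MemLp.zero⟩

lemma MemWInf.sum {ι : Type*} {m : ℕ} {U : Set R3} {f : ι → R3 → ℝ} (s : Finset ι)
    (hf : ∀ i ∈ s, MemWInf m (f i) U) : MemWInf m (∑ i ∈ s, f i) U := by
  classical
  induction s using Finset.induction_on with
  | empty => simpa using MemWInf.zero m U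
  | insert i s hi ih =>
    rw [Finset.sum_insert hi]
    exact (hf i (Finset.mem_insert_self i s)).add
      (ih fun j hj => hf j (Finset.mem_insert_of_mem hj))

/-- A function in `W^{m,∞}` is essentially bounded. -/
lemma MemWInf.memLp {m : ℕ} {U : Set R3} (hU : IsOpen U) {f : R3 → ℝ} (hf : MemWInf m f U) :
    MemLp f ⊤ (volume.restrict U) := by
  obtain ⟨g, h1, h2⟩ := hf 0 (by simp)
  have h3 : HasWeakDeriv 0 f f U := ⟨h1.1, h1.1, fun ψ _ _ _ => by simp [multiDeriv_zero]⟩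
  exact (memLp_congr_ae (h3.ae_eq hU h1)).2 h2

lemma locallyIntegrableOn_of_memLp_top {U : Set R3} {f : R3 → ℝ}
    (hf : MemLp f ⊤ (volume.restrict U)) : LocallyIntegrableOn f U :=
  locallyIntegrableOn_of_locallyIntegrable_restrict (hf.locallyIntegrable (by simp))

lemma memLp_top_comp_affine (φ : R3 ≃ᵃ[ℝ] R3) {V : Set R3} {f : R3 → ℝ}
    (hf : MemLp f ⊤ (volume.restrict (φ '' V))) :
    MemLp (fun x => f (φ x)) ⊤ (volume.restrict V) := by
  have hq := affine_quasiMeasurePreserving φ V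
  have hb : ∀ᵐ y ∂(volume.restrict (φ '' V)),
      ‖f y‖ ≤ (eLpNorm f ⊤ (volume.restrict (φ '' V))).toReal := by
    filter_upwards [ae_le_eLpNormEssSup (f := f) (μ := volume.restrict (φ '' V))] with y hy
    rw [← eLpNorm_exponent_top] at hy
    rw [← toReal_enorm]
    exact ENNReal.toReal_mono hf.2.ne hy
  exact memLp_top_of_bound (hf.1.comp_quasiMeasurePreserving hq) _ (hq.ae hb)

/-- Sobolev regularity is preserved by affine changes of coordinates. -/
lemma MemWInf.comp_affine {m : ℕ} (φ : R3 ≃ᵃ[ℝ] R3) {V : Set R3} (hV : IsOpen V) {f : R3 → ℝ}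
    (hf : MemWInf m f (φ '' V)) : MemWInf m (fun x => f (φ x)) V := by
  intro α hα
  have hU := affine_image_isOpen φ hV
  -- These coefficients do not depend on the test function, so `∑ c β * g β (φ x)` can serve as the
  -- weak derivative of the pulled-back function.
  obtain ⟨c, hc⟩ := exists_multiDeriv_affine φ _ α rfl
  have hex : ∀ β, ∃ g, β ∈ multiIdx (∑ i, α i) → HasWeakDeriv β f g (φ '' V) ∧
      MemLp g ⊤ (volume.restrict (φ '' V)) := by
    intro β
    by_cases hβ : β ∈ multiIdx (∑ i, α i)
    · obtain ⟨g, hg⟩ := hf β (by rw [mem_multiIdx.1 hβ]; exact hα)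
      exact ⟨g, fun _ => hg⟩
    · exact ⟨0, fun h => absurd h hβ⟩
  choose g hg using hex
  have hmem : MemLp (fun x => ∑ β ∈ multiIdx (∑ i, α i), c β * g β (φ x)) ⊤
      (volume.restrict V) :=
    memLp_finsetSum _ fun β hβ => (memLp_top_comp_affine φ (hg β hβ).2).const_mul (c β)
  refine ⟨_, ⟨locallyIntegrableOn_of_memLp_top (memLp_top_comp_affine φ (hf.memLp hU)),
    locallyIntegrableOn_of_memLp_top hmem, fun ψ hψ hcs hs => ?_⟩, hmem⟩
  set ψ' : R3 → ℝ := fun z => ψ (φ.symm z) with hψ'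
  have hψs : ContDiff ℝ ∞ ψ' := hψ.comp (affine_contDiff φ.symm)
  have hcs' : HasCompactSupport ψ' := hcs.comp_homeomorph (affineHomeo φ).symm
  have hs' : tsupport ψ' ⊆ φ '' V := by
    have : tsupport ψ' = (affineHomeo φ).symm ⁻¹' tsupport ψ :=
      tsupport_comp_eq_preimage ψ (affineHomeo φ).symm
    rw [this]
    intro y hy
    exact ⟨φ.symm y, hs hy, by simp⟩
  have hdet := (jacDet_pos φ).ne'
  -- With the Jacobian factor restored, both sides become integrals over `φ '' V`, where the weak
  -- derivatives of `f` are tested against `ψ'`.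
  apply mul_left_cancel₀ hdet
  have e1 := setIntegral_affine_image φ hV (fun y => f y * multiDeriv α ψ (φ.symm y))
  have e2 := setIntegral_affine_image φ hV
    (fun y => (∑ β ∈ multiIdx (∑ i, α i), c β * g β y) * ψ (φ.symm y))
  simp only [AffineEquiv.symm_apply_apply] at e1 e2
  rw [mul_left_comm, ← e1, ← e2]
  simp only [hc ψ hψ, Finset.mul_sum, Finset.sum_mul]
  rw [integral_finsetSum, integral_finsetSum, Finset.mul_sum]
  · refine Finset.sum_congr rfl fun β hβ => ?_
    have h3 := (hg β hβ).1.2.2 ψ' hψs hcs' hs'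
    rw [mem_multiIdx.1 hβ] at h3
    calc ∫ y in φ '' V, f y * (c β * multiDeriv β ψ' y)
        = c β * ∫ y in φ '' V, f y * multiDeriv β ψ' y := by
          rw [← integral_const_mul]; congr 1; ext y; ring
      _ = (-1) ^ (∑ i, α i) * (c β * ∫ y in φ '' V, g β y * ψ' y) := by rw [h3]; ring
      _ = _ := by rw [← integral_const_mul]; congr 2; ext y; simp only [hψ']; ring
  · intro β hβ
    have := (integrable_mul_of_tsupport_subset (hg β hβ).1.2.1 hψs.continuous hcs' hs').const_mul
      (c β)
    refine (this.integrableOn (s := φ '' V)).congr (Filter.Eventually.of_forall fun y => ?_)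
    simp only [hψ']; ring
  · intro β hβ
    have := (integrable_mul_of_tsupport_subset (hg β hβ).1.1
      (multiDeriv_contDiff hψs β).continuous (multiDeriv_hasCompactSupport hcs' β)
      ((multiDeriv_tsupport_subset ψ' β).trans hs')).const_mul (c β)
    refine (this.integrableOn (s := φ '' V)).congr (Filter.Eventually.of_forall fun y => ?_)
    simp only [hψ']; ring

/-- The chosen weak derivatives of a `W^{m,∞}` function are weak derivatives, bounded almost
everywhere by the seminorm. -/
lemma MemWInf.weakDeriv_spec {m n : ℕ} {U : Set R3} (hU : IsOpen U) {f : R3 → ℝ}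
    (hf : MemWInf m f U) (hn : n ≤ m) {α : Fin 3 → ℕ} (hα : ∑ i, α i = n) :
    HasWeakDeriv α f (weakDeriv α f U) U ∧
      ∀ᵐ x ∂(volume.restrict U), |weakDeriv α f U x| ≤ wInfSeminorm n f U := by
  -- `weakDeriv` is an arbitrary choice of weak derivative; almost-everywhere uniqueness gives it
  -- the essential bound of the one supplied by `MemWInf`.
  have hspec : ∀ β : Fin 3 → ℕ, ∑ i, β i = n → HasWeakDeriv β f (weakDeriv β f U) U ∧
      MemLp (weakDeriv β f U) ⊤ (volume.restrict U) := by
    intro β hβ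
    obtain ⟨g, h1, h2⟩ := hf β (hβ.trans_le hn)
    have hex : ∃ g, HasWeakDeriv β f g U := ⟨g, h1⟩
    have h3 : HasWeakDeriv β f (weakDeriv β f U) U := by
      unfold weakDeriv
      rw [dif_pos hex]
      exact hex.choose_spec
    exact ⟨h3, (memLp_congr_ae (h3.ae_eq hU h1)).2 h2⟩
  refine ⟨(hspec α hα).1, ?_⟩
  filter_upwards [ae_le_eLpNormEssSup (f := weakDeriv α f U) (μ := volume.restrict U)] with y hy
  rw [← eLpNorm_exponent_top] at hy
  rw [← Real.norm_eq_abs, ← toReal_enorm]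
  -- Finiteness of the supremum is essential here: `toReal` would send an infinite one to `0`.
  refine ENNReal.toReal_mono ?_ (hy.trans
    (Finset.le_sup (f := fun α => eLpNorm (weakDeriv α f U) ⊤ (volume.restrict U))
      (mem_multiIdx.2 hα)))
  rw [← lt_top_iff_ne_top, Finset.sup_lt_iff (by simp)]
  exact fun β hβ => (hspec β (mem_multiIdx.1 hβ)).2.2

end PyramidFE

namespace PyramidFE

open MeasureTheory Filter
open scoped Topology Convolution

/-! ### Mollification -/

/-- All derivatives fall on the smooth compactly supported factor, so local integrability of `F` is
enough. -/
lemma multiDeriv_convolution {F φ : R3 → ℝ} (hF : LocallyIntegrable F) (hφ : ContDiff ℝ ∞ φ)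
    (hc : HasCompactSupport φ) (L : ℝ →L[ℝ] ℝ →L[ℝ] ℝ) (α : Fin 3 → ℕ) :
    multiDeriv α (F ⋆[L] φ) = F ⋆[L] (multiDeriv α φ) := by
  have h1 : ∀ (i : Fin 3) (φ : R3 → ℝ), ContDiff ℝ ∞ φ → HasCompactSupport φ →
      pderiv i (F ⋆[L] φ) = F ⋆[L] (pderiv i φ) := by
    intro i φ hφ hc
    funext x
    have hd := hc.hasFDerivAt_convolution_right L hF (hφ.of_le (by simp)) x
    unfold pderiv
    rw [hd.fderiv]
    exact convolution_precompR_apply L hF (hc.fderiv ℝ) (hφ.continuous_fderiv (by simp)) x _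
  have hcs : ∀ (i : Fin 3) (φ : R3 → ℝ), HasCompactSupport φ → HasCompactSupport (pderiv i φ) :=
    fun i φ hc => hc.fderiv_apply ℝ _
  have h2 : ∀ (i : Fin 3) (n : ℕ) (φ : R3 → ℝ), ContDiff ℝ ∞ φ → HasCompactSupport φ →
      (pderiv i)^[n] (F ⋆[L] φ) = F ⋆[L] ((pderiv i)^[n] φ) ∧
        ContDiff ℝ ∞ ((pderiv i)^[n] φ) ∧ HasCompactSupport ((pderiv i)^[n] φ) := by
    intro i n
    induction n with
    | zero => exact fun φ hφ hc => ⟨rfl, hφ, hc⟩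
    | succ n ih =>
      intro φ hφ hc
      obtain ⟨e, s, c⟩ := ih φ hφ hc
      simp only [Function.iterate_succ_apply']
      refine ⟨by rw [e, h1 i _ s c], ?_, hcs i _ c⟩
      exact contDiffOn_univ.1 (pderiv_contDiffOn isOpen_univ s.contDiffOn i)
  unfold multiDeriv
  obtain ⟨e2, s2, c2⟩ := h2 2 (α 2) φ hφ hc
  obtain ⟨e1, s1, c1⟩ := h2 1 (α 1) _ s2 c2
  obtain ⟨e0, -, -⟩ := h2 0 (α 0) _ s1 c1
  rw [e2, e1, e0]

/-- Derivatives of a mollified function are bounded by the weak derivatives. -/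
lemma abs_multiDeriv_convolution_le {U : Set R3} (hU : IsOpen U) {α : Fin 3 → ℕ}
    {a g : R3 → ℝ} {M : ℝ} (h : HasWeakDeriv α a g U)
    (hM : ∀ᵐ x ∂(volume.restrict U), |g x| ≤ M) (ha : LocallyIntegrable (U.indicator a))
    (φ : ContDiffBump (0 : R3)) {x : R3} (hx : Metric.closedBall x φ.rOut ⊆ U) :
    |multiDeriv α (φ.normed volume ⋆[ContinuousLinearMap.lsmul ℝ ℝ] (U.indicator a)) x| ≤ M := by
  have hφ : ContDiff ℝ ∞ (φ.normed volume) := φ.contDiff_normed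
  rw [← convolution_flip, multiDeriv_convolution ha hφ φ.hasCompactSupport_normed,
    convolution_def]
  -- The reflected and translated kernel is the test function: its support lies in the closed ball
  -- around `x`, hence in `U`.
  set ψ : R3 → ℝ := fun t => φ.normed volume (x + (-1 : ℝ) • t) with hψ
  have hψs : ContDiff ℝ ∞ ψ := hφ.comp (by fun_prop)
  have hts : tsupport ψ ⊆ Metric.closedBall x φ.rOut := by
    refine closure_minimal (fun t ht => ?_) Metric.isClosed_closedBall
    have h1 : x + (-1 : ℝ) • t ∈ tsupport (φ.normed volume) := subset_tsupport _ ht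
    rw [φ.tsupport_normed_eq, mem_closedBall_zero_iff] at h1
    rw [mem_closedBall_iff_norm']
    simpa [sub_eq_add_neg] using h1
  have hcs : HasCompactSupport ψ :=
    (isCompact_closedBall x φ.rOut).of_isClosed_subset (isClosed_tsupport _) hts
  have hmd := multiDeriv_comp_homothety hφ x (-1) α
  -- Reflecting the kernel produces one sign `(-1)^|α|`; the definition of the weak derivative
  -- produces a second, and the two cancel.
  have e1 : ∀ t, (ContinuousLinearMap.lsmul ℝ ℝ).flip (U.indicator a t)
      (multiDeriv α (φ.normed volume) (x - t)) =
      U.indicator (fun t => (-1) ^ (∑ i, α i) * (a t * multiDeriv α ψ t)) t := by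
    intro t
    by_cases ht : t ∈ U
    · rw [Set.indicator_of_mem ht, Set.indicator_of_mem ht, hψ, hmd t]
      have : ((-1 : ℝ) ^ (∑ i, α i)) * (-1) ^ (∑ i, α i) = 1 := by
        rw [← mul_pow]; simp
      have hxt : x - t = x + (-1 : ℝ) • t := by simp [sub_eq_add_neg]
      rw [hxt]
      simp only [ContinuousLinearMap.flip_apply, ContinuousLinearMap.lsmul_apply, smul_eq_mul]
      linear_combination (-(multiDeriv α (φ.normed volume) (x + (-1 : ℝ) • t) * a t)) * this
    · simp [Set.indicator_of_notMem ht]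
  simp only [e1]
  rw [integral_indicator hU.measurableSet, integral_const_mul, h.2.2 ψ hψs hcs (hts.trans hx),
    ← mul_assoc, ← mul_pow]
  simp only [mul_neg, mul_one, neg_neg, one_pow, one_mul]
  have hψ0 : ∀ t, 0 ≤ ψ t := fun t => φ.nonneg_normed _
  have hψi : Integrable ψ := hψs.continuous.integrable_of_hasCompactSupport hcs
  have hψ1 : ∫ t, ψ t = 1 := by
    have : ∫ t, φ.normed volume (x - t) = ∫ t, φ.normed volume t :=
      integral_sub_left_eq_self _ volume x
    rw [φ.integral_normed] at this
    rw [← this]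
    congr 1
    ext t
    simp [hψ, sub_eq_add_neg]
  have hψU : ∫ t in U, ψ t = 1 := by
    rw [← hψ1]
    refine setIntegral_eq_integral_of_forall_compl_eq_zero fun t ht => ?_
    exact image_eq_zero_of_notMem_tsupport fun h' => ht (hx (hts h'))
  -- What is left is an average of `g` against a nonnegative kernel of mass one.
  calc |∫ t in U, g t * ψ t| ≤ ∫ t in U, M * ψ t := by
        rw [← Real.norm_eq_abs]
        refine norm_integral_le_of_norm_le (hψi.integrableOn.const_mul M) ?_
        filter_upwards [hM] with t ht
        rw [norm_mul, Real.norm_eq_abs, Real.norm_eq_abs, abs_of_nonneg (hψ0 t)]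
        exact mul_le_mul_of_nonneg_right ht (hψ0 t)
    _ = M := by rw [integral_const_mul, hψU, mul_one]

/-- Smooth approximation of a Sobolev function on a convex set, without increase of the bounds. -/
theorem exists_smooth_approx {U : Set R3} (hU : IsOpen U) (hconv : Convex ℝ U)
    (hvol : volume U ≠ ⊤) {x₀ : R3} (hx₀ : x₀ ∈ U) {n : ℕ} {a : R3 → ℝ}
    {g : (Fin 3 → ℕ) → R3 → ℝ} {B M : ℝ}
    (hcont : ContinuousOn a U) (hB : ∀ x ∈ U, |a x| ≤ B)
    (hw : ∀ α : Fin 3 → ℕ, ∑ i, α i = n → HasWeakDeriv α a (g α) U)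
    (hM : ∀ α : Fin 3 → ℕ, ∑ i, α i = n → ∀ᵐ x ∂(volume.restrict U), |g α x| ≤ M) :
    ∃ G : ℕ → R3 → ℝ, (∀ j, ContDiff ℝ ∞ (G j)) ∧ (∀ j, ∀ x ∈ U, |G j x| ≤ B) ∧
      (∀ j, ∀ α : Fin 3 → ℕ, ∑ i, α i = n → ∀ x ∈ U, |multiDeriv α (G j) x| ≤ M) ∧
      ∀ x ∈ U, Tendsto (fun j => G j x) atTop (𝓝 (a x)) := by
  obtain ⟨ρ, hρ, hball⟩ := Metric.isOpen_iff.1 hU x₀ hx₀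
  have haU : IntegrableOn a U := by
    refine IntegrableOn.of_bound (lt_top_iff_ne_top.2 hvol)
      (hcont.aestronglyMeasurable hU.measurableSet) B ?_
    rw [ae_restrict_iff' hU.measurableSet]
    exact Eventually.of_forall hB
  have hF : LocallyIntegrable (U.indicator a) :=
    ((integrable_indicator_iff hU.measurableSet).2 haU).locallyIntegrable
  -- Viewing `a` as its own derivative of order zero lets one mollification bound serve both for
  -- values and for derivatives.
  have ha0 : HasWeakDeriv 0 a a U :=
    ⟨haU.locallyIntegrableOn, haU.locallyIntegrableOn, fun ψ _ _ _ => by simp [multiDeriv_zero]⟩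
  have hBae : ∀ᵐ x ∂(volume.restrict U), |a x| ≤ B := by
    rw [ae_restrict_iff' hU.measurableSet]
    exact Eventually.of_forall hB
  set δ : ℕ → ℝ := fun j => 1 / ((j : ℝ) + 1) with hδ
  have hδ0 : ∀ j, 0 < δ j := fun j => by positivity
  have hδ1 : ∀ j, δ j ≤ 1 := fun j => by
    rw [hδ]; simp only; rw [div_le_one (by positivity)]; linarith [Nat.cast_nonneg (α := ℝ) j]
  have hδt : Tendsto δ atTop (𝓝 0) := tendsto_one_div_add_atTop_nhds_zero_nat
  let φ : ℕ → ContDiffBump (0 : R3) := fun j =>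
    ⟨δ j * ρ / 4, δ j * ρ / 2, by have := hδ0 j; positivity,
      by have := mul_pos (hδ0 j) hρ; linarith⟩
  -- The contracted point is a convex combination of `x₀` and `x`, so by convexity the ball of
  -- radius `ρ` about `x₀`, scaled by `δ j`, fits around it; the mollifier radius `δ j * ρ / 2`
  -- stays inside.
  have hsub : ∀ j, ∀ x ∈ U, Metric.closedBall (δ j • x₀ + (1 - δ j) • x) (φ j).rOut ⊆ U := by
    intro j x hx y hy
    rw [mem_closedBall_iff_norm] at hy
    set e := y - (δ j • x₀ + (1 - δ j) • x) with he
    have h1 : x₀ + (δ j)⁻¹ • e ∈ U := by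
      apply hball
      rw [mem_ball_iff_norm, add_sub_cancel_left, norm_smul, norm_inv,
        Real.norm_of_nonneg (hδ0 j).le, inv_mul_lt_iff₀ (hδ0 j)]
      refine hy.trans_lt ?_
      change δ j * ρ / 2 < _
      have := mul_pos (hδ0 j) hρ
      linarith
    have h2 := hconv h1 hx (hδ0 j).le (sub_nonneg.2 (hδ1 j)) (by ring)
    have h3 : δ j • (x₀ + (δ j)⁻¹ • e) + (1 - δ j) • x = y := by
      rw [smul_add, smul_smul, mul_inv_cancel₀ (hδ0 j).ne', one_smul, he]
      abel
    rwa [h3] at h2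
  set H : ℕ → R3 → ℝ := fun j =>
    (φ j).normed volume ⋆[ContinuousLinearMap.lsmul ℝ ℝ] (U.indicator a) with hH
  have hHs : ∀ j, ContDiff ℝ ∞ (H j) := fun j =>
    (φ j).hasCompactSupport_normed.contDiff_convolution_left _ (φ j).contDiff_normed hF
  -- Mollify, then precompose with the contraction towards `x₀`. This avoids extending `a` beyond
  -- `U`, and the chain rule contributes only powers of `1 - δ j ≤ 1`.
  refine ⟨fun j x => H j (δ j • x₀ + (1 - δ j) • x), fun j => (hHs j).comp (by fun_prop),
    fun j x hx => ?_, fun j α hα x hx => ?_, fun x hx => ?_⟩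
  · exact abs_multiDeriv_convolution_le hU ha0 hBae hF (φ j) (hsub j x hx)
  · rw [multiDeriv_comp_homothety (hHs j), abs_mul, abs_pow,
      abs_of_nonneg (sub_nonneg.2 (hδ1 j))]
    have h1 := abs_multiDeriv_convolution_le hU (hw α hα) (hM α hα) hF (φ j) (hsub j x hx)
    have h2 : (1 - δ j) ^ (∑ i, α i) ≤ 1 :=
      pow_le_one₀ (sub_nonneg.2 (hδ1 j)) (by linarith [hδ0 j])
    calc (1 - δ j) ^ (∑ i, α i) * _ ≤ 1 * M := by
          refine mul_le_mul h2 h1 (abs_nonneg _) zero_le_one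
      _ = M := one_mul M
  · refine ContDiffBump.convolution_tendsto_right (φ := φ) (g := fun _ => U.indicator a)
      (x₀ := x) ?_ ?_ ?_ ?_
    · have : Tendsto (fun j => δ j * ρ / 2) atTop (𝓝 (0 * ρ / 2)) :=
        (hδt.mul_const ρ).div_const 2
      simpa using this
    · exact Eventually.of_forall fun _ => hF.aestronglyMeasurable
    · have hc : ContinuousAt (U.indicator a) x := by
        refine (hcont.continuousAt (hU.mem_nhds hx)).congr ?_
        filter_upwards [hU.mem_nhds hx] with y hy
        rw [Set.indicator_of_mem hy]
      have := hc.tendsto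
      rw [Set.indicator_of_mem hx] at this
      exact this.comp tendsto_snd
    · have : Tendsto (fun j => δ j • x₀ + (1 - δ j) • x) atTop
          (𝓝 ((0 : ℝ) • x₀ + (1 - (0 : ℝ)) • x)) :=
        (hδt.smul_const x₀).add ((tendsto_const_nhds.sub hδt).smul_const x)
      simpa using this

end PyramidFE

namespace PyramidFE

/-! ### Taylor polynomials -/

/-- Polynomial functions of total degree at most `m`. -/
def polyFun (m : ℕ) : Submodule ℝ (R3 → ℝ) :=
  Submodule.span ℝ {f | ∃ a b c : ℕ, a + b + c ≤ m ∧ f = fun p => p 0 ^ a * p 1 ^ b * p 2 ^ c}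

lemma polyFun_mono {m n : ℕ} (h : m ≤ n) : polyFun m ≤ polyFun n :=
  Submodule.span_mono fun _ ⟨a, b, c, h1, h2⟩ => ⟨a, b, c, h1.trans h, h2⟩

lemma const_mem_polyFun (c : ℝ) (m : ℕ) : (fun _ => c) ∈ polyFun m := by
  have h : (fun _ : R3 => c) = c • fun p : R3 => p 0 ^ 0 * p 1 ^ 0 * p 2 ^ 0 := by
    ext p; simp
  rw [h]
  exact Submodule.smul_mem _ _ (Submodule.subset_span ⟨0, 0, 0, by omega, rfl⟩)

lemma coord_mul_mem_polyFun {m : ℕ} {f : R3 → ℝ} (hf : f ∈ polyFun m) (i : Fin 3) :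
    (fun p => p i * f p) ∈ polyFun (m + 1) := by
  refine Submodule.span_induction (p := fun f _ => (fun p => p i * f p) ∈ polyFun (m + 1))
    ?_ ?_ ?_ ?_ hf
  · rintro _ ⟨a, b, c, h, rfl⟩
    refine Submodule.subset_span ?_
    fin_cases i
    · exact ⟨a + 1, b, c, by omega, by ext p; simp; ring⟩
    · exact ⟨a, b + 1, c, by omega, by ext p; simp; ring⟩
    · exact ⟨a, b, c + 1, by omega, by ext p; simp; ring⟩
  · simpa using const_mem_polyFun 0 (m + 1)
  · intro f g _ _ h1 h2
    have : (fun p : R3 => p i * (f + g) p) = (fun p => p i * f p) + fun p => p i * g p := by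
      ext p; simp [mul_add]
    rw [this]
    exact Submodule.add_mem _ h1 h2
  · intro c f _ h1
    have : (fun p : R3 => p i * (c • f) p) = c • fun p => p i * f p := by
      ext p; simp; ring
    rw [this]
    exact Submodule.smul_mem _ _ h1

/-- Directional derivative. -/
noncomputable def dirDeriv (d : R3) (f : R3 → ℝ) : R3 → ℝ := fun x => fderiv ℝ f x d

lemma dirDeriv_eq_sum (d : R3) (f : R3 → ℝ) :
    dirDeriv d f = d 0 • pderiv 0 f + (d 1 • pderiv 1 f + d 2 • pderiv 2 f) := by
  funext x
  unfold dirDeriv pderiv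
  conv_lhs => rw [pi_eq_sum_univ' d]
  rw [map_sum, Fin.sum_univ_three]
  simp [add_assoc]

lemma dirDeriv_contDiff {f : R3 → ℝ} (hf : ContDiff ℝ ∞ f) (d : R3) :
    ContDiff ℝ ∞ (dirDeriv d f) :=
  (hf.fderiv_right (m := ∞) (by simp)).clm_apply contDiff_const

lemma pderiv_contDiff {f : R3 → ℝ} (hf : ContDiff ℝ ∞ f) (i : Fin 3) :
    ContDiff ℝ ∞ (pderiv i f) :=
  (hf.fderiv_right (m := ∞) (by simp)).clm_apply contDiff_const

lemma iterate_dirDeriv_add (d : R3) (j : ℕ) {f g : R3 → ℝ} (hf : ContDiff ℝ ∞ f)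
    (hg : ContDiff ℝ ∞ g) :
    (dirDeriv d)^[j] (f + g) = (dirDeriv d)^[j] f + (dirDeriv d)^[j] g := by
  induction j generalizing f g with
  | zero => rfl
  | succ j ih =>
    simp only [Function.iterate_succ_apply]
    rw [← ih (dirDeriv_contDiff hf d) (dirDeriv_contDiff hg d)]
    congr 1
    funext x
    simp [dirDeriv, fderiv_add (hf.differentiable (by simp) x) (hg.differentiable (by simp) x)]

lemma iterate_dirDeriv_smul (d : R3) (j : ℕ) {f : R3 → ℝ} (hf : ContDiff ℝ ∞ f) (c : ℝ) :
    (dirDeriv d)^[j] (c • f) = c • (dirDeriv d)^[j] f := by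
  induction j generalizing f with
  | zero => rfl
  | succ j ih =>
    simp only [Function.iterate_succ_apply]
    rw [← ih (dirDeriv_contDiff hf d)]
    congr 1
    funext x
    simp [dirDeriv, fderiv_const_smul (hf.differentiable (by simp) x)]

/-- Splitting off one partial derivative drives both inductions below: each step gains one linear
factor in `d`, and three terms. -/
lemma iterate_dirDeriv_succ (d : R3) (j : ℕ) {f : R3 → ℝ} (hf : ContDiff ℝ ∞ f) :
    (dirDeriv d)^[j + 1] f = d 0 • (dirDeriv d)^[j] (pderiv 0 f) +
      (d 1 • (dirDeriv d)^[j] (pderiv 1 f) + d 2 • (dirDeriv d)^[j] (pderiv 2 f)) := by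
  have h := fun i => pderiv_contDiff hf i
  have h' : ∀ i, ContDiff ℝ ∞ (d i • pderiv i f) := fun i => contDiff_const.smul (h i)
  rw [Function.iterate_succ_apply, dirDeriv_eq_sum,
    iterate_dirDeriv_add d j (h' 0) (show ContDiff ℝ ∞ (d 1 • pderiv 1 f + d 2 • pderiv 2 f) from
      (h' 1).add (h' 2)), iterate_dirDeriv_add d j (h' 1) (h' 2),
    iterate_dirDeriv_smul d j (h 0), iterate_dirDeriv_smul d j (h 1),
    iterate_dirDeriv_smul d j (h 2)]

/-- The base point is fixed and only the direction varies, so each differentiation multiplies by a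
coordinate of `x - x₀` and raises the degree by one. -/
lemma iterate_dirDeriv_mem_polyFun (x₀ : R3) (j : ℕ) {f : R3 → ℝ} (hf : ContDiff ℝ ∞ f) :
    (fun x => (dirDeriv (x - x₀))^[j] f x₀) ∈ polyFun j := by
  induction j generalizing f with
  | zero => exact const_mem_polyFun _ _
  | succ j ih =>
    have key : ∀ i, (fun x : R3 => (x - x₀) i * (dirDeriv (x - x₀))^[j] (pderiv i f) x₀) ∈
        polyFun (j + 1) := by
      intro i
      have h := ih (pderiv_contDiff hf i)
      have h1 := coord_mul_mem_polyFun h i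
      have h2 := (polyFun (j + 1)).smul_mem (x₀ i) (polyFun_mono (Nat.le_succ j) h)
      convert (polyFun (j + 1)).sub_mem h1 h2 using 1
      ext x
      simp only [Pi.sub_apply, Pi.smul_apply, smul_eq_mul]
      ring
    convert (polyFun (j + 1)).add_mem (key 0) ((polyFun (j + 1)).add_mem (key 1) (key 2)) using 1
    ext x
    rw [iterate_dirDeriv_succ _ j hf]
    rfl

/-- Expanding `j` directional derivatives gives `3^j` mixed partials, each with a coefficient of
size at most `R^j`. -/
lemma abs_iterate_dirDeriv_le {U : Set R3} {n : ℕ} {f : R3 → ℝ} (hf : ContDiff ℝ ∞ f) {M R : ℝ}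
    (hM : ∀ α : Fin 3 → ℕ, ∑ i, α i = n → ∀ x ∈ U, |multiDeriv α f x| ≤ M) {d : R3}
    (hd : ‖d‖ ≤ R) (j : ℕ) (β : Fin 3 → ℕ) (hβ : ∑ i, β i + j = n) {x : R3} (hx : x ∈ U) :
    |(dirDeriv d)^[j] (multiDeriv β f) x| ≤ (3 * R) ^ j * M := by
  induction j generalizing β with
  | zero => simpa using hM β hβ x hx
  | succ j ih =>
    have hR : 0 ≤ R := (norm_nonneg d).trans hd
    have hi : ∀ i, |d i * (dirDeriv d)^[j] (pderiv i (multiDeriv β f)) x| ≤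
        R * ((3 * R) ^ j * M) := by
      intro i
      have e : pderiv i (multiDeriv β f) = multiDeriv (β + Pi.single i 1) f :=
        funext fun y => pderiv_multiDeriv isOpen_univ hf.contDiffOn β i (Set.mem_univ y)
      rw [e, abs_mul]
      refine mul_le_mul ((norm_le_pi_norm d i).trans hd) (ih _ ?_) (abs_nonneg _) hR
      rw [sum_add_single]; omega
    rw [iterate_dirDeriv_succ d j (multiDeriv_contDiff hf β)]
    simp only [Pi.add_apply, Pi.smul_apply, smul_eq_mul]
    calc _ ≤ R * ((3 * R) ^ j * M) + (R * ((3 * R) ^ j * M) + R * ((3 * R) ^ j * M)) :=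
          (abs_add_le _ _).trans (add_le_add (hi 0) ((abs_add_le _ _).trans
            (add_le_add (hi 1) (hi 2))))
      _ = _ := by ring

lemma iteratedDeriv_comp_line {f : R3 → ℝ} (hf : ContDiff ℝ ∞ f) (x₀ d : R3) (j : ℕ) :
    iteratedDeriv j (fun t : ℝ => f (x₀ + t • d)) =
      fun t => (dirDeriv d)^[j] f (x₀ + t • d) := by
  induction j generalizing f with
  | zero => simp
  | succ j ih =>
    rw [iteratedDeriv_succ']
    have : deriv (fun t : ℝ => f (x₀ + t • d)) = fun t => dirDeriv d f (x₀ + t • d) := by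
      funext t
      have h1 : HasDerivAt (fun t : ℝ => x₀ + t • d) d t := by
        simpa using ((hasDerivAt_id t).smul_const d).const_add x₀
      exact ((hf.differentiable (by simp) _).hasFDerivAt.comp_hasDerivAt t h1).deriv
    rw [this, ih (dirDeriv_contDiff hf d)]
    rfl

/-- Taylor approximation of a smooth function on a convex set. -/
theorem exists_polyFun_approx {U : Set R3} (hconv : Convex ℝ U) {x₀ : R3} (hx₀ : x₀ ∈ U) {R : ℝ}
    (hR : ∀ x ∈ U, ‖x - x₀‖ ≤ R) {m : ℕ} {f : R3 → ℝ} (hf : ContDiff ℝ ∞ f) {M : ℝ}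
    (hM : ∀ α : Fin 3 → ℕ, ∑ i, α i = m + 1 → ∀ x ∈ U, |multiDeriv α f x| ≤ M) :
    ∃ p ∈ polyFun m, ∀ x ∈ U, |f x - p x| ≤ (3 * R) ^ (m + 1) * M := by
  -- The Taylor polynomial at `x₀`, in directional form, so that the one-variable theorem applies
  -- along the segment to `x`.
  refine ⟨fun x => ∑ j ∈ Finset.range (m + 1),
    ((j.factorial : ℝ)⁻¹) * (dirDeriv (x - x₀))^[j] f x₀, ?_, fun x hx => ?_⟩
  · have : (fun x => ∑ j ∈ Finset.range (m + 1),
        ((j.factorial : ℝ)⁻¹) * (dirDeriv (x - x₀))^[j] f x₀) =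
        ∑ j ∈ Finset.range (m + 1),
          ((j.factorial : ℝ)⁻¹) • fun x => (dirDeriv (x - x₀))^[j] f x₀ := by
      ext x; simp
    rw [this]
    refine Submodule.sum_mem _ fun j hj => Submodule.smul_mem _ _ ?_
    exact polyFun_mono (by rw [Finset.mem_range] at hj; omega)
      (iterate_dirDeriv_mem_polyFun x₀ j hf)
  · set h : ℝ → ℝ := fun t => f (x₀ + t • (x - x₀)) with hh
    have hhs : ContDiff ℝ ∞ h := hf.comp (by fun_prop)
    have hit : ∀ j : ℕ, ∀ t ∈ Set.Icc (0 : ℝ) 1, iteratedDerivWithin j h (Set.Icc 0 1) t =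
        (dirDeriv (x - x₀))^[j] f (x₀ + t • (x - x₀)) := by
      intro j t ht
      rw [iteratedDerivWithin_eq_iteratedDeriv (uniqueDiffOn_Icc zero_lt_one)
        ((hhs.of_le (by exact_mod_cast le_top)).contDiffAt) ht, hh, iteratedDeriv_comp_line hf]
    have hseg : ∀ t ∈ Set.Icc (0 : ℝ) 1, x₀ + t • (x - x₀) ∈ U := fun t ht => by
      have := hconv hx₀ hx (sub_nonneg.2 ht.2) ht.1 (by ring)
      convert this using 1
      rw [smul_sub, sub_smul, one_smul]; abel
    -- Nonnegativity of `M` is not assumed; any multi-index of order `m + 1` supplies it.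
    have hM0 : 0 ≤ M := (abs_nonneg _).trans (hM (Pi.single 0 (m + 1)) (by simp) x hx)
    have hb := taylor_mean_remainder_bound (f := h) (a := 0) (b := 1) (x := 1) (n := m)
      (C := (3 * R) ^ (m + 1) * M) zero_le_one
      ((hhs.of_le (by exact_mod_cast le_top)).contDiffOn) (by simp) (fun t ht => by
        rw [hit _ t ht, Real.norm_eq_abs]
        exact abs_iterate_dirDeriv_le hf hM (hR x hx) (m + 1) 0 (by simp) (hseg t ht))
    rw [taylor_within_apply] at hb
    have e : ∑ j ∈ Finset.range (m + 1),
        ((j.factorial : ℝ)⁻¹) * (dirDeriv (x - x₀))^[j] f x₀ =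
        ∑ k ∈ Finset.range (m + 1), ((k.factorial : ℝ)⁻¹ * (1 - 0) ^ k) •
          iteratedDerivWithin k h (Set.Icc 0 1) 0 := by
      refine Finset.sum_congr rfl fun j _ => ?_
      rw [hit j 0 (by simp)]
      simp
    have hfx : f x = h 1 := by simp [hh]
    beta_reduce
    rw [hfx, e, ← Real.norm_eq_abs]
    refine hb.trans ?_
    have hR0 : 0 ≤ R := (norm_nonneg _).trans (hR x hx)
    rw [sub_zero, one_pow, mul_one]
    -- The factor `1/m!` of the remainder is simply dropped.
    exact div_le_self (by positivity) (by exact_mod_cast Nat.one_le_iff_ne_zero.2 m.factorial_ne_zero)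

end PyramidFE

namespace PyramidFE

open Polynomial

/-! ### Gauss–Jacobi quadrature -/

/-- Rodrigues' formula. -/
lemma rodrigues (n a b : ℕ) :
    derivative^[n] ((1 - X : ℝ[X]) ^ (n + a) * X ^ (n + b)) =
      C ((-1) ^ n * (n.factorial : ℝ)) * ((1 - X) ^ a * X ^ b * jacobiPoly n a b) := by
  rw [iterate_derivative_mul, jacobiPoly, Finset.mul_sum, Finset.mul_sum]
  have hd : ∀ N j, derivative^[j] ((1 - X : ℝ[X]) ^ N) =
      C ((-1) ^ j * (N.descFactorial j : ℝ)) * (1 - X) ^ (N - j) := by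
    intro N j
    have h1 : (1 - X : ℝ[X]) ^ N = ((X : ℝ[X]) ^ N).comp (1 - X) := by simp
    rw [h1, iterate_derivative_comp_one_sub_X, iterate_derivative_X_pow_eq_smul, smul_eq_C_mul]
    simp
    ring
  have hx : ∀ N j, derivative^[j] ((X : ℝ[X]) ^ N) =
      C (N.descFactorial j : ℝ) * X ^ (N - j) := by
    intro N j
    rw [iterate_derivative_X_pow_eq_smul, smul_eq_C_mul]
  refine Finset.sum_congr rfl fun j hj => ?_
  have hj' : j ≤ n := by simpa [Nat.lt_succ_iff] using hj
  rw [hd, hx]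
  obtain ⟨i, rfl⟩ := Nat.exists_eq_add_of_le hj'
  have e1 : j + i - j = i := by omega
  have e2 : j + i + a - i = a + j := by omega
  have e3 : j + i + b - j = i + b := by omega
  have e4 : (X - 1 : ℝ[X]) ^ j = C ((-1) ^ j) * (1 - X) ^ j := by
    rw [← neg_sub, neg_pow]; simp
  -- The Leibniz coefficient times the two falling factorials is `n!` times the binomial product in
  -- `jacobiPoly`, where `n = j + i`.
  have e5 : ((j + i).choose j : ℝ) * ((j + i + a).descFactorial i * (j + i + b).descFactorial j) =
      (j + i).factorial * ((j + i + a).choose i * (j + i + b).choose j) := by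
    rw [Nat.descFactorial_eq_factorial_mul_choose, Nat.descFactorial_eq_factorial_mul_choose]
    have := Nat.add_choose_mul_factorial_mul_factorial j i
    rw [← Nat.choose_symm_add, ← Nat.cast_inj (R := ℝ)] at this
    push_cast at this ⊢
    linear_combination ((j + i + a).choose i * (j + i + b).choose j : ℝ) * this
  have e6 : ((-1 : ℝ) ^ j) * (-1) ^ j = 1 := by rw [← mul_pow]; simp
  rw [e1, e2, e3, e4, nsmul_eq_mul, ← C_eq_natCast]
  calc _ = C (((j + i).choose j : ℝ) * ((j + i + a).descFactorial i * (j + i + b).descFactorial j)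
        * (-1) ^ i) * ((1 - X) ^ (a + j) * X ^ (i + b)) := by
          simp only [C_mul]; ring
    _ = C ((-1) ^ (j + i) * ((j + i).factorial : ℝ) *
        (((j + i + a).choose i * (j + i + b).choose j) * (-1) ^ j)) *
          ((1 - X) ^ (a + j) * X ^ (i + b)) := by
          rw [e5]; congr 2
          linear_combination (-((j + i).factorial : ℝ) * ((j + i + a).choose i) *
            ((j + i + b).choose j) * (-1) ^ i) * e6
    _ = _ := by
          simp only [C_mul, Nat.cast_mul]; ring

/-- The weighted integral of a polynomial over the unit interval. -/
noncomputable def jacobiIntegral (a b : ℕ) (f : ℝ[X]) : ℝ :=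
  ∫ t in (0 : ℝ)..1, (1 - t) ^ a * t ^ b * f.eval t

lemma jacobiIntegral_eq (a b : ℕ) (f : ℝ[X]) :
    jacobiIntegral a b f = ∫ t in (0 : ℝ)..1, ((1 - X) ^ a * X ^ b * f).eval t := by
  simp [jacobiIntegral]

lemma jacobiIntegral_add (a b : ℕ) (f g : ℝ[X]) :
    jacobiIntegral a b (f + g) = jacobiIntegral a b f + jacobiIntegral a b g := by
  simp only [jacobiIntegral_eq, mul_add, eval_add]
  exact intervalIntegral.integral_add ((Polynomial.continuous _).intervalIntegrable _ _)
    ((Polynomial.continuous _).intervalIntegrable _ _)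

lemma jacobiIntegral_C_mul (a b : ℕ) (c : ℝ) (f : ℝ[X]) :
    jacobiIntegral a b (C c * f) = c * jacobiIntegral a b f := by
  rw [jacobiIntegral, jacobiIntegral, ← intervalIntegral.integral_const_mul]
  congr 1
  ext t
  simp only [eval_mul, eval_C]
  ring

lemma jacobiIntegral_sum {ι : Type*} (a b : ℕ) (s : Finset ι) (f : ι → ℝ[X]) :
    jacobiIntegral a b (∑ i ∈ s, f i) = ∑ i ∈ s, jacobiIntegral a b (f i) := by
  classical
  induction s using Finset.induction_on with
  | empty => simp [jacobiIntegral]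
  | insert i s hi ih => rw [Finset.sum_insert hi, Finset.sum_insert hi, jacobiIntegral_add, ih]

/-- Integrate by parts `i` times. The boundary terms vanish because lower derivatives of `G` keep a
factor `X` and a factor `X - 1`, and the degree condition makes `q` disappear at the end. -/
lemma integral_iterate_derivative_mul_eq_zero {G : ℝ[X]} {n : ℕ} (h0 : X ^ n ∣ G)
    (h1 : (X - C 1) ^ n ∣ G) (i : ℕ) (hi : i ≤ n) (q : ℝ[X]) (hq : q.degree < i) :
    ∫ t in (0 : ℝ)..1, q.eval t * (derivative^[i] G).eval t = 0 := by
  induction i generalizing q with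
  | zero =>
    have : q = 0 := by simpa using hq
    simp [this]
  | succ i ih =>
    have v0 : (derivative^[i] G).eval 0 = 0 := by
      have := (dvd_pow_self X (by omega : n - i ≠ 0)).trans
        (pow_sub_dvd_iterate_derivative_of_pow_dvd i h0)
      rwa [X_dvd_iff, coeff_zero_eq_eval_zero] at this
    have v1 : (derivative^[i] G).eval 1 = 0 := by
      have := (dvd_pow_self (X - C 1) (by omega : n - i ≠ 0)).trans
        (pow_sub_dvd_iterate_derivative_of_pow_dvd i h1)
      rwa [dvd_iff_isRoot] at this
    have key := intervalIntegral.integral_mul_deriv_eq_deriv_mul (a := 0) (b := 1)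
      (u := fun t => q.eval t) (v := fun t => (derivative^[i] G).eval t)
      (u' := fun t => (derivative q).eval t) (v' := fun t => (derivative^[i + 1] G).eval t)
      (fun t _ => q.hasDerivAt t)
      (fun t _ => by rw [Function.iterate_succ_apply']; exact Polynomial.hasDerivAt _ t)
      ((Polynomial.continuous _).intervalIntegrable _ _)
      ((Polynomial.continuous _).intervalIntegrable _ _)
    rw [key, v0, v1, ih (by omega) (derivative q) ?_]
    · simp
    · by_cases hq0 : q = 0
      · simp [hq0]
      · have h2 := degree_derivative_lt hq0
        rw [degree_eq_natDegree hq0] at hq h2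
        refine h2.trans_le ?_
        have : q.natDegree < i + 1 := by exact_mod_cast hq
        exact_mod_cast Nat.lt_succ_iff.1 this

/-- Orthogonality of the Jacobi polynomials. -/
lemma jacobiIntegral_mul_eq_zero (n a b : ℕ) (q : ℝ[X]) (hq : q.degree < n) :
    jacobiIntegral a b (jacobiPoly n a b * q) = 0 := by
  set G : ℝ[X] := (1 - X) ^ (n + a) * X ^ (n + b) with hG
  have h0 : X ^ n ∣ G := Dvd.dvd.mul_left (pow_dvd_pow _ (by omega)) _
  have h1 : (X - C 1) ^ n ∣ G := by
    refine Dvd.dvd.mul_right ((pow_dvd_pow_of_dvd ?_ n).trans (pow_dvd_pow _ (by omega))) _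
    exact ⟨-1, by simp⟩
  have h := integral_iterate_derivative_mul_eq_zero h0 h1 n le_rfl q hq
  rw [hG, rodrigues] at h
  have hc : ((-1) ^ n * (n.factorial : ℝ)) ≠ 0 := by
    have := n.factorial_ne_zero
    positivity
  apply mul_left_cancel₀ hc
  rw [mul_zero, ← h, ← jacobiIntegral_C_mul, jacobiIntegral]
  congr 1
  ext t
  simp only [eval_mul, eval_C, eval_pow, eval_sub, eval_one, eval_X]
  ring

/-- A nonzero polynomial changes sign in `(0,1)` only at a finite set of its roots. -/
lemma exists_sign_changes (f : ℝ[X]) (hf : f ≠ 0) :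
    ∃ R : Finset ℝ, (∀ x ∈ R, x ∈ Set.Ioo (0 : ℝ) 1 ∧ f.IsRoot x) ∧
      ((∀ t ∈ Set.Ioo (0 : ℝ) 1, 0 ≤ f.eval t * ∏ x ∈ R, (t - x)) ∨
        ∀ t ∈ Set.Ioo (0 : ℝ) 1, f.eval t * ∏ x ∈ R, (t - x) ≤ 0) := by
  classical
  induction hn : f.natDegree generalizing f with
  | zero =>
    refine ⟨∅, by simp, ?_⟩
    rw [eq_C_of_natDegree_eq_zero hn]
    rcases le_total 0 (f.coeff 0) with h | h
    · left; intro t _; simpa using h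
    · right; intro t _; simpa using h
  | succ n ih =>
    by_cases hr : ∃ x ∈ Set.Ioo (0 : ℝ) 1, f.IsRoot x
    · obtain ⟨x, hx, hfx⟩ := hr
      obtain ⟨g, rfl⟩ := dvd_iff_isRoot.2 hfx
      have hg : g ≠ 0 := right_ne_zero_of_mul hf
      have hdeg : g.natDegree = n := by
        rw [natDegree_mul (X_sub_C_ne_zero x) hg, natDegree_X_sub_C] at hn
        omega
      obtain ⟨R, hR, hs⟩ := ih g hg hdeg
      have hR' : ∀ y ∈ R, y ∈ Set.Ioo (0 : ℝ) 1 ∧ ((X - C x) * g).IsRoot y := fun y hy =>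
        ⟨(hR y hy).1, by rw [IsRoot, eval_mul, (hR y hy).2, mul_zero]⟩
      -- Dividing out the root `x` flips the sign pattern at `x`: a sign change of `g` there is
      -- cancelled, and otherwise a new one appears.
      by_cases hxR : x ∈ R
      · refine ⟨R.erase x, fun y hy => hR' y (Finset.mem_of_mem_erase hy), ?_⟩
        have e : ∀ t, eval t ((X - C x) * g) * ∏ y ∈ R.erase x, (t - y) =
            eval t g * ∏ y ∈ R, (t - y) := fun t => by
          rw [← Finset.mul_prod_erase R _ hxR]
          simp only [eval_mul, eval_sub, eval_X, eval_C]
          ring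
        simpa only [e] using hs
      · refine ⟨insert x R, fun y hy => ?_, ?_⟩
        · rcases Finset.mem_insert.1 hy with rfl | hy
          · exact ⟨hx, hfx⟩
          · exact hR' y hy
        · have e : ∀ t, eval t ((X - C x) * g) * ∏ y ∈ insert x R, (t - y) =
              (t - x) ^ 2 * (eval t g * ∏ y ∈ R, (t - y)) := fun t => by
            rw [Finset.prod_insert hxR]
            simp only [eval_mul, eval_sub, eval_X, eval_C]
            ring
          simp only [e]
          rcases hs with hs | hs
          · exact Or.inl fun t ht => mul_nonneg (sq_nonneg _) (hs t ht)
          · exact Or.inr fun t ht => mul_nonpos_of_nonneg_of_nonpos (sq_nonneg _) (hs t ht)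
    · push Not at hr
      refine ⟨∅, by simp, ?_⟩
      simp only [Finset.prod_empty, mul_one]
      -- Without a root in the interval, values of both signs would contradict the intermediate
      -- value theorem.
      by_contra! hcon
      obtain ⟨⟨s, hs, hs'⟩, t, ht, ht'⟩ := hcon
      have hpre : IsPreconnected (Set.Ioo (0 : ℝ) 1) := isPreconnected_Ioo
      obtain ⟨x, hx, hx'⟩ := hpre.intermediate_value hs ht (f := fun t => f.eval t)
        f.continuous.continuousOn ⟨hs'.le, ht'.le⟩
      exact hr x hx hx'

/-- At `1` only the summand `j = 0` survives, and it is a positive binomial coefficient. -/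
lemma jacobiPoly_ne_zero (n a b : ℕ) : jacobiPoly n a b ≠ 0 := by
  intro h
  have h1 : (jacobiPoly n a b).eval 1 = ((n + a).choose n : ℝ) := by
    rw [jacobiPoly, eval_finsetSum, Finset.sum_eq_single 0]
    · simp
    · intro j _ hj
      simp [hj]
    · simp
  rw [h, eval_zero] at h1
  have := Nat.choose_pos (show n ≤ n + a by omega)
  rw [← Nat.cast_pos (α := ℝ)] at this
  linarith

lemma jacobiPoly_natDegree_le (n a b : ℕ) : (jacobiPoly n a b).natDegree ≤ n := by
  refine natDegree_sum_le_of_forall_le _ _ fun j hj => ?_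
  have hj' : j ≤ n := by simpa [Nat.lt_succ_iff] using hj
  have h1 : (X - 1 : ℝ[X]).natDegree ≤ 1 := by
    rw [← C_1, natDegree_X_sub_C]
  calc _ ≤ 0 + j * 1 + (n - j) := by
        refine natDegree_mul_le_of_le (natDegree_mul_le_of_le (natDegree_C _).le
          (natDegree_pow_le_of_le j h1)) (natDegree_X_pow _).le
    _ = n := by omega

/-- A polynomial of constant sign with vanishing weighted integral is zero. -/
lemma eq_zero_of_jacobiIntegral_eq_zero {a b : ℕ} {f : ℝ[X]} (h : jacobiIntegral a b f = 0)
    (h0 : ∀ t ∈ Set.Ioo (0 : ℝ) 1, 0 ≤ f.eval t) : f = 0 := by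
  by_contra hf
  have hg : (1 - X) ^ a * X ^ b * f ≠ 0 := by
    refine mul_ne_zero (mul_ne_zero (pow_ne_zero _ ?_) (pow_ne_zero _ X_ne_zero)) hf
    rw [← neg_sub, neg_ne_zero, ← C_1]
    exact X_sub_C_ne_zero 1
  set g := (1 - X) ^ a * X ^ b * f with hgdef
  have hpos : ∀ t ∈ Set.Ioo (0 : ℝ) 1, 0 ≤ g.eval t := fun t ht => by
    rw [hgdef]
    simp only [eval_mul, eval_pow, eval_sub, eval_one, eval_X]
    exact mul_nonneg (mul_nonneg (pow_nonneg (by linarith [ht.2]) _) (pow_nonneg ht.1.le _))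
      (h0 t ht)
  have hposI : ∀ t ∈ Set.Icc (0 : ℝ) 1, 0 ≤ g.eval t := by
    have hcl : IsClosed {t : ℝ | 0 ≤ g.eval t} := isClosed_le continuous_const g.continuous
    rw [← closure_Ioo zero_ne_one]
    exact fun t ht => closure_minimal (s := Set.Ioo (0 : ℝ) 1) (fun t ht => hpos t ht) hcl ht
  rw [jacobiIntegral_eq] at h
  obtain ⟨t, ht, htr⟩ : ∃ t ∈ Set.Ioo (0 : ℝ) 1, g.eval t ≠ 0 := by
    by_contra! hc
    exact hg (eq_zero_of_infinite_isRoot g ((Set.Ioo_infinite zero_lt_one).mono hc))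
  have := intervalIntegral.integral_pos (a := 0) (b := 1) (f := fun t => g.eval t) zero_lt_one
    g.continuous.continuousOn (fun t ht => hposI t ⟨ht.1.le, ht.2⟩)
    ⟨t, ⟨ht.1.le, ht.2.le⟩, lt_of_le_of_ne (hpos t ht) htr.symm⟩
  exact this.ne' h

/-- The classical argument: with fewer than `n` sign changes, multiplying by the linear factors at
those points would give a nonzero polynomial of constant sign whose weighted integral is zero by
orthogonality. So there are at least `n` sign changes in `(0,1)`, and the degree bound makes them
all the roots. -/
lemma gaussNodes_spec (n a b : ℕ) :
    (gaussNodes n a b).card = n ∧ (∀ x ∈ gaussNodes n a b, x ∈ Set.Ioo (0 : ℝ) 1) ∧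
      (jacobiPoly n a b).natDegree = n := by
  have hP := jacobiPoly_ne_zero n a b
  obtain ⟨R, hR, hs⟩ := exists_sign_changes _ hP
  have hsub : R ⊆ gaussNodes n a b := fun x hx => by
    rw [gaussNodes, Multiset.mem_toFinset, mem_roots hP]
    exact (hR x hx).2
  have hcard : n ≤ R.card := by
    by_contra! hlt
    set q : ℝ[X] := ∏ x ∈ R, (X - C x) with hq
    have hq0 : q ≠ 0 := Finset.prod_ne_zero_iff.2 fun x _ => X_sub_C_ne_zero x
    have hqd : q.degree < n := by
      rw [degree_eq_natDegree hq0, hq, natDegree_finsetProd_X_sub_C_eq_card]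
      exact_mod_cast hlt
    have hev : ∀ t, (jacobiPoly n a b * q).eval t =
        (jacobiPoly n a b).eval t * ∏ x ∈ R, (t - x) := fun t => by
      rw [eval_mul, hq, eval_prod]; simp
    have hz := jacobiIntegral_mul_eq_zero n a b q hqd
    have hne := mul_ne_zero hP hq0
    rcases hs with hs | hs
    · exact hne (eq_zero_of_jacobiIntegral_eq_zero hz fun t ht => by rw [hev]; exact hs t ht)
    · have hz' : jacobiIntegral a b (C (-1) * (jacobiPoly n a b * q)) = 0 := by
        rw [jacobiIntegral_C_mul, hz, mul_zero]
      refine mul_ne_zero (C_ne_zero.2 (by norm_num)) hne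
        (eq_zero_of_jacobiIntegral_eq_zero hz' fun t ht => ?_)
      rw [eval_mul, eval_C, hev]
      linarith [hs t ht]
  have h1 : (gaussNodes n a b).card ≤ (jacobiPoly n a b).natDegree :=
    (Multiset.toFinset_card_le _).trans (card_roots' _)
  have h2 := jacobiPoly_natDegree_le n a b
  have h3 := Finset.card_le_card hsub
  have heq : R = gaussNodes n a b := Finset.eq_of_subset_of_card_le hsub (by omega)
  refine ⟨by omega, fun x hx => ?_, by omega⟩
  rw [← heq] at hx
  exact (hR x hx).1

/-- The Gauss–Jacobi rule with `n` points is exact for polynomials of degree below `2n`. -/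
theorem gauss_exact (n a b : ℕ) (hn : 0 < n) (f : ℝ[X]) (hf : f.natDegree < 2 * n) :
    ∑ x ∈ gaussNodes n a b, gaussWeight n a b x * f.eval x = jacobiIntegral a b f := by
  obtain ⟨hcard, -, hdeg⟩ := gaussNodes_spec n a b
  have hP := jacobiPoly_ne_zero n a b
  set P := jacobiPoly n a b with hPdef
  set q := f / P with hq
  set r := f % P with hr
  -- The multiple of `P` is invisible to both sides: it vanishes at the nodes, and it integrates to
  -- zero since `q` has degree below `n`. The remainder equals its Lagrange interpolant.
  have hfqr : f = P * q + r := (EuclideanDomain.div_add_mod f P).symm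
  have hrd : r.degree < P.degree := EuclideanDomain.mod_lt f hP
  have hqd : q.degree < n := by
    by_cases hq0 : q = 0
    · rw [hq0, degree_zero]; exact WithBot.bot_lt_coe n
    · rw [degree_eq_natDegree hq0]
      have h1 := natDegree_mul hP hq0
      have h2 : P * q = f - r := by rw [hfqr]; ring
      have h3 := natDegree_sub_le f r
      have h4 := natDegree_le_natDegree hrd.le
      rw [h2, hdeg] at h1
      have : q.natDegree < n := by omega
      exact_mod_cast this
  have hre : ∀ x ∈ gaussNodes n a b, f.eval x = r.eval x := fun x hx => by
    have hroot : P.eval x = 0 := by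
      rw [gaussNodes, Multiset.mem_toFinset, mem_roots hP] at hx
      exact hx
    rw [hfqr, eval_add, eval_mul, hroot, zero_mul, zero_add]
  have hlag : r = Lagrange.interpolate (gaussNodes n a b) id fun x => r.eval x := by
    refine Lagrange.eq_interpolate_of_eval_eq _ Function.injective_id.injOn ?_ (fun x _ => rfl)
    rw [hcard]
    rw [degree_eq_natDegree hP, hdeg] at hrd
    exact hrd
  rw [hfqr, jacobiIntegral_add, jacobiIntegral_mul_eq_zero n a b q hqd, zero_add, ← hfqr]
  conv_rhs => rw [hlag, Lagrange.interpolate_apply, jacobiIntegral_sum]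
  refine Finset.sum_congr rfl fun x hx => ?_
  rw [jacobiIntegral_C_mul, hre x hx, mul_comm]
  rfl

end PyramidFE

namespace PyramidFE

open MeasureTheory Filter Polynomial
open scoped Topology

/-! ### The reference pyramid and the conical product rule -/

lemma refPyramid_isOpen : IsOpen refPyramid := by
  refine IsOpen.inter (isOpen_lt continuous_const (continuous_apply 2)) ?_
  refine IsOpen.inter (isOpen_lt continuous_const (continuous_apply 0)) ?_
  refine IsOpen.inter (isOpen_lt (continuous_apply 0) (by fun_prop)) ?_
  exact IsOpen.inter (isOpen_lt continuous_const (continuous_apply 1))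
    (isOpen_lt (continuous_apply 1) (by fun_prop))

lemma refPyramid_convex : Convex ℝ refPyramid := by
  rintro x ⟨h1, h2, h3, h4, h5⟩ y ⟨g1, g2, g3, g4, g5⟩ a b ha hb hab
  have key : ∀ {u v : ℝ}, 0 < u → 0 < v → 0 < a * u + b * v := fun {u v} hu hv => by
    rcases ha.eq_or_lt with rfl | ha
    · rw [zero_add] at hab; subst hab; simpa using hv
    · exact add_pos_of_pos_of_nonneg (mul_pos ha hu) (mul_nonneg hb hv.le)
  have hb' : b = 1 - a := by linarith
  refine ⟨key h1 g1, key h2 g2, ?_, key h4 g4, ?_⟩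
  · have := key (sub_pos.2 h3) (sub_pos.2 g3)
    simp only [Pi.add_apply, Pi.smul_apply, smul_eq_mul]
    rw [hb'] at this ⊢
    linarith
  · have := key (sub_pos.2 h5) (sub_pos.2 g5)
    simp only [Pi.add_apply, Pi.smul_apply, smul_eq_mul]
    rw [hb'] at this ⊢
    linarith

/-- An interior point of the reference pyramid. -/
noncomputable def refPoint : R3 := fun _ => 1 / 4

lemma refPoint_mem : refPoint ∈ refPyramid := by
  unfold refPoint refPyramid
  norm_num

lemma norm_sub_refPoint_le {x : R3} (hx : x ∈ refPyramid) : ‖x - refPoint‖ ≤ 1 := by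
  obtain ⟨h1, h2, h3, h4, h5⟩ := hx
  rw [pi_norm_le_iff_of_nonneg zero_le_one]
  intro i
  rw [Real.norm_eq_abs, abs_le]
  fin_cases i <;> simp [refPoint] <;> constructor <;> linarith

lemma refPyramid_volume_ne_top : volume refPyramid ≠ ⊤ := by
  have h : refPyramid ⊆ Metric.closedBall refPoint 1 := fun x hx => by
    rw [mem_closedBall_iff_norm]; exact norm_sub_refPoint_le hx
  exact ((measure_mono h).trans_lt measure_closedBall_lt_top).ne

/-- The open unit cube. -/
def cube : Set R3 := Set.univ.pi fun _ => Set.Ioo (0 : ℝ) 1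

lemma mem_cube {p : R3} : p ∈ cube ↔ ∀ i, 0 < p i ∧ p i < 1 := by
  simp [cube]

lemma cube_isOpen : IsOpen cube := isOpen_set_pi Set.finite_univ fun _ _ => isOpen_Ioo

/-- The map collapsing the top face of the cube to the apex of the pyramid. -/
def duffy (p : R3) : R3 := ![p 0 * (1 - p 2), p 1 * (1 - p 2), p 2]

lemma duffy_mem {p : R3} (hp : p ∈ cube) : duffy p ∈ refPyramid := by
  rw [mem_cube] at hp
  have h0 := hp 0
  have h1 := hp 1
  have h2 := hp 2
  have h3 : 0 < 1 - p 2 := sub_pos.2 h2.2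
  simp only [refPyramid, duffy, Set.mem_ofPred_eq, Matrix.cons_val_zero, Matrix.cons_val_one,
    Matrix.cons_val]
  exact ⟨h2.1, mul_pos h0.1 h3, by nlinarith, mul_pos h1.1 h3, by nlinarith⟩

/-- The inverse of `duffy`. -/
noncomputable def unduffy (x : R3) : R3 := ![x 0 / (1 - x 2), x 1 / (1 - x 2), x 2]

lemma refPyramid_pos {x : R3} (hx : x ∈ refPyramid) : 0 < 1 - x 2 := hx.2.1.trans hx.2.2.1

lemma unduffy_mem {x : R3} (hx : x ∈ refPyramid) : unduffy x ∈ cube := by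
  have h := refPyramid_pos hx
  obtain ⟨h1, h2, h3, h4, h5⟩ := hx
  rw [mem_cube]
  intro i
  fin_cases i
  · exact ⟨div_pos h2 h, (div_lt_one h).2 h3⟩
  · exact ⟨div_pos h4 h, (div_lt_one h).2 h5⟩
  · exact ⟨h1, sub_pos.1 h⟩

lemma duffy_unduffy {x : R3} (hx : x ∈ refPyramid) : duffy (unduffy x) = x := by
  have h := (refPyramid_pos hx).ne'
  ext i
  fin_cases i <;> simp [duffy, unduffy, h]

lemma duffy_image : duffy '' cube = refPyramid := by
  ext x
  constructor
  · rintro ⟨p, hp, rfl⟩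
    exact duffy_mem hp
  · exact fun hx => ⟨unduffy x, unduffy_mem hx, duffy_unduffy hx⟩

lemma unduffy_duffy {p : R3} (hp : p ∈ cube) : unduffy (duffy p) = p := by
  have h : 1 - p 2 ≠ 0 := (sub_pos.2 (mem_cube.1 hp 2).2).ne'
  ext i
  fin_cases i <;> simp [duffy, unduffy, h]

lemma duffy_injOn : Set.InjOn duffy cube := fun p hp q hq h => by
  rw [← unduffy_duffy hp, ← unduffy_duffy hq, h]

lemma duffy_hasFDerivAt (p : R3) :
    HasFDerivAt duffy (LinearMap.toContinuousLinearMap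
      (Matrix.toLin' !![1 - p 2, 0, -p 0; 0, 1 - p 2, -p 1; 0, 0, 1])) p := by
  have hc : ∀ i : Fin 3, HasFDerivAt (fun x : R3 => x i)
      (ContinuousLinearMap.proj (R := ℝ) (φ := fun _ : Fin 3 => ℝ) i) p := fun i =>
    (ContinuousLinearMap.proj (R := ℝ) (φ := fun _ : Fin 3 => ℝ) i).hasFDerivAt
  rw [hasFDerivAt_pi']
  intro i
  fin_cases i
  · refine ((hc 0).mul ((hc 2).const_sub 1)).congr_fderiv ?_
    ext v
    simp [dotProduct, Fin.sum_univ_three]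
    ring
  · refine ((hc 1).mul ((hc 2).const_sub 1)).congr_fderiv ?_
    ext v
    simp [dotProduct, Fin.sum_univ_three]
    ring
  · refine (hc 2).congr_fderiv ?_
    ext v
    simp [dotProduct, Fin.sum_univ_three]

/-- The Jacobian determinant of `duffy` is `(1 - p 2) ^ 2`, exactly the weight of the Gauss–Jacobi
rule in the third direction. -/
lemma setIntegral_refPyramid (f : R3 → ℝ) :
    ∫ x in refPyramid, f x = ∫ p in cube, (1 - p 2) ^ 2 * f (duffy p) := by
  rw [← duffy_image, integral_image_eq_integral_abs_det_fderiv_smul volume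
    cube_isOpen.measurableSet (fun p _ => (duffy_hasFDerivAt p).hasFDerivWithinAt) duffy_injOn]
  refine setIntegral_congr_fun cube_isOpen.measurableSet fun p _ => ?_
  have : (LinearMap.toContinuousLinearMap
      (Matrix.toLin' !![1 - p 2, 0, -p 0; 0, 1 - p 2, -p 1; 0, 0, 1])).det = (1 - p 2) ^ 2 := by
    rw [ContinuousLinearMap.det, LinearMap.coe_toContinuousLinearMap, LinearMap.det_toLin',
      Matrix.det_fin_three]
    simp
    ring
  simp only [this, smul_eq_mul, abs_of_nonneg (sq_nonneg (1 - p 2))]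

lemma setIntegral_cube_prod (f : Fin 3 → ℝ → ℝ) :
    ∫ p in cube, ∏ i, f i (p i) = ∏ i, ∫ t in (0 : ℝ)..1, f i t := by
  have h1 : (volume : Measure R3).restrict cube =
      Measure.pi fun _ : Fin 3 => (volume : Measure ℝ).restrict (Set.Ioo 0 1) := by
    rw [volume_pi, cube, Measure.restrict_pi_pi]
  rw [h1, integral_fintype_prod_eq_prod]
  refine Finset.prod_congr rfl fun i _ => ?_
  rw [intervalIntegral.integral_of_le zero_le_one, integral_Ioc_eq_integral_Ioo]

/-- The conical product rule is exact for products of polynomials on the cube. -/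
theorem errRef_eq_zero (k : ℕ) {f : R3 → ℝ} {P Q S : ℝ[X]} (hP : P.natDegree ≤ 2 * k + 1)
    (hQ : Q.natDegree ≤ 2 * k + 1) (hS : S.natDegree ≤ 2 * k + 1)
    (hf : ∀ p ∈ cube, f (duffy p) = P.eval (p 0) * Q.eval (p 1) * S.eval (p 2)) :
    errRef k f = 0 := by
  rw [errRef, sub_eq_zero]
  have hI : ∫ x in refPyramid, f x =
      jacobiIntegral 0 0 P * jacobiIntegral 0 0 Q * jacobiIntegral 2 0 S := by
    rw [setIntegral_refPyramid]
    have := setIntegral_cube_prod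
      ![fun t => P.eval t, fun t => Q.eval t, fun t => (1 - t) ^ 2 * S.eval t]
    simp only [Fin.prod_univ_three, Matrix.cons_val_zero, Matrix.cons_val_one,
      Matrix.cons_val] at this
    simp only [jacobiIntegral, pow_zero, one_mul, mul_one]
    rw [← this]
    refine setIntegral_congr_fun cube_isOpen.measurableSet fun p hp => ?_
    simp only [hf p hp]
    ring
  rw [hI, quadRef, ← gauss_exact (k + 1) 0 0 (by omega) P (by omega),
    ← gauss_exact (k + 1) 0 0 (by omega) Q (by omega),
    ← gauss_exact (k + 1) 2 0 (by omega) S (by omega), Finset.sum_mul_sum, Finset.sum_mul]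
  refine Finset.sum_congr rfl fun x hx => ?_
  rw [Finset.sum_mul]
  refine Finset.sum_congr rfl fun y hy => ?_
  rw [Finset.mul_sum]
  refine Finset.sum_congr rfl fun z hz => ?_
  have hmem : ![x, y, z] ∈ cube := by
    rw [mem_cube]
    intro i
    fin_cases i
    · exact (gaussNodes_spec _ _ _).2.1 x hx
    · exact (gaussNodes_spec _ _ _).2.1 y hy
    · exact (gaussNodes_spec _ _ _).2.1 z hz
  have h := hf _ hmem
  simp only [duffy, Matrix.cons_val_zero, Matrix.cons_val_one, Matrix.cons_val] at h
  rw [h]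
  ring

lemma quadNode_mem {k : ℕ} {x y z : ℝ} (hx : x ∈ gaussNodes (k + 1) 0 0)
    (hy : y ∈ gaussNodes (k + 1) 0 0) (hz : z ∈ gaussNodes (k + 1) 2 0) :
    ![x * (1 - z), y * (1 - z), z] ∈ refPyramid := by
  have hmem : ![x, y, z] ∈ cube := by
    rw [mem_cube]
    intro i
    fin_cases i
    · exact (gaussNodes_spec _ _ _).2.1 x hx
    · exact (gaussNodes_spec _ _ _).2.1 y hy
    · exact (gaussNodes_spec _ _ _).2.1 z hz
  exact duffy_mem hmem

/-- The quadrature error depends only on the values in the open pyramid. -/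
lemma errRef_congr (k : ℕ) {f g : R3 → ℝ} (h : Set.EqOn f g refPyramid) :
    errRef k f = errRef k g := by
  unfold errRef quadRef
  congr 1
  · refine Finset.sum_congr rfl fun x hx => Finset.sum_congr rfl fun y hy =>
      Finset.sum_congr rfl fun z hz => ?_
    rw [h (quadNode_mem hx hy hz)]
  · exact setIntegral_congr_fun refPyramid_isOpen.measurableSet h

lemma errRef_add (k : ℕ) {f g : R3 → ℝ} (hf : IntegrableOn f refPyramid)
    (hg : IntegrableOn g refPyramid) : errRef k (f + g) = errRef k f + errRef k g := by
  unfold errRef quadRef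
  simp only [Pi.add_apply, add_mul, Finset.sum_add_distrib]
  rw [integral_add hf hg]
  ring

lemma errRef_smul (k : ℕ) (c : ℝ) (f : R3 → ℝ) : errRef k (c • f) = c * errRef k f := by
  unfold errRef quadRef
  simp only [Pi.smul_apply, smul_eq_mul]
  rw [integral_const_mul, mul_sub, Finset.mul_sum]
  congr 1
  refine Finset.sum_congr rfl fun x _ => ?_
  rw [Finset.mul_sum]
  refine Finset.sum_congr rfl fun y _ => ?_
  rw [Finset.mul_sum]
  exact Finset.sum_congr rfl fun z _ => by ring

lemma errRef_sum {ι : Type*} (k : ℕ) (s : Finset ι) (f : ι → R3 → ℝ)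
    (hf : ∀ i ∈ s, IntegrableOn (f i) refPyramid) :
    errRef k (∑ i ∈ s, f i) = ∑ i ∈ s, errRef k (f i) := by
  classical
  induction s using Finset.induction_on with
  | empty => simp [errRef, quadRef]
  | insert i s hi ih =>
    rw [Finset.sum_insert hi, Finset.sum_insert hi,
      errRef_add k (hf i (Finset.mem_insert_self i s))
        (integrable_finsetSum' _ fun j hj => hf j (Finset.mem_insert_of_mem hj)),
      ih fun j hj => hf j (Finset.mem_insert_of_mem hj)]

/-- The constant is the sum of the absolute weights plus the volume. The bound on `f` must hold
pointwise, since the nodes form a null set. -/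
lemma exists_errRef_bound (k : ℕ) : ∃ C, 0 ≤ C ∧ ∀ (f : R3 → ℝ) (B : ℝ),
    (∀ x ∈ refPyramid, |f x| ≤ B) → |errRef k f| ≤ C * B := by
  refine ⟨(∑ x ∈ gaussNodes (k + 1) 0 0, ∑ y ∈ gaussNodes (k + 1) 0 0,
    ∑ z ∈ gaussNodes (k + 1) 2 0, |gaussWeight (k + 1) 0 0 x * gaussWeight (k + 1) 0 0 y *
      gaussWeight (k + 1) 2 0 z|) + (volume refPyramid).toReal, by positivity, fun f B hB => ?_⟩
  rw [errRef, add_mul]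
  refine (abs_sub _ _).trans (add_le_add ?_ ?_)
  · unfold quadRef
    simp only [Finset.sum_mul]
    refine (Finset.abs_sum_le_sum_abs _ _).trans (Finset.sum_le_sum fun x hx => ?_)
    refine (Finset.abs_sum_le_sum_abs _ _).trans (Finset.sum_le_sum fun y hy => ?_)
    refine (Finset.abs_sum_le_sum_abs _ _).trans (Finset.sum_le_sum fun z hz => ?_)
    rw [abs_mul, mul_comm]
    exact mul_le_mul_of_nonneg_left (hB _ (quadNode_mem hx hy hz)) (abs_nonneg _)
  · rw [← Real.norm_eq_abs]
    have := norm_setIntegral_le_of_norm_le_const (μ := volume) (f := f) (C := B)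
      (lt_top_iff_ne_top.2 refPyramid_volume_ne_top) hB
    rwa [mul_comm] at this

lemma integrableOn_refPyramid {f : R3 → ℝ} {B : ℝ} (hf : ContinuousOn f refPyramid)
    (hB : ∀ x ∈ refPyramid, |f x| ≤ B) : IntegrableOn f refPyramid := by
  refine IntegrableOn.of_bound (lt_top_iff_ne_top.2 refPyramid_volume_ne_top)
    (hf.aestronglyMeasurable refPyramid_isOpen.measurableSet) B ?_
  rw [ae_restrict_iff' refPyramid_isOpen.measurableSet]
  exact Eventually.of_forall hB

/-- Pointwise convergence covers the nodes and dominated convergence covers the integral; no uniform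
convergence of the approximants is needed. -/
lemma errRef_tendsto (k : ℕ) {F : ℕ → R3 → ℝ} {f : R3 → ℝ} {B : ℝ}
    (hF : ∀ j, ContinuousOn (F j) refPyramid) (hB : ∀ j, ∀ x ∈ refPyramid, |F j x| ≤ B)
    (hlim : ∀ x ∈ refPyramid, Tendsto (fun j => F j x) atTop (𝓝 (f x))) :
    Tendsto (fun j => errRef k (F j)) atTop (𝓝 (errRef k f)) := by
  unfold errRef quadRef
  refine Tendsto.sub ?_ ?_
  · refine tendsto_finsetSum _ fun x hx => tendsto_finsetSum _ fun y hy =>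
      tendsto_finsetSum _ fun z hz => ?_
    exact (hlim _ (quadNode_mem hx hy hz)).mul_const _
  · refine tendsto_integral_of_dominated_convergence (fun _ => B)
      (fun j => (hF j).aestronglyMeasurable refPyramid_isOpen.measurableSet)
      (integrableOn_const refPyramid_volume_ne_top) (fun j => ?_) ?_
    · rw [ae_restrict_iff' refPyramid_isOpen.measurableSet]
      exact Eventually.of_forall (hB j)
    · rw [ae_restrict_iff' refPyramid_isOpen.measurableSet]
      exact Eventually.of_forall hlim

end PyramidFE

namespace PyramidFE

open MeasureTheory Filter
open scoped Topology BoundedContinuousFunction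

/-! ### Spaces of conical monomials on the reference pyramid -/

/-- The monomial `x^a y^b (1+z)^{-d}` in reference coordinates. -/
noncomputable def conicMono (a b d : ℕ) : R3 → ℝ :=
  fun x => (x 0 / (1 - x 2)) ^ a * (x 1 / (1 - x 2)) ^ b * (1 - x 2) ^ d

lemma conicMono_contDiffOn (a b d : ℕ) : ContDiffOn ℝ ∞ (conicMono a b d) refPyramid := by
  have h : ∀ x ∈ refPyramid, 1 - x 2 ≠ 0 := fun x hx => (refPyramid_pos hx).ne'
  have hs : ContDiffOn ℝ ∞ (fun x : R3 => 1 - x 2) refPyramid := by fun_prop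
  have h0 : ∀ i, ContDiffOn ℝ ∞ (fun x : R3 => x i / (1 - x 2)) refPyramid := fun i =>
    ContDiffOn.div (by fun_prop) hs h
  exact (((h0 0).pow a).mul ((h0 1).pow b)).mul (hs.pow d)

lemma abs_conicMono_le_one (a b d : ℕ) {x : R3} (hx : x ∈ refPyramid) :
    |conicMono a b d x| ≤ 1 := by
  have hp := refPyramid_pos hx
  obtain ⟨h1, h2, h3, h4, h5⟩ := hx
  unfold conicMono
  rw [abs_of_nonneg (by positivity)]
  refine mul_le_one₀ (mul_le_one₀ (pow_le_one₀ (by positivity) ((div_le_one hp).2 h3.le))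
    (by positivity) (pow_le_one₀ (by positivity) ((div_le_one hp).2 h5.le))) (by positivity)
    (pow_le_one₀ hp.le (by linarith))

lemma pderiv_eq_deriv {f : R3 → ℝ} {x : R3} (hf : DifferentiableAt ℝ f x) (i : Fin 3) :
    pderiv i f x = deriv (fun t => f (Function.update x i t)) (x i) := by
  have h1 : HasDerivAt (Function.update x i) (Pi.single i 1) (x i) := hasDerivAt_update x i (x i)
  have h2 : HasFDerivAt f (fderiv ℝ f x) (Function.update x i (x i)) := by
    rw [Function.update_eq_self]; exact hf.hasFDerivAt
  exact (h2.comp_hasDerivAt (x i) h1).deriv.symm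

/-- Differentiation costs one power of `1 - x 2` and otherwise stays within conical monomials. The
power may not be zero beforehand, whence `d + 1`. -/
lemma pderiv_conicMono (a b d : ℕ) (i : Fin 3) : ∃ (c : ℝ) (a' b' : ℕ),
    Set.EqOn (pderiv i (conicMono a b (d + 1))) (c • conicMono a' b' d) refPyramid := by
  have hdiff : ∀ x ∈ refPyramid, DifferentiableAt ℝ (conicMono a b (d + 1)) x := fun x hx =>
    differentiableAt_of_contDiffOn refPyramid_isOpen (conicMono_contDiffOn a b (d + 1)) hx
  fin_cases i
  -- If `a = 0` the truncated exponent is harmless, as the coefficient is zero.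
  · refine ⟨a, a - 1, b, fun x hx => ?_⟩
    have hp := (refPyramid_pos hx).ne'
    change pderiv 0 _ _ = _
    rw [pderiv_eq_deriv (hdiff x hx)]
    have h : HasDerivAt (fun t => (t / (1 - x 2)) ^ a * (x 1 / (1 - x 2)) ^ b * (1 - x 2) ^ (d + 1))
        (a * (x 0 / (1 - x 2)) ^ (a - 1) * (1 / (1 - x 2)) * (x 1 / (1 - x 2)) ^ b *
          (1 - x 2) ^ (d + 1)) (x 0) :=
      ((((hasDerivAt_id (x 0)).div_const (1 - x 2)).pow a).mul_const _).mul_const _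
    have e : (fun t => conicMono a b (d + 1) (Function.update x 0 t)) =
        fun t => (t / (1 - x 2)) ^ a * (x 1 / (1 - x 2)) ^ b * (1 - x 2) ^ (d + 1) := by
      ext t; simp [conicMono]
    rw [e, h.deriv]
    simp only [conicMono, Pi.smul_apply, smul_eq_mul]
    field_simp
    ring
  · refine ⟨b, a, b - 1, fun x hx => ?_⟩
    have hp := (refPyramid_pos hx).ne'
    change pderiv 1 _ _ = _
    rw [pderiv_eq_deriv (hdiff x hx)]
    have h : HasDerivAt (fun t => (x 0 / (1 - x 2)) ^ a * (t / (1 - x 2)) ^ b * (1 - x 2) ^ (d + 1))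
        ((x 0 / (1 - x 2)) ^ a * (b * (x 1 / (1 - x 2)) ^ (b - 1) * (1 / (1 - x 2))) *
          (1 - x 2) ^ (d + 1)) (x 1) :=
      ((((hasDerivAt_id (x 1)).div_const (1 - x 2)).pow b).const_mul _).mul_const _
    have e : (fun t => conicMono a b (d + 1) (Function.update x 1 t)) =
        fun t => (x 0 / (1 - x 2)) ^ a * (t / (1 - x 2)) ^ b * (1 - x 2) ^ (d + 1) := by
      ext t; simp [conicMono]
    rw [e, h.deriv]
    simp only [conicMono, Pi.smul_apply, smul_eq_mul]
    field_simp
    ring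
  -- As a function of `x 2` alone, the monomial is a constant times `(1 - x 2)^(d + 1 - a - b)`,
  -- which explains the coefficient.
  · refine ⟨a + b - (d + 1), a, b, fun x hx => ?_⟩
    have hp := (refPyramid_pos hx).ne'
    change pderiv 2 _ _ = _
    rw [pderiv_eq_deriv (hdiff x hx)]
    have hs : HasDerivAt (fun t : ℝ => 1 - t) (-1) (x 2) := (hasDerivAt_id (x 2)).const_sub 1
    have hq : ∀ (u : ℝ) (n : ℕ), HasDerivAt (fun t : ℝ => (u / (1 - t)) ^ n)
        (n * (u / (1 - x 2)) ^ n / (1 - x 2)) (x 2) := by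
      intro u n
      have h1 := ((hasDerivAt_const (x 2) u).div hs hp).pow n
      refine h1.congr_deriv ?_
      rcases n with _ | n
      · simp
      · simp only [Nat.add_sub_cancel, Pi.div_apply, pow_succ (u / (1 - x 2))]
        generalize (u / (1 - x 2)) ^ n = q
        field_simp
        ring
    have h := ((hq (x 0) a).mul (hq (x 1) b)).mul (hs.pow (d + 1))
    have e : (fun t => conicMono a b (d + 1) (Function.update x 2 t)) =
        ((fun t : ℝ => (x 0 / (1 - t)) ^ a) * fun t => (x 1 / (1 - t)) ^ b) *
          (fun t : ℝ => 1 - t) ^ (d + 1) := by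
      ext t; simp [conicMono]
    rw [e, h.deriv]
    simp only [conicMono, Pi.smul_apply, smul_eq_mul, Pi.mul_apply, Pi.pow_apply]
    push_cast
    simp only [pow_succ (1 - x 2)]
    generalize (x 0 / (1 - x 2)) ^ a = q
    generalize (x 1 / (1 - x 2)) ^ b = q'
    field_simp
    ring

/-- The conical monomials that are homogeneous of degree `d` about the apex. -/
noncomputable def conicHom (d : ℕ) : Submodule ℝ (R3 → ℝ) :=
  Submodule.span ℝ {f | ∃ a b : ℕ, f = conicMono a b d}

lemma contDiffOn_of_mem_span {S : Set (R3 → ℝ)} {U : Set R3}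
    (hS : ∀ f ∈ S, ContDiffOn ℝ ∞ f U) {f : R3 → ℝ} (hf : f ∈ Submodule.span ℝ S) :
    ContDiffOn ℝ ∞ f U := by
  refine Submodule.span_induction (p := fun f _ => ContDiffOn ℝ ∞ f U) (fun f hf => hS f hf)
    contDiffOn_const (fun f g _ _ hf hg => hf.add hg) (fun c f _ hf => ?_) hf
  exact contDiffOn_const.smul hf

lemma bounded_of_mem_span {S : Set (R3 → ℝ)} {U : Set R3}
    (hS : ∀ f ∈ S, ∃ B, ∀ x ∈ U, |f x| ≤ B) {f : R3 → ℝ} (hf : f ∈ Submodule.span ℝ S) :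
    ∃ B, ∀ x ∈ U, |f x| ≤ B := by
  refine Submodule.span_induction (p := fun f _ => ∃ B, ∀ x ∈ U, |f x| ≤ B) (fun f hf => hS f hf)
    ⟨0, by simp⟩ ?_ ?_ hf
  · rintro f g _ _ ⟨B, hB⟩ ⟨B', hB'⟩
    exact ⟨B + B', fun x hx => (abs_add_le _ _).trans (add_le_add (hB x hx) (hB' x hx))⟩
  · rintro c f _ ⟨B, hB⟩
    refine ⟨|c| * B, fun x hx => ?_⟩
    rw [Pi.smul_apply, smul_eq_mul, abs_mul]
    exact mul_le_mul_of_nonneg_left (hB x hx) (abs_nonneg c)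

lemma conicHom_contDiffOn {d : ℕ} {f : R3 → ℝ} (hf : f ∈ conicHom d) :
    ContDiffOn ℝ ∞ f refPyramid :=
  contDiffOn_of_mem_span (by rintro _ ⟨a, b, rfl⟩; exact conicMono_contDiffOn a b d) hf

lemma conicHom_bounded {d : ℕ} {f : R3 → ℝ} (hf : f ∈ conicHom d) :
    ∃ B, ∀ x ∈ refPyramid, |f x| ≤ B :=
  bounded_of_mem_span (by
    rintro _ ⟨a, b, rfl⟩; exact ⟨1, fun x hx => abs_conicMono_le_one a b d hx⟩) hf

lemma conicHom_pderiv {d : ℕ} {f : R3 → ℝ} (hf : f ∈ conicHom (d + 1)) (i : Fin 3) :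
    ∃ g ∈ conicHom d, Set.EqOn (pderiv i f) g refPyramid := by
  have hU := refPyramid_isOpen
  refine Submodule.span_induction (p := fun f _ => ∃ g ∈ conicHom d,
    Set.EqOn (pderiv i f) g refPyramid) ?_ ?_ ?_ ?_ hf
  · rintro _ ⟨a, b, rfl⟩
    obtain ⟨c, a', b', h⟩ := pderiv_conicMono a b d i
    exact ⟨_, Submodule.smul_mem _ c (Submodule.subset_span ⟨a', b', rfl⟩), h⟩
  · refine ⟨0, Submodule.zero_mem _, fun x _ => ?_⟩
    change fderiv ℝ (fun _ => (0 : ℝ)) x _ = 0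
    simp
  · rintro f g hf hg ⟨f', hf', ef⟩ ⟨g', hg', eg⟩
    refine ⟨f' + g', Submodule.add_mem _ hf' hg', ?_⟩
    exact (pderiv_add hU (conicHom_contDiffOn hf) (conicHom_contDiffOn hg) i).trans
      fun x hx => by simp [ef hx, eg hx]
  · rintro c f hf ⟨f', hf', ef⟩
    refine ⟨c • f', Submodule.smul_mem _ c hf', ?_⟩
    exact (pderiv_smul hU (conicHom_contDiffOn hf) c i).trans fun x hx => by simp [ef hx]

lemma conicHom_multiDeriv {d j : ℕ} {α : Fin 3 → ℕ} (hα : ∑ i, α i = j) {f : R3 → ℝ}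
    (hf : f ∈ conicHom (d + j)) :
    ∃ g ∈ conicHom d, Set.EqOn (multiDeriv α f) g refPyramid := by
  induction j generalizing α f with
  | zero =>
    have : α = 0 := by
      ext i
      simpa using (Finset.sum_eq_zero_iff.1 hα) i (Finset.mem_univ i)
    subst this
    exact ⟨f, hf, fun x _ => rfl⟩
  | succ j ih =>
    obtain ⟨β, i, rfl, hβ⟩ := exists_eq_add_single hα
    obtain ⟨g, hg, e⟩ := conicHom_pderiv (d := d + j) hf i
    obtain ⟨g', hg', e'⟩ := ih hβ hg
    refine ⟨g', hg', ?_⟩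
    exact (multiDeriv_pderiv refPyramid_isOpen (conicHom_contDiffOn hf) β i).symm.trans
      ((multiDeriv_congr refPyramid_isOpen e β).trans e')

/-- The midpoint of a point and the apex. -/
noncomputable def towardApex (x : R3) : R3 := ![x 0 / 2, x 1 / 2, (1 + x 2) / 2]

lemma towardApex_mem {x : R3} (hx : x ∈ refPyramid) : towardApex x ∈ refPyramid := by
  obtain ⟨h1, h2, h3, h4, h5⟩ := hx
  simp only [refPyramid, towardApex, Set.mem_ofPred_eq, Matrix.cons_val_zero, Matrix.cons_val_one,
    Matrix.cons_val]
  refine ⟨?_, ?_, ?_, ?_, ?_⟩ <;> linarith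

/-- Moving halfway to the apex halves `1 - x 2` and leaves both quotients unchanged. -/
lemma conicHom_homogeneous {d : ℕ} {f : R3 → ℝ} (hf : f ∈ conicHom d) (x : R3) :
    f (towardApex x) = (1 / 2) ^ d * f x := by
  refine Submodule.span_induction (p := fun f _ => f (towardApex x) = (1 / 2) ^ d * f x)
    ?_ (by simp) ?_ ?_ hf
  · rintro _ ⟨a, b, rfl⟩
    have h : 1 - (1 + x 2) / 2 = 1 / 2 * (1 - x 2) := by ring
    have h' : ∀ u : ℝ, u / 2 / (1 / 2 * (1 - x 2)) = u / (1 - x 2) := fun u => by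
      rw [div_div]
      congr 1
      ring
    simp only [conicMono, towardApex, Matrix.cons_val_zero, Matrix.cons_val_one, Matrix.cons_val,
      h, h']
    rw [mul_pow]
    ring
  · intro f g _ _ h1 h2
    simp only [Pi.add_apply, h1, h2]; ring
  · intro c f _ h1
    simp only [Pi.smul_apply, smul_eq_mul, h1]; ring

/-- A homogeneous function of degree `r` with vanishing derivatives of order `r` is zero. -/
lemma conicHom_eq_zero {r : ℕ} {f : R3 → ℝ} (hf : f ∈ conicHom r)
    (h : ∀ α : Fin 3 → ℕ, ∑ i, α i = r → ∀ x ∈ refPyramid, multiDeriv α f x = 0) :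
    ∀ x ∈ refPyramid, f x = 0 := by
  induction r generalizing f with
  | zero => exact h 0 (by simp)
  | succ r ih =>
    have hU := refPyramid_isOpen
    have hfs := conicHom_contDiffOn hf
    -- Each partial derivative is homogeneous of degree `r` with vanishing derivatives of order `r`,
    -- so the induction hypothesis kills it.
    have hp : ∀ i, ∀ x ∈ refPyramid, pderiv i f x = 0 := by
      intro i
      obtain ⟨g, hg, e⟩ := conicHom_pderiv hf i
      intro x hx
      rw [e hx]
      refine ih hg (fun α hα y hy => ?_) x hx
      rw [← multiDeriv_congr hU e α hy, multiDeriv_pderiv hU hfs α i hy]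
      exact h _ (by rw [sum_add_single, hα]) y hy
    have hd : Set.EqOn (fderiv ℝ f) 0 refPyramid := by
      intro x hx
      ext v
      have h3 := congrFun (dirDeriv_eq_sum v f) x
      simp only [dirDeriv, Pi.add_apply, Pi.smul_apply, hp _ x hx] at h3
      simpa using h3
    intro x hx
    have h1 := hU.is_const_of_fderiv_eq_zero refPyramid_convex.isPreconnected
      (hfs.differentiableOn (by simp)) hd hx (towardApex_mem hx)
    -- The function is constant, yet halving the distance to the apex multiplies it by `(1/2)^(r+1)
    -- < 1`; so it is zero.
    rw [conicHom_homogeneous hf x] at h1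
    have h2 : ((1 : ℝ) / 2) ^ (r + 1) < 1 := pow_lt_one₀ (by norm_num) (by norm_num) (by omega)
    have h4 : (1 - ((1 : ℝ) / 2) ^ (r + 1)) * f x = 0 := by linarith
    exact (mul_eq_zero.1 h4).resolve_left (by linarith)

/-! ### Equivalence of norms on finite-dimensional spaces -/

/-- `S` factors through the range of `T`, which is finite-dimensional, so the factor is
automatically bounded. -/
lemma exists_norm_le_of_ker_le {E F G : Type*} [AddCommGroup E] [Module ℝ E]
    [FiniteDimensional ℝ E] [NormedAddCommGroup F] [NormedSpace ℝ F] [NormedAddCommGroup G]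
    [NormedSpace ℝ G] (T : E →ₗ[ℝ] F) (S : E →ₗ[ℝ] G) (h : T.ker ≤ S.ker) :
    ∃ C, 0 ≤ C ∧ ∀ e, ‖S e‖ ≤ C * ‖T e‖ := by
  let Q : T.range →ₗ[ℝ] G := (T.ker.liftQ S h).comp T.quotKerEquivRange.symm.toLinearMap
  let Q' : T.range →L[ℝ] G := LinearMap.toContinuousLinearMap Q
  refine ⟨‖Q'‖, Q'.opNorm_nonneg, fun e => ?_⟩
  have h1 : Q' ⟨T e, T.mem_range_self e⟩ = S e := by
    change (T.ker.liftQ S h) (T.quotKerEquivRange.symm ⟨T e, _⟩) = S e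
    have : T.quotKerEquivRange.symm ⟨T e, T.mem_range_self e⟩ = T.ker.mkQ e := by
      rw [LinearEquiv.symm_apply_eq]
      rfl
    rw [this]
    simp
  rw [← h1]
  exact Q'.le_opNorm _

lemma hSeminorm_congr {m : ℕ} {f g : R3 → ℝ} {U : Set R3} (hU : IsOpen U)
    (h : Set.EqOn f g U) : hSeminorm m f U = hSeminorm m g U := by
  unfold hSeminorm
  congr 2
  refine Finset.sum_congr rfl fun α _ => ?_
  rw [eLpNorm_congr_ae]
  rw [EventuallyEq, ae_restrict_iff' hU.measurableSet]
  exact Eventually.of_forall fun x hx => multiDeriv_congr hU h α hx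

lemma hSeminorm_nonneg (m : ℕ) (f : R3 → ℝ) (U : Set R3) : 0 ≤ hSeminorm m f U :=
  Real.sqrt_nonneg _

/-- On a finite-dimensional space on which it is a norm, the `H^r` seminorm controls the
supremum. -/
theorem exists_abs_le_hSeminorm (r : ℕ) (V : Submodule ℝ (R3 → ℝ)) [FiniteDimensional ℝ V]
    (hs : ∀ f ∈ V, ContDiffOn ℝ ∞ f refPyramid)
    (hb : ∀ f ∈ V, ∃ B, ∀ x ∈ refPyramid, |f x| ≤ B)
    (hd : ∀ f ∈ V, ∀ α : Fin 3 → ℕ, ∑ i, α i = r →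
      ∃ B, ∀ x ∈ refPyramid, |multiDeriv α f x| ≤ B)
    (hk : ∀ f ∈ V, (∀ α : Fin 3 → ℕ, ∑ i, α i = r → ∀ x ∈ refPyramid, multiDeriv α f x = 0) →
      ∀ x ∈ refPyramid, f x = 0) :
    ∃ C, 0 ≤ C ∧ ∀ f ∈ V, ∀ x ∈ refPyramid, |f x| ≤ C * hSeminorm r f refPyramid := by
  have hU := refPyramid_isOpen
  have : IsFiniteMeasure (volume.restrict refPyramid) :=
    ⟨by rw [Measure.restrict_apply_univ]; exact lt_top_iff_ne_top.2 refPyramid_volume_ne_top⟩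
  have hmem : ∀ f ∈ V, ∀ α ∈ multiIdx r,
      MemLp (multiDeriv α f) 2 (volume.restrict refPyramid) := by
    intro f hf α hα
    obtain ⟨B, hB⟩ := hd f hf α (mem_multiIdx.1 hα)
    refine MemLp.of_bound ((multiDeriv_contDiffOn hU (hs f hf) α).continuousOn.aestronglyMeasurable
      hU.measurableSet) B ?_
    rw [ae_restrict_iff' hU.measurableSet]
    exact Eventually.of_forall hB
  have hae : ∀ {f g : R3 → ℝ}, Set.EqOn f g refPyramid → f =ᵐ[volume.restrict refPyramid] g := by
    intro f g h
    rw [EventuallyEq, ae_restrict_iff' hU.measurableSet]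
    exact Eventually.of_forall h
  -- `T` records the derivatives of order `r` in `L²`, and `S` below the function itself in the sup
  -- norm; the claim is that `T` dominates `S`.
  let T : V →ₗ[ℝ] (multiIdx r → Lp ℝ 2 (volume.restrict refPyramid)) :=
    { toFun := fun f α => (hmem f.1 f.2 α.1 α.2).toLp
      map_add' := fun f g => by
        ext1 α
        rw [Pi.add_apply, ← MemLp.toLp_add, MemLp.toLp_eq_toLp_iff]
        exact hae (multiDeriv_add hU (hs f.1 f.2) (hs g.1 g.2) α.1)
      map_smul' := fun c f => by
        ext1 α
        rw [Pi.smul_apply, RingHom.id_apply, ← MemLp.toLp_const_smul, MemLp.toLp_eq_toLp_iff]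
        exact hae (multiDeriv_smul hU (hs f.1 f.2) c α.1) }
  choose B hB using hb
  let S : V →ₗ[ℝ] (refPyramid →ᵇ ℝ) :=
    { toFun := fun f => BoundedContinuousFunction.ofNormedAddCommGroup
        (fun x : refPyramid => f.1 x.1) ((hs f.1 f.2).continuousOn.domRestrict)
        (B f.1 f.2) (fun x => hB f.1 f.2 x.1 x.2)
      map_add' := fun f g => by ext x; rfl
      map_smul' := fun c f => by ext x; rfl }
  have hker : T.ker ≤ S.ker := by
    intro f hf
    rw [LinearMap.mem_ker] at hf ⊢
    ext x
    refine hk f.1 f.2 (fun α hα => ?_) x.1 x.2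
    have h1 : (hmem f.1 f.2 α (mem_multiIdx.2 hα)).toLp = 0 :=
      congrFun hf ⟨α, mem_multiIdx.2 hα⟩
    have h2 : multiDeriv α f.1 =ᵐ[volume.restrict refPyramid] (fun _ => 0) :=
      ((hmem f.1 f.2 α (mem_multiIdx.2 hα)).coeFn_toLp.symm.trans (by rw [h1])).trans
        (Lp.coeFn_zero ℝ 2 _)
    -- Continuity upgrades vanishing almost everywhere to vanishing at every point, as `hk`
    -- requires.
    exact Measure.eqOn_open_of_ae_eq h2 hU
      (multiDeriv_contDiffOn hU (hs f.1 f.2) α).continuousOn continuousOn_const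
  obtain ⟨C, hC0, hC⟩ := exists_norm_le_of_ker_le T S hker
  refine ⟨C, hC0, fun f hf x hx => ?_⟩
  have h1 : |f x| ≤ ‖S ⟨f, hf⟩‖ := (S ⟨f, hf⟩).norm_coe_le_norm ⟨x, hx⟩
  refine h1.trans ((hC ⟨f, hf⟩).trans (mul_le_mul_of_nonneg_left ?_ hC0))
  rw [pi_norm_le_iff_of_nonneg (hSeminorm_nonneg _ _ _)]
  intro α
  have h2 : ‖T ⟨f, hf⟩ α‖ =
      (eLpNorm (multiDeriv α.1 f) 2 (volume.restrict refPyramid)).toReal :=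
    Lp.norm_toLp _ (hmem f hf α.1 α.2)
  rw [h2, hSeminorm]
  refine Real.le_sqrt_of_sq_le ?_
  rw [← ENNReal.toReal_pow]
  refine ENNReal.toReal_mono ?_ (Finset.single_le_sum (f := fun α =>
    eLpNorm (multiDeriv α f) 2 (volume.restrict refPyramid) ^ 2) (fun _ _ => zero_le) α.2)
  rw [ENNReal.sum_ne_top]
  exact fun β hβ => ENNReal.pow_ne_top (hmem f hf β hβ).2.ne

end PyramidFE

namespace PyramidFE

open MeasureTheory Filter
open scoped Topology Pointwise

/-! ### The error estimate for scalar factors -/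

/-- The reference components of the shape functions of order `k`. -/
noncomputable def conicShape (k : ℕ) : Submodule ℝ (R3 → ℝ) :=
  Submodule.span ℝ {f | ∃ a b d : ℕ, a ≤ k ∧ b ≤ k ∧ d ≤ k ∧ f = conicMono a b d}

/-- The reference components of the `r`-weighted fields. -/
noncomputable def conicWeighted (r : ℕ) : Submodule ℝ (R3 → ℝ) :=
  Submodule.span ℝ {f | ∃ a b : ℕ, a ≤ r + 1 ∧ b ≤ r + 1 ∧ f = conicMono a b r}

instance finiteDimensional_conicShape (k : ℕ) : FiniteDimensional ℝ (conicShape k) := by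
  classical
  refine FiniteDimensional.span_of_finite ℝ (Set.Finite.subset (Finset.finite_toSet
    ((Finset.range (k + 1) ×ˢ Finset.range (k + 1) ×ˢ Finset.range (k + 1)).image
      fun t => conicMono t.1 t.2.1 t.2.2)) ?_)
  rintro _ ⟨a, b, d, ha, hb, hd, rfl⟩
  rw [Finset.mem_coe, Finset.mem_image]
  exact ⟨(a, b, d), by simp; omega, rfl⟩

instance finiteDimensional_conicWeighted (r : ℕ) : FiniteDimensional ℝ (conicWeighted r) := by
  classical
  refine FiniteDimensional.span_of_finite ℝ (Set.Finite.subset (Finset.finite_toSet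
    ((Finset.range (r + 2) ×ˢ Finset.range (r + 2)).image fun t => conicMono t.1 t.2 r)) ?_)
  rintro _ ⟨a, b, ha, hb, rfl⟩
  rw [Finset.mem_coe, Finset.mem_image]
  exact ⟨(a, b), by simp; omega, rfl⟩

lemma conicShape_contDiffOn {k : ℕ} {f : R3 → ℝ} (hf : f ∈ conicShape k) :
    ContDiffOn ℝ ∞ f refPyramid :=
  contDiffOn_of_mem_span
    (by rintro _ ⟨a, b, d, -, -, -, rfl⟩; exact conicMono_contDiffOn a b d) hf

lemma conicShape_bounded {k : ℕ} {f : R3 → ℝ} (hf : f ∈ conicShape k) :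
    ∃ B, ∀ x ∈ refPyramid, |f x| ≤ B :=
  bounded_of_mem_span (by
    rintro _ ⟨a, b, d, -, -, -, rfl⟩
    exact ⟨1, fun x hx => abs_conicMono_le_one a b d hx⟩) hf

lemma conicWeighted_le_conicHom (r : ℕ) : conicWeighted r ≤ conicHom r :=
  Submodule.span_mono fun _ ⟨a, b, _, _, h⟩ => ⟨a, b, h⟩

lemma exists_conicShape_bound (k : ℕ) : ∃ C, 0 ≤ C ∧ ∀ f ∈ conicShape k, ∀ x ∈ refPyramid,
    |f x| ≤ C * hSeminorm 0 f refPyramid := by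
  have h0 : ∀ α : Fin 3 → ℕ, ∑ i, α i = 0 → α = 0 := fun α hα => by
    ext i
    simpa using (Finset.sum_eq_zero_iff.1 hα) i (Finset.mem_univ i)
  refine exists_abs_le_hSeminorm 0 (conicShape k) (fun f hf => conicShape_contDiffOn hf)
    (fun f hf => conicShape_bounded hf) (fun f hf α hα => ?_) (fun f _ h => h 0 (by simp))
  rw [h0 α hα, multiDeriv_zero]
  exact conicShape_bounded hf

/-- The exact `r`-weighting is used twice: derivatives of order `r` are homogeneous of degree zero,
hence bounded up to the apex, and the seminorm has trivial kernel. -/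
lemma exists_conicWeighted_bound (r : ℕ) : ∃ C, 0 ≤ C ∧ ∀ f ∈ conicWeighted r,
    ∀ x ∈ refPyramid, |f x| ≤ C * hSeminorm r f refPyramid := by
  have hle := conicWeighted_le_conicHom r
  refine exists_abs_le_hSeminorm r (conicWeighted r) (fun f hf => conicHom_contDiffOn (hle hf))
    (fun f hf => conicHom_bounded (hle hf)) (fun f hf α hα => ?_)
    (fun f hf h => conicHom_eq_zero (hle hf) h)
  obtain ⟨g, hg, e⟩ := conicHom_multiDeriv (d := 0) hα (by rw [zero_add]; exact hle hf)
  obtain ⟨B, hB⟩ := conicHom_bounded hg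
  exact ⟨B, fun x hx => by rw [e hx]; exact hB x hx⟩

/-- In cube coordinates the rational functions become polynomials, which is why a product rule can
integrate them exactly. -/
lemma conicMono_duffy (a b d : ℕ) {p : R3} (hp : p ∈ cube) :
    conicMono a b d (duffy p) = p 0 ^ a * p 1 ^ b * (1 - p 2) ^ d := by
  have h : 1 - p 2 ≠ 0 := (sub_pos.2 (mem_cube.1 hp 2).2).ne'
  simp only [conicMono, duffy, Matrix.cons_val_zero, Matrix.cons_val_one, Matrix.cons_val]
  rw [mul_div_cancel_right₀ _ h, mul_div_cancel_right₀ _ h]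

/-- The quadrature rule integrates exactly the products of shape functions, weighted fields and
polynomials. -/
lemma errRef_polyFun_mul_eq_zero {k m r : ℕ} (h : m + r ≤ k) {p v w : R3 → ℝ}
    (hp : p ∈ polyFun m) (hv : v ∈ conicWeighted r) (hw : w ∈ conicShape k) :
    IntegrableOn (p * v * w) refPyramid ∧ errRef k (p * v * w) = 0 := by
  -- Exactness is a linear condition once integrability is included, so it only has to be checked on
  -- products of generators.
  let Z : Submodule ℝ (R3 → ℝ) :=
    { carrier := {f | IntegrableOn f refPyramid volume ∧ errRef k f = 0}
      add_mem' := fun {f g} hf hg => ⟨hf.1.add hg.1, by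
        rw [errRef_add k hf.1 hg.1, hf.2, hg.2, add_zero]⟩
      zero_mem' := ⟨integrableOn_zero, by simp [errRef, quadRef]⟩
      smul_mem' := fun c f hf => ⟨hf.1.smul c, by rw [errRef_smul, hf.2, mul_zero]⟩ }
  have hmem := Submodule.mul_mem_mul (Submodule.mul_mem_mul hp hv) hw
  rw [polyFun, conicWeighted, conicShape, Submodule.span_mul_span, Submodule.span_mul_span] at hmem
  refine Submodule.span_le (p := Z).2 ?_ hmem
  rintro _ ⟨_, ⟨_, ⟨a, b, c, habc, rfl⟩, _, ⟨a', b', ha', hb', rfl⟩, rfl⟩, _,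
    ⟨a'', b'', d, ha'', hb'', hd, rfl⟩, rfl⟩
  refine ⟨integrableOn_refPyramid (B := 1) ?_ ?_, ?_⟩
  · refine ContinuousOn.mul (ContinuousOn.mul (by fun_prop) ?_) ?_
    · exact (conicMono_contDiffOn _ _ _).continuousOn
    · exact (conicMono_contDiffOn _ _ _).continuousOn
  · intro x hx
    simp only [Pi.mul_apply, abs_mul]
    have hp := refPyramid_pos hx
    have h1 := abs_conicMono_le_one a' b' r hx
    have h2 := abs_conicMono_le_one a'' b'' d hx
    have hi : ∀ i, |x i| ≤ 1 := by
      obtain ⟨g1, g2, g3, g4, g5⟩ := hx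
      intro i
      rw [abs_le]
      fin_cases i <;> constructor <;> simp <;> linarith
    have hpow : ∀ (i : Fin 3) (n : ℕ), |x i ^ n| ≤ 1 := fun i n => by
      rw [abs_pow]; exact pow_le_one₀ (abs_nonneg _) (hi i)
    refine mul_le_one₀ (mul_le_one₀ (mul_le_one₀ (mul_le_one₀ (hpow 0 a) (abs_nonneg _)
      (hpow 1 b)) (abs_nonneg _) (hpow 2 c)) (abs_nonneg _) h1) (abs_nonneg _) h2
  · have hX : ∀ n : ℕ, ((Polynomial.X : ℝ[X]) ^ n).natDegree ≤ n := fun n =>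
      (Polynomial.natDegree_X_pow n).le
    have hOneSub : (1 - Polynomial.X : ℝ[X]).natDegree ≤ 1 := by
      rw [← neg_sub, Polynomial.natDegree_neg, ← Polynomial.C_1, Polynomial.natDegree_X_sub_C]
    -- Degree count: at most `m + (r+1) + k ≤ 2k+1` in each base variable, and at most `m + r + k ≤
    -- 2k` in the third, where each base coordinate in `p` brings its own factor `1 - p 2`.
    refine errRef_eq_zero k (P := Polynomial.X ^ (a + a' + a''))
      (Q := Polynomial.X ^ (b + b' + b''))
      (S := (1 - Polynomial.X) ^ (a + b + r + d) * Polynomial.X ^ c) ((hX _).trans (by omega))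
      ((hX _).trans (by omega)) ?_ fun p hp => ?_
    · refine (Polynomial.natDegree_mul_le_of_le (Polynomial.natDegree_pow_le_of_le _ hOneSub)
        (hX c)).trans (by omega)
    · simp only [Pi.mul_apply, conicMono_duffy _ _ _ hp]
      simp only [duffy, Matrix.cons_val_zero, Matrix.cons_val_one, Matrix.cons_val,
        Polynomial.eval_mul, Polynomial.eval_pow, Polynomial.eval_X, Polynomial.eval_sub,
        Polynomial.eval_one, mul_pow]
      ring

/-- A continuous function in `W^{m,∞}` is bounded. -/
lemma MemWInf.bounded {m : ℕ} {U : Set R3} (hU : IsOpen U) {f : R3 → ℝ} (hf : MemWInf m f U)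
    (hc : ContinuousOn f U) : ∃ B, ∀ x ∈ U, |f x| ≤ B := by
  have hL := hf.memLp hU
  set B := (eLpNorm f ⊤ (volume.restrict U)).toReal with hB
  refine ⟨B, fun x hx => ?_⟩
  -- The essential bound is phrased as an equality of continuous functions, which then holds at
  -- every point of the open set.
  have h1 : (fun x => max |f x| B) =ᵐ[volume.restrict U] fun _ => B := by
    filter_upwards [ae_le_eLpNormEssSup (f := f) (μ := volume.restrict U)] with y hy
    rw [← eLpNorm_exponent_top] at hy
    rw [max_eq_right_iff, ← Real.norm_eq_abs, ← toReal_enorm]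
    exact ENNReal.toReal_mono hL.2.ne hy
  have h2 := Measure.eqOn_open_of_ae_eq h1 hU (hc.abs.sup continuousOn_const)
    continuousOn_const hx
  exact max_eq_right_iff.1 h2

lemma wInfSeminorm_nonneg (m : ℕ) (f : R3 → ℝ) (U : Set R3) : 0 ≤ wInfSeminorm m f U :=
  ENNReal.toReal_nonneg

/-- The quadrature error estimate for one component. -/
theorem exists_errRef_estimate {k r : ℕ} (hr : r ≤ k) : ∃ C, 0 ≤ C ∧ ∀ a v w : R3 → ℝ,
    MemWInf (k + 1) a refPyramid → ContinuousOn a refPyramid → v ∈ conicWeighted r →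
    w ∈ conicShape k → |errRef k (a * v * w)| ≤ C * wInfSeminorm (k - r + 1) a refPyramid *
      hSeminorm r v refPyramid * hSeminorm 0 w refPyramid := by
  obtain ⟨C₁, hC₁, h₁⟩ := exists_errRef_bound k
  obtain ⟨C₂, hC₂, h₂⟩ := exists_conicWeighted_bound r
  obtain ⟨C₃, hC₃, h₃⟩ := exists_conicShape_bound k
  -- The power of `3` is the Taylor constant for radius `R = 1`, and its exponent is the order of
  -- the derivatives.
  refine ⟨C₁ * 3 ^ (k - r + 1) * C₂ * C₃, by positivity, fun a v w ha hac hv hw => ?_⟩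
  set M := wInfSeminorm (k - r + 1) a refPyramid with hM
  set Nv := hSeminorm r v refPyramid with hNv
  set Nw := hSeminorm 0 w refPyramid with hNw
  have hM0 : 0 ≤ M := wInfSeminorm_nonneg _ _ _
  have hNv0 : 0 ≤ Nv := hSeminorm_nonneg _ _ _
  have hNw0 : 0 ≤ Nw := hSeminorm_nonneg _ _ _
  have hvb := h₂ v hv
  have hwb := h₃ w hw
  have hvc := (conicHom_contDiffOn (conicWeighted_le_conicHom r hv)).continuousOn
  have hwc := (conicShape_contDiffOn hw).continuousOn
  -- This bound is only qualitative: it gives integrability and domination, and does not enter the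
  -- constant.
  obtain ⟨B, hB⟩ := ha.bounded refPyramid_isOpen hac
  have hspec := fun (α : Fin 3 → ℕ) (hα : ∑ i, α i = k - r + 1) =>
    ha.weakDeriv_spec refPyramid_isOpen (by omega : k - r + 1 ≤ k + 1) hα
  obtain ⟨G, hGs, hGB, hGd, hGl⟩ := exists_smooth_approx refPyramid_isOpen refPyramid_convex
    refPyramid_volume_ne_top refPoint_mem hac hB (fun α hα => (hspec α hα).1)
    (fun α hα => (hspec α hα).2)
  have hB0 : 0 ≤ B := (abs_nonneg _).trans (hB _ refPoint_mem)
  have hprod : ∀ {g : R3 → ℝ} {D : ℝ}, 0 ≤ D → (∀ x ∈ refPyramid, |g x| ≤ D) →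
      ∀ x ∈ refPyramid, |(g * v * w) x| ≤ D * (C₂ * Nv) * (C₃ * Nw) := by
    intro g D hD hg x hx
    simp only [Pi.mul_apply, abs_mul]
    gcongr
    · exact hg x hx
    · exact hvb x hx
    · exact hwb x hx
  have hest : ∀ j, |errRef k (G j * v * w)| ≤
      C₁ * 3 ^ (k - r + 1) * C₂ * C₃ * M * Nv * Nw := by
    intro j
    obtain ⟨p, hp, hpb⟩ := exists_polyFun_approx refPyramid_convex refPoint_mem
      (fun x hx => norm_sub_refPoint_le hx) (hGs j) (hGd j)
    obtain ⟨hpi, hp0⟩ := errRef_polyFun_mul_eq_zero (by omega : k - r + r ≤ k) hp hv hw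
    have hb := hprod (g := G j - p) (by positivity) hpb
    have hGi : IntegrableOn (G j * v * w) refPyramid :=
      integrableOn_refPyramid (((hGs j).continuous.continuousOn.mul hvc).mul hwc)
        (hprod hB0 (hGB j))
    -- The polynomial part contributes no error, which leaves the Taylor remainder.
    have e : G j * v * w = (G j - p) * v * w + p * v * w := by ring
    have hdi : IntegrableOn ((G j - p) * v * w) refPyramid := by
      have : (G j - p) * v * w = G j * v * w - p * v * w := by ring
      rw [this]
      exact hGi.sub hpi
    rw [e, errRef_add k hdi hpi, hp0, add_zero]
    refine (h₁ _ _ hb).trans (le_of_eq ?_)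
    ring
  refine le_of_tendsto (errRef_tendsto k (F := fun j => G j * v * w)
    (fun j => ((hGs j).continuous.continuousOn.mul hvc).mul hwc) (fun j => hprod hB0 (hGB j))
    (fun x hx => ((hGl x hx).mul_const _).mul_const _)).abs (Eventually.of_forall hest)

end PyramidFE

namespace PyramidFE

open MeasureTheory Filter

/-! ### The infinite pyramid -/

lemma infPyramid_isOpen : IsOpen infPyramid := by
  refine IsOpen.inter (isOpen_lt continuous_const (continuous_apply 0)) ?_
  refine IsOpen.inter (isOpen_lt (continuous_apply 0) continuous_const) ?_
  refine IsOpen.inter (isOpen_lt continuous_const (continuous_apply 1)) ?_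
  exact IsOpen.inter (isOpen_lt (continuous_apply 1) continuous_const)
    (isOpen_lt continuous_const (continuous_apply 2))

lemma infPyramid_pos {p : R3} (hp : p ∈ infPyramid) : 0 < 1 + p 2 :=
  add_pos zero_lt_one hp.2.2.2.2

lemma exists_projMap_eq {x : R3} (hx : x ∈ refPyramid) : ∃ p ∈ infPyramid, projMap p = x := by
  have h := refPyramid_pos hx
  obtain ⟨h1, h2, h3, h4, h5⟩ := hx
  refine ⟨![x 0 / (1 - x 2), x 1 / (1 - x 2), x 2 / (1 - x 2)],
    ⟨div_pos h2 h, (div_lt_one h).2 h3, div_pos h4 h, (div_lt_one h).2 h5, div_pos h1 h⟩, ?_⟩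
  have h' : 1 + x 2 / (1 - x 2) = 1 / (1 - x 2) := by field_simp; ring
  ext i
  fin_cases i <;> simp only [projMap, Matrix.cons_val_zero, Matrix.cons_val_one, Matrix.cons_val,
    h', Fin.zero_eta, Fin.mk_one, Fin.reduceFinMk] <;> field_simp

lemma conicMono_projMap (a b d : ℕ) {p : R3} (hp : p ∈ infPyramid) :
    conicMono a b d (projMap p) = p 0 ^ a * p 1 ^ b / (1 + p 2) ^ d := by
  have h := (infPyramid_pos hp).ne'
  have h1 : 1 - p 2 / (1 + p 2) = (1 + p 2)⁻¹ := by field_simp; ring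
  simp only [conicMono, projMap, Matrix.cons_val_zero, Matrix.cons_val_one, Matrix.cons_val, h1]
  have h2 : ∀ u : ℝ, u / (1 + p 2) / (1 + p 2)⁻¹ = u := fun u => by field_simp
  rw [h2, h2, inv_pow, div_eq_mul_inv]

/-- Functions on the infinite pyramid that are pulled back from `conicShape k`. -/
noncomputable def pulledShape (k : ℕ) : Submodule ℝ (R3 → ℝ) where
  carrier := {F | ∃ h ∈ conicShape k, ∀ p ∈ infPyramid, F p = h (projMap p)}
  add_mem' := by
    rintro F G ⟨f, hf, ef⟩ ⟨g, hg, eg⟩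
    exact ⟨f + g, Submodule.add_mem _ hf hg, fun p hp => by simp [ef p hp, eg p hp]⟩
  zero_mem' := ⟨0, Submodule.zero_mem _, fun p _ => rfl⟩
  smul_mem' := by
    rintro c F ⟨f, hf, ef⟩
    exact ⟨c • f, Submodule.smul_mem _ c hf, fun p hp => by simp [ef p hp]⟩

lemma pulledShape_of_eq {k : ℕ} {F G : R3 → ℝ} (hG : G ∈ pulledShape k)
    (h : ∀ p ∈ infPyramid, F p = G p) : F ∈ pulledShape k := by
  obtain ⟨g, hg, e⟩ := hG
  exact ⟨g, hg, fun p hp => (h p hp).trans (e p hp)⟩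

/-- The monomial `x^a y^b (1+z)^{-c}` on the infinite pyramid. -/
noncomputable def infMono (a b c : ℕ) : R3 → ℝ := fun p => p 0 ^ a * p 1 ^ b / (1 + p 2) ^ c

lemma pulledShape_of_eq_infMono {k a b c : ℕ} (ha : a ≤ k) (hb : b ≤ k) (hc : c ≤ k) (C : ℝ)
    {F : R3 → ℝ} (h : ∀ p ∈ infPyramid, F p = C * infMono a b c p) : F ∈ pulledShape k := by
  refine ⟨C • conicMono a b c, Submodule.smul_mem _ _ (Submodule.subset_span
    ⟨a, b, c, ha, hb, hc, rfl⟩), fun p hp => ?_⟩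
  rw [h p hp, Pi.smul_apply, smul_eq_mul, conicMono_projMap a b c hp, infMono]

lemma infMono_contDiffOn (a b c : ℕ) : ContDiffOn ℝ ∞ (infMono a b c) infPyramid := by
  refine ContDiffOn.div (by fun_prop) (by fun_prop) fun p hp => ?_
  exact pow_ne_zero _ (infPyramid_pos hp).ne'

lemma pderiv_infMono (a b c : ℕ) {p : R3} (hp : p ∈ infPyramid) :
    pderiv 0 (infMono a b c) p = a * p 0 ^ (a - 1) * p 1 ^ b / (1 + p 2) ^ c ∧
    pderiv 1 (infMono a b c) p = p 0 ^ a * (b * p 1 ^ (b - 1)) / (1 + p 2) ^ c ∧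
    pderiv 2 (infMono a b c) p = -c * (p 0 ^ a * p 1 ^ b) / (1 + p 2) ^ (c + 1) := by
  have hd := differentiableAt_of_contDiffOn infPyramid_isOpen (infMono_contDiffOn a b c) hp
  have ht := (infPyramid_pos hp).ne'
  refine ⟨?_, ?_, ?_⟩ <;> rw [pderiv_eq_deriv hd]
  · have h := (((hasDerivAt_id (p 0)).pow a).mul_const (p 1 ^ b)).div_const ((1 + p 2) ^ c)
    refine (h.congr_of_eventuallyEq (Eventually.of_forall fun t => ?_)).deriv.trans ?_
    · simp [infMono]
    · simp
  · have h := (((hasDerivAt_id (p 1)).pow b).const_mul (p 0 ^ a)).div_const ((1 + p 2) ^ c)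
    refine (h.congr_of_eventuallyEq (Eventually.of_forall fun t => ?_)).deriv.trans ?_
    · simp [infMono]
    · simp
  · have h := (hasDerivAt_const (p 2) (p 0 ^ a * p 1 ^ b)).div
      (((hasDerivAt_id (p 2)).const_add 1).pow c) (pow_ne_zero c ht)
    refine (h.congr_of_eventuallyEq (Eventually.of_forall fun t => ?_)).deriv.trans ?_
    · simp [infMono]
    · rcases c with _ | c
      · simp
      · simp only [Pi.pow_apply, id, Nat.add_sub_cancel, zero_mul, mul_one, zero_sub]
        rw [div_eq_div_iff (by positivity) (by positivity)]
        push_cast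
        ring

lemma mul_mem_pulledShape_of_span {k : ℕ} {S : Set (R3 → ℝ)} (c : R3 → ℝ)
    (hgen : ∀ f ∈ S, (fun p => c p * f p) ∈ pulledShape k) {q : R3 → ℝ}
    (hq : q ∈ Submodule.span ℝ S) : (fun p => c p * q p) ∈ pulledShape k := by
  refine Submodule.span_induction (p := fun q _ => (fun p => c p * q p) ∈ pulledShape k) hgen
    ?_ ?_ ?_ hq
  · exact pulledShape_of_eq (Submodule.zero_mem _) fun p _ => by simp
  · intro f g _ _ hf hg
    exact pulledShape_of_eq (Submodule.add_mem _ hf hg) fun p _ => by simp [mul_add]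
  · intro a f _ hf
    exact pulledShape_of_eq (Submodule.smul_mem _ a hf) fun p _ => by simp; ring

lemma pderiv_mem_pulledShape_of_span {k : ℕ} {S : Set (R3 → ℝ)}
    (hS : ∀ f ∈ S, ContDiffOn ℝ ∞ f infPyramid) (c : Fin 3 → R3 → ℝ)
    (hgen : ∀ f ∈ S, (fun p => ∑ i, c i p * pderiv i f p) ∈ pulledShape k) {q : R3 → ℝ}
    (hq : q ∈ Submodule.span ℝ S) : (fun p => ∑ i, c i p * pderiv i q p) ∈ pulledShape k := by
  refine Submodule.span_induction
    (p := fun q _ => (fun p => ∑ i, c i p * pderiv i q p) ∈ pulledShape k) hgen ?_ ?_ ?_ hq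
  · refine pulledShape_of_eq (Submodule.zero_mem _) fun p _ => ?_
    have : ∀ i, pderiv i (0 : R3 → ℝ) p = 0 := fun i => by
      change fderiv ℝ (fun _ => (0 : ℝ)) p _ = 0
      simp
    simp [this]
  · intro f g hf hg h1 h2
    refine pulledShape_of_eq (Submodule.add_mem _ h1 h2) fun p hp => ?_
    simp only [Pi.add_apply, ← Finset.sum_add_distrib, ← mul_add]
    refine Finset.sum_congr rfl fun i _ => ?_
    rw [pderiv_add infPyramid_isOpen (contDiffOn_of_mem_span hS hf)
      (contDiffOn_of_mem_span hS hg) i hp]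
    rfl
  · intro a f hf h1
    refine pulledShape_of_eq (Submodule.smul_mem _ a h1) fun p hp => ?_
    simp only [Pi.smul_apply, smul_eq_mul, Finset.mul_sum]
    refine Finset.sum_congr rfl fun i _ => ?_
    rw [pderiv_smul infPyramid_isOpen (contDiffOn_of_mem_span hS hf) a i hp]
    simp only [Pi.smul_apply, smul_eq_mul]
    ring

/-! ### Weights of coordinate changes -/

lemma weight_isUnit (s : Fin 4) {J : Matrix (Fin 3) (Fin 3) ℝ} (hJ : J.det ≠ 0) :
    IsUnit (weight s J).det := by
  rw [isUnit_iff_ne_zero]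
  match s with
  | 0 =>
    change (Matrix.of fun (_ _ : Fin 1) => (1 : ℝ)).det ≠ 0
    simp
  | 1 =>
    change ((J⁻¹)ᵀ).det ≠ 0
    rw [Matrix.det_transpose, Matrix.det_nonsing_inv, Ring.inverse_eq_inv']
    exact inv_ne_zero hJ
  | 2 =>
    change (J.det⁻¹ • J).det ≠ 0
    rw [Matrix.det_smul]
    exact mul_ne_zero (pow_ne_zero _ (inv_ne_zero hJ)) hJ
  | 3 =>
    change (Matrix.of fun (_ _ : Fin 1) => J.det⁻¹).det ≠ 0
    simpa using hJ

lemma weight_mulVec_changeCoords (s : Fin 4) {φ : R3 → R3} {x : R3}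
    (h : (jacobian φ x).det ≠ 0) (u : Proxy s) :
    weight s (jacobian φ x) *ᵥ changeCoords s φ u x = u (φ x) := by
  rw [changeCoords, Matrix.mulVec_mulVec, Matrix.mul_nonsing_inv _ (weight_isUnit s h),
    Matrix.one_mulVec]

/-- The Jacobian matrix of the projective map. -/
noncomputable def projJac (p : R3) : Matrix (Fin 3) (Fin 3) ℝ :=
  !![1 / (1 + p 2), 0, -p 0 / (1 + p 2) ^ 2;
     0, 1 / (1 + p 2), -p 1 / (1 + p 2) ^ 2;
     0, 0, 1 / (1 + p 2) ^ 2]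

lemma jacobian_projMap {p : R3} (hp : p ∈ infPyramid) : jacobian projMap p = projJac p := by
  have ht := (infPyramid_pos hp).ne'
  have hc : ∀ i : Fin 3, HasFDerivAt (fun x : R3 => x i)
      (ContinuousLinearMap.proj (R := ℝ) (φ := fun _ : Fin 3 => ℝ) i) p := fun i =>
    (ContinuousLinearMap.proj (R := ℝ) (φ := fun _ : Fin 3 => ℝ) i).hasFDerivAt
  have hd : HasFDerivAt projMap (LinearMap.toContinuousLinearMap (Matrix.toLin' (projJac p))) p := by
    have hinv := (hasDerivAt_inv ht).comp_hasFDerivAt p ((hc 2).const_add 1)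
    have hq : ∀ i, HasFDerivAt (fun x : R3 => x i * (1 + x 2)⁻¹) _ p := fun i => (hc i).mul hinv
    have he : projMap = fun x => ![x 0 * (1 + x 2)⁻¹, x 1 * (1 + x 2)⁻¹, x 2 * (1 + x 2)⁻¹] := by
      funext x; simp only [projMap, div_eq_mul_inv]
    rw [he]
    rw [hasFDerivAt_pi']
    intro i
    fin_cases i
    · refine (hq 0).congr_fderiv ?_
      ext v
      simp [projJac, dotProduct, Fin.sum_univ_three]
      field_simp
      ring
    · refine (hq 1).congr_fderiv ?_
      ext v
      simp [projJac, dotProduct, Fin.sum_univ_three]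
      field_simp
      ring
    · refine (hq 2).congr_fderiv ?_
      ext v
      simp [projJac, dotProduct, Fin.sum_univ_three]
      field_simp
      ring
  ext i j
  rw [jacobian, hd.fderiv]
  simp

lemma projJac_det {p : R3} (hp : p ∈ infPyramid) : (projJac p).det = ((1 + p 2) ^ 4)⁻¹ := by
  have ht := (infPyramid_pos hp).ne'
  rw [projJac, Matrix.det_fin_three]
  simp
  field_simp

lemma projJac_inv {p : R3} (hp : p ∈ infPyramid) : (projJac p)⁻¹ =
    !![1 + p 2, 0, p 0 * (1 + p 2); 0, 1 + p 2, p 1 * (1 + p 2); 0, 0, (1 + p 2) ^ 2] := by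
  have ht := (infPyramid_pos hp).ne'
  refine Matrix.inv_eq_left_inv ?_
  ext i j
  fin_cases i <;> fin_cases j <;> simp [projJac, Matrix.mul_apply, Fin.sum_univ_three, ht] <;>
    field_simp <;> ring

end PyramidFE

namespace PyramidFE

open MeasureTheory Filter

/-! ### Reference components of the shape functions -/

/-- The monomials spanning `bracketQ k l m`. -/
def bracketGen (k : ℕ) (l m : ℤ) : Set (R3 → ℝ) :=
  {f | ∃ a b c : ℕ, c ≤ k ∧ (a : ℤ) ≤ c + l - k ∧ (b : ℤ) ≤ c + m - k ∧ f = infMono a b c}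

lemma bracketGen_contDiffOn {k : ℕ} {l m : ℤ} : ∀ f ∈ bracketGen k l m,
    ContDiffOn ℝ ∞ f infPyramid := by
  rintro _ ⟨a, b, c, -, -, -, rfl⟩
  exact infMono_contDiffOn a b c

lemma mul_bracketQ_mem {k n : ℕ} {l m : ℤ} (c : R3 → ℝ)
    (hgen : ∀ f ∈ bracketGen n l m, (fun p => c p * f p) ∈ pulledShape k) {q : R3 → ℝ}
    (hq : q ∈ bracketQ n l m) : (fun p => c p * q p) ∈ pulledShape k :=
  mul_mem_pulledShape_of_span c hgen hq

lemma pderiv_bracketQ_mem {k n : ℕ} {l m : ℤ} (c : Fin 3 → R3 → ℝ)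
    (hgen : ∀ f ∈ bracketGen n l m, (fun p => ∑ i, c i p * pderiv i f p) ∈ pulledShape k)
    {q : R3 → ℝ} (hq : q ∈ bracketQ n l m) :
    (fun p => ∑ i, c i p * pderiv i q p) ∈ pulledShape k :=
  pderiv_mem_pulledShape_of_span bracketGen_contDiffOn c hgen hq

lemma natCast_mul_pow_pred (y : ℝ) (b : ℕ) : (b : ℝ) * y ^ (b - 1) * y = b * y ^ b := by
  rcases b with _ | b
  · simp
  · rw [Nat.add_sub_cancel, pow_succ]; ring

lemma infMono_shift (a b c n : ℕ) {p : R3} (hp : p ∈ infPyramid) :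
    (1 + p 2) ^ n * infMono a b (c + n) p = infMono a b c p := by
  have ht := (infPyramid_pos hp).ne'
  simp only [infMono, pow_add]
  field_simp

/-- Multiplication by a power of `1+z` and by coordinates. -/
lemma pow_mul_bracketQ_mem {k n e a₀ b₀ : ℕ} {l m : ℤ} (hn : n ≤ k + e) (hl : l + a₀ ≤ k)
    (hm : m + b₀ ≤ k) (hle : l + e ≤ n) {q : R3 → ℝ} (hq : q ∈ bracketQ n l m) :
    (fun p => p 0 ^ a₀ * p 1 ^ b₀ * (1 + p 2) ^ e * q p) ∈ pulledShape k := by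
  refine mul_bracketQ_mem _ ?_ hq
  rintro _ ⟨a, b, c, hc, ha, hb, rfl⟩
  -- Since `0 ≤ a ≤ c + l - n` and `l + e ≤ n`, the exponent `c` is at least `e`, so the factor `(1
  -- + p 2) ^ e` is absorbed entirely.
  obtain ⟨c', rfl⟩ : ∃ c', c = c' + e := ⟨c - e, by omega⟩
  refine pulledShape_of_eq_infMono (a := a + a₀) (b := b + b₀) (c := c') (by omega) (by omega)
    (by omega) 1 fun p hp => ?_
  rw [mul_assoc, infMono_shift a b c' e hp]
  simp only [infMono, pow_add]
  ring

/-- The reference components of a gradient. -/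
lemma grad_bracketQ_mem {k : ℕ} {q : R3 → ℝ} (hq : q ∈ bracketQ k k k) :
    (fun p => (1 + p 2) * pderiv 0 q p) ∈ pulledShape k ∧
    (fun p => (1 + p 2) * pderiv 1 q p) ∈ pulledShape k ∧
    (fun p => p 0 * (1 + p 2) * pderiv 0 q p + p 1 * (1 + p 2) * pderiv 1 q p +
      (1 + p 2) ^ 2 * pderiv 2 q p) ∈ pulledShape k := by
  refine ⟨?_, ?_, ?_⟩
  · have h := pderiv_bracketQ_mem (k := k) ![fun p => 1 + p 2, fun _ => 0, fun _ => 0] ?_ hq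
    · simpa [Fin.sum_univ_three] using h
    rintro _ ⟨a, b, c, hc, ha, hb, rfl⟩
    refine pulledShape_of_eq_infMono (a := a - 1) (b := b) (c := c - 1) (by omega) (by omega)
      (by omega) a fun p hp => ?_
    have ht := (infPyramid_pos hp).ne'
    obtain ⟨e0, e1, e2⟩ := pderiv_infMono a b c hp
    simp only [Fin.sum_univ_three, Matrix.cons_val_zero, Matrix.cons_val_one, Matrix.cons_val, e0]
    -- For `c = 0` the constraint forces `a = 0`, so the derivative vanishes and the truncated `c -
    -- 1` does no harm.
    rcases c with _ | c
    · obtain rfl : a = 0 := by omega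
      simp
    · simp only [infMono, Nat.add_sub_cancel, pow_succ (1 + p 2)]
      field_simp
      ring
  · have h := pderiv_bracketQ_mem (k := k) ![fun _ => 0, fun p => 1 + p 2, fun _ => 0] ?_ hq
    · simpa [Fin.sum_univ_three] using h
    rintro _ ⟨a, b, c, hc, ha, hb, rfl⟩
    refine pulledShape_of_eq_infMono (a := a) (b := b - 1) (c := c - 1) (by omega) (by omega)
      (by omega) b fun p hp => ?_
    have ht := (infPyramid_pos hp).ne'
    obtain ⟨e0, e1, e2⟩ := pderiv_infMono a b c hp
    simp only [Fin.sum_univ_three, Matrix.cons_val_zero, Matrix.cons_val_one, Matrix.cons_val, e1]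
    rcases c with _ | c
    · obtain rfl : b = 0 := by omega
      simp
    · simp only [infMono, Nat.add_sub_cancel, pow_succ (1 + p 2)]
      field_simp
      ring
  · have h := pderiv_bracketQ_mem (k := k)
      ![fun p => p 0 * (1 + p 2), fun p => p 1 * (1 + p 2), fun p => (1 + p 2) ^ 2] ?_ hq
    · simpa [Fin.sum_univ_three] using h
    rintro _ ⟨a, b, c, hc, ha, hb, rfl⟩
    -- Euler's identity: `x∂x + y∂y + (1+z)∂z` multiplies the monomial by `a + b - c`.
    refine pulledShape_of_eq_infMono (a := a) (b := b) (c := c - 1) (by omega) (by omega)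
      (by omega) (a + b - c) fun p hp => ?_
    have ht := (infPyramid_pos hp).ne'
    obtain ⟨e0, e1, e2⟩ := pderiv_infMono a b c hp
    have ha' := natCast_mul_pow_pred (p 0) a
    have hb' := natCast_mul_pow_pred (p 1) b
    simp only [Fin.sum_univ_three, Matrix.cons_val_zero, Matrix.cons_val_one, Matrix.cons_val,
      e0, e1, e2]
    rcases c with _ | c
    · obtain rfl : a = 0 := by omega
      obtain rfl : b = 0 := by omega
      simp
    · simp only [infMono, Nat.add_sub_cancel, pow_succ (1 + p 2)]
      push_cast
      field_simp
      linear_combination (p 1 ^ b) * ha' + (p 0 ^ a) * hb'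

/-- The contributions of the first component of a vector field to the reference components of its
curl. -/
lemma curl_bracketQ_mem_left {k : ℕ} {q : R3 → ℝ} (hq : q ∈ bracketQ (k + 1) (k - 1) k) :
    (fun p => p 0 * (1 + p 2) ^ 2 * pderiv 1 q p) ∈ pulledShape k ∧
    (fun p => p 1 * (1 + p 2) ^ 2 * pderiv 1 q p + (1 + p 2) ^ 3 * pderiv 2 q p) ∈
      pulledShape k ∧
    (fun p => (1 + p 2) ^ 2 * pderiv 1 q p) ∈ pulledShape k := by
  refine ⟨?_, ?_, ?_⟩
  · have h := pderiv_bracketQ_mem (k := k)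
      ![fun _ => 0, fun p => p 0 * (1 + p 2) ^ 2, fun _ => 0] ?_ hq
    · simpa [Fin.sum_univ_three] using h
    rintro _ ⟨a, b, c, hc, ha, hb, rfl⟩
    -- Here the constraint reads `a ≤ c - 2`, so two powers of `1 + p 2` are available to cancel.
    obtain ⟨c, rfl⟩ : ∃ c', c = c' + 2 := ⟨c - 2, by omega⟩
    refine pulledShape_of_eq_infMono (a := a + 1) (b := b - 1) (c := c) (by omega) (by omega)
      (by omega) b fun p hp => ?_
    have ht := (infPyramid_pos hp).ne'
    obtain ⟨e0, e1, e2⟩ := pderiv_infMono a b (c + 2) hp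
    simp only [Fin.sum_univ_three, Matrix.cons_val_zero, Matrix.cons_val_one, Matrix.cons_val,
      e1, infMono, pow_add]
    field_simp
    ring
  · have h := pderiv_bracketQ_mem (k := k)
      ![fun _ => 0, fun p => p 1 * (1 + p 2) ^ 2, fun p => (1 + p 2) ^ 3] ?_ hq
    · simpa [Fin.sum_univ_three] using h
    rintro _ ⟨a, b, c, hc, ha, hb, rfl⟩
    obtain ⟨c, rfl⟩ : ∃ c', c = c' + 2 := ⟨c - 2, by omega⟩
    refine pulledShape_of_eq_infMono (a := a) (b := b) (c := c) (by omega) (by omega)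
      (by omega) (b - (c + 2)) fun p hp => ?_
    have ht := (infPyramid_pos hp).ne'
    obtain ⟨e0, e1, e2⟩ := pderiv_infMono a b (c + 2) hp
    have hb' := natCast_mul_pow_pred (p 1) b
    simp only [Fin.sum_univ_three, Matrix.cons_val_zero, Matrix.cons_val_one, Matrix.cons_val,
      e1, e2, infMono, pow_add]
    push_cast
    field_simp
    linear_combination (p 0 ^ a) * hb'
  · have h := pderiv_bracketQ_mem (k := k)
      ![fun _ => 0, fun p => (1 + p 2) ^ 2, fun _ => 0] ?_ hq
    · simpa [Fin.sum_univ_three] using h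
    rintro _ ⟨a, b, c, hc, ha, hb, rfl⟩
    obtain ⟨c, rfl⟩ : ∃ c', c = c' + 2 := ⟨c - 2, by omega⟩
    refine pulledShape_of_eq_infMono (a := a) (b := b - 1) (c := c) (by omega) (by omega)
      (by omega) b fun p hp => ?_
    have ht := (infPyramid_pos hp).ne'
    obtain ⟨e0, e1, e2⟩ := pderiv_infMono a b (c + 2) hp
    simp only [Fin.sum_univ_three, Matrix.cons_val_zero, Matrix.cons_val_one, Matrix.cons_val,
      e1, infMono, pow_add]
    field_simp
    ring

/-- The contributions of the second component of a vector field to the reference components of its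
curl. -/
lemma curl_bracketQ_mem_right {k : ℕ} {q : R3 → ℝ} (hq : q ∈ bracketQ (k + 1) k (k - 1)) :
    (fun p => p 1 * (1 + p 2) ^ 2 * pderiv 0 q p) ∈ pulledShape k ∧
    (fun p => p 0 * (1 + p 2) ^ 2 * pderiv 0 q p + (1 + p 2) ^ 3 * pderiv 2 q p) ∈
      pulledShape k ∧
    (fun p => (1 + p 2) ^ 2 * pderiv 0 q p) ∈ pulledShape k := by
  refine ⟨?_, ?_, ?_⟩
  · have h := pderiv_bracketQ_mem (k := k)
      ![fun p => p 1 * (1 + p 2) ^ 2, fun _ => 0, fun _ => 0] ?_ hq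
    · simpa [Fin.sum_univ_three] using h
    rintro _ ⟨a, b, c, hc, ha, hb, rfl⟩
    -- Now it is the bound `b ≤ c - 2` that supplies the two powers.
    obtain ⟨c, rfl⟩ : ∃ c', c = c' + 2 := ⟨c - 2, by omega⟩
    refine pulledShape_of_eq_infMono (a := a - 1) (b := b + 1) (c := c) (by omega) (by omega)
      (by omega) a fun p hp => ?_
    have ht := (infPyramid_pos hp).ne'
    obtain ⟨e0, e1, e2⟩ := pderiv_infMono a b (c + 2) hp
    simp only [Fin.sum_univ_three, Matrix.cons_val_zero, Matrix.cons_val_one, Matrix.cons_val,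
      e0, infMono, pow_add]
    field_simp
    ring
  · have h := pderiv_bracketQ_mem (k := k)
      ![fun p => p 0 * (1 + p 2) ^ 2, fun _ => 0, fun p => (1 + p 2) ^ 3] ?_ hq
    · simpa [Fin.sum_univ_three] using h
    rintro _ ⟨a, b, c, hc, ha, hb, rfl⟩
    obtain ⟨c, rfl⟩ : ∃ c', c = c' + 2 := ⟨c - 2, by omega⟩
    refine pulledShape_of_eq_infMono (a := a) (b := b) (c := c) (by omega) (by omega)
      (by omega) (a - (c + 2)) fun p hp => ?_
    have ht := (infPyramid_pos hp).ne'
    obtain ⟨e0, e1, e2⟩ := pderiv_infMono a b (c + 2) hp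
    have ha' := natCast_mul_pow_pred (p 0) a
    simp only [Fin.sum_univ_three, Matrix.cons_val_zero, Matrix.cons_val_one, Matrix.cons_val,
      e0, e2, infMono, pow_add]
    push_cast
    field_simp
    linear_combination (p 1 ^ b) * ha'
  · have h := pderiv_bracketQ_mem (k := k)
      ![fun p => (1 + p 2) ^ 2, fun _ => 0, fun _ => 0] ?_ hq
    · simpa [Fin.sum_univ_three] using h
    rintro _ ⟨a, b, c, hc, ha, hb, rfl⟩
    obtain ⟨c, rfl⟩ : ∃ c', c = c' + 2 := ⟨c - 2, by omega⟩
    refine pulledShape_of_eq_infMono (a := a - 1) (b := b) (c := c) (by omega) (by omega)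
      (by omega) a fun p hp => ?_
    have ht := (infPyramid_pos hp).ne'
    obtain ⟨e0, e1, e2⟩ := pderiv_infMono a b (c + 2) hp
    simp only [Fin.sum_univ_three, Matrix.cons_val_zero, Matrix.cons_val_one, Matrix.cons_val,
      e0, infMono, pow_add]
    field_simp
    ring

/-- The components of the weighted fields in `𝒫^{(s)}_k` are pulled back from `conicShape k`. -/
lemma weight_mulVec_spaceP_mem (s : Fin 4) (k : ℕ) {u : Proxy s} (hu : u ∈ spaceP s k)
    (i : Fin (proxyDim s)) :
    (fun p => (weight s (projJac p) *ᵥ u p) i) ∈ pulledShape k := by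
  revert u hu i
  match s with
  | 0 =>
    intro u hu i
    obtain ⟨q, hq, e⟩ := hu
    have h := pow_mul_bracketQ_mem (k := k) (e := 0) (a₀ := 0) (b₀ := 0) (by omega) (by omega)
      (by omega) (by omega) hq
    refine pulledShape_of_eq h fun p hp => ?_
    change Fin 1 at i
    rw [e p hp]
    simp [weight, Matrix.mulVec, dotProduct]
  | 1 =>
    intro u hu i
    obtain ⟨q₁, hq₁, q₂, hq₂, q, hq, e⟩ := hu
    obtain ⟨g0, g1, g2⟩ := grad_bracketQ_mem hq
    -- The exponents are read off from the inverse transposed Jacobian, whose entries in the first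
    -- two columns are `1+z`, `x(1+z)` and `y(1+z)`.
    have a0 := pow_mul_bracketQ_mem (k := k) (e := 1) (a₀ := 0) (b₀ := 0) (by omega) (by omega)
      (by omega) (by push_cast; omega) hq₁
    have a1 := pow_mul_bracketQ_mem (k := k) (e := 1) (a₀ := 1) (b₀ := 0) (by omega)
      (by push_cast; omega) (by omega) (by push_cast; omega) hq₁
    have b0 := pow_mul_bracketQ_mem (k := k) (e := 1) (a₀ := 0) (b₀ := 0) (by omega) (by omega)
      (by omega) (by push_cast; omega) hq₂
    have b1 := pow_mul_bracketQ_mem (k := k) (e := 1) (a₀ := 0) (b₀ := 1) (by omega) (by omega)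
      (by push_cast; omega) (by push_cast; omega) hq₂
    change Fin 3 at i
    fin_cases i
    · refine pulledShape_of_eq (Submodule.add_mem _ a0 g0) fun p hp => ?_
      rw [e p hp]
      simp [weight, projJac_inv hp, Matrix.mulVec, dotProduct, Fin.sum_univ_three, grad, pderiv]
      ring
    · refine pulledShape_of_eq (Submodule.add_mem _ b0 g1) fun p hp => ?_
      rw [e p hp]
      simp [weight, projJac_inv hp, Matrix.mulVec, dotProduct, Fin.sum_univ_three, grad, pderiv]
      ring
    · refine pulledShape_of_eq (Submodule.add_mem _ (Submodule.add_mem _ a1 b1) g2) fun p hp => ?_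
      rw [e p hp]
      simp [weight, projJac_inv hp, Matrix.mulVec, dotProduct, Fin.sum_univ_three, grad, pderiv]
      ring
  | 2 =>
    intro u hu i
    obtain ⟨q₃, hq₃, q₁, hq₁, q₂, hq₂, e⟩ := hu
    obtain ⟨l0, l1, l2⟩ := curl_bracketQ_mem_left hq₁
    obtain ⟨r0, r1, r2⟩ := curl_bracketQ_mem_right hq₂
    have c0 := pow_mul_bracketQ_mem (k := k) (e := 2) (a₀ := 1) (b₀ := 0) (by omega)
      (by push_cast; omega) (by omega) (by push_cast; omega) hq₃
    have c1 := pow_mul_bracketQ_mem (k := k) (e := 2) (a₀ := 0) (b₀ := 1) (by omega) (by omega)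
      (by push_cast; omega) (by push_cast; omega) hq₃
    have c2 := pow_mul_bracketQ_mem (k := k) (e := 2) (a₀ := 0) (b₀ := 0) (by omega) (by omega)
      (by omega) (by push_cast; omega) hq₃
    change Fin 3 at i
    -- The inverse determinant `(1+z)^4` clears all denominators of `projJac`; the third column
    -- becomes `-x(1+z)^2`, `-y(1+z)^2`, `(1+z)^2`, which is where `c0`, `c1`, `c2` come from.
    have hw : ∀ p ∈ infPyramid, weight 2 (projJac p) = (1 + p 2) ^ 4 • projJac p := fun p hp => by
      change (projJac p).det⁻¹ • projJac p = _
      rw [projJac_det hp, inv_inv]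
    fin_cases i
    · refine pulledShape_of_eq (Submodule.sub_mem _ l0 (Submodule.add_mem _ r1 c0)) fun p hp => ?_
      have ht := (infPyramid_pos hp).ne'
      rw [e p hp, hw p hp]
      simp [projJac, Matrix.mulVec, dotProduct, Fin.sum_univ_three, curl, grad, pderiv]
      field_simp
      ring
    · refine pulledShape_of_eq (Submodule.sub_mem _ l1 (Submodule.add_mem _ r0 c1)) fun p hp => ?_
      have ht := (infPyramid_pos hp).ne'
      rw [e p hp, hw p hp]
      simp [projJac, Matrix.mulVec, dotProduct, Fin.sum_univ_three, curl, grad, pderiv]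
      field_simp
      ring
    · refine pulledShape_of_eq (Submodule.sub_mem _ (Submodule.add_mem _ r2 c2) l2) fun p hp => ?_
      have ht := (infPyramid_pos hp).ne'
      rw [e p hp, hw p hp]
      simp [projJac, Matrix.mulVec, dotProduct, Fin.sum_univ_three, curl, grad, pderiv]
      field_simp
      ring
  | 3 =>
    intro u hu i
    obtain ⟨q, hq, e⟩ := hu
    -- The weight is the inverse determinant `(1+z)^4`, and `(k-1) + 4 = k+3` meets the absorption
    -- condition with equality.
    have h := pow_mul_bracketQ_mem (k := k) (e := 4) (a₀ := 0) (b₀ := 0) (by omega) (by omega)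
      (by omega) (by push_cast; omega) hq
    refine pulledShape_of_eq h fun p hp => ?_
    change Fin 1 at i
    rw [e p hp]
    simp [weight, Matrix.mulVec, dotProduct, projJac_det hp]

end PyramidFE

namespace PyramidFE

open MeasureTheory Filter

/-! ### Reference components of forms and tensors -/

/-- Undoing the projective change of coordinates multiplies the infinite-pyramid components by the
weight matrix, and `projMap` covers the whole reference pyramid. -/
lemma exists_conicShape_eqOn {s : Fin 4} {k : ℕ} {φK : R3 ≃ᵃ[ℝ] R3} {u : Proxy s}
    (hu : u ∈ approxP s k φK) (i : Fin (proxyDim s)) :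
    ∃ h ∈ conicShape k, Set.EqOn (fun x => changeCoords s φK u x i) h refPyramid := by
  obtain ⟨h, hh, e⟩ := weight_mulVec_spaceP_mem s k hu.2 i
  refine ⟨h, hh, fun x hx => ?_⟩
  obtain ⟨p, hp, rfl⟩ := exists_projMap_eq hx
  have hJ := jacobian_projMap hp
  have hdet : (jacobian projMap p).det ≠ 0 := by
    rw [hJ, projJac_det hp]
    exact inv_ne_zero (pow_ne_zero _ (infPyramid_pos hp).ne')
  have h1 := weight_mulVec_changeCoords s hdet (changeCoords s φK u)
  rw [← e p hp]
  beta_reduce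
  rw [← hJ, h1]

lemma exists_conicWeighted_eqOn {s : Fin 4} {r k : ℕ} {φK : R3 ≃ᵃ[ℝ] R3} {v : Proxy s}
    (hv : v ∈ approxX s r k φK) (i : Fin (proxyDim s)) :
    ∃ h ∈ conicWeighted r, Set.EqOn (fun x => changeCoords s φK v x i) h refPyramid := by
  obtain ⟨q, hq, e⟩ := hv.2 i
  have key : ∃ h ∈ conicWeighted r, ∀ p ∈ infPyramid, q p = h (projMap p) := by
    refine Submodule.span_induction (p := fun q _ => ∃ h ∈ conicWeighted r,
      ∀ p ∈ infPyramid, q p = h (projMap p)) ?_ ?_ ?_ ?_ hq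
    · rintro _ ⟨a, b, c, ha, hb, hc, rfl⟩
      obtain rfl : c = 0 := by omega
      refine ⟨_, Submodule.subset_span ⟨a, b, ha, hb, rfl⟩, fun p hp => ?_⟩
      rw [conicMono_projMap a b r hp]
      simp only [pow_zero, mul_one]
    · exact ⟨0, Submodule.zero_mem _, fun p _ => rfl⟩
    · rintro f g _ _ ⟨f', hf, ef⟩ ⟨g', hg, eg⟩
      exact ⟨f' + g', Submodule.add_mem _ hf hg, fun p hp => by simp [ef p hp, eg p hp]⟩
    · rintro c f _ ⟨f', hf, ef⟩
      exact ⟨c • f', Submodule.smul_mem _ c hf, fun p hp => by simp [ef p hp]⟩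
  obtain ⟨h, hh, e'⟩ := key
  refine ⟨h, hh, fun x hx => ?_⟩
  obtain ⟨p, hp, rfl⟩ := exists_projMap_eq hx
  exact (e p hp).trans (e' p hp)

lemma jacobian_affine (φK : R3 ≃ᵃ[ℝ] R3) (x : R3) :
    jacobian φK x = LinearMap.toMatrix' (φK.linear : R3 →ₗ[ℝ] R3) := by
  ext i j
  rw [jacobian, (affine_hasFDerivAt φK x).fderiv, LinearMap.toMatrix'_apply]
  rfl

lemma jacobian_affine_det_ne_zero (φK : R3 ≃ᵃ[ℝ] R3) (x : R3) : (jacobian φK x).det ≠ 0 := by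
  rw [jacobian_affine, LinearMap.det_toMatrix']
  exact affine_det_ne_zero φK

/-- `A(v,w)` is a scalar. -/
lemma tensorApply_affine {s : Fin 4} (φK : R3 ≃ᵃ[ℝ] R3) (A : Tensor s) (v w : Proxy s) (x : R3) :
    tensorApply A v w (φK x) = tensorApply (tensorChangeCoords s φK A) (changeCoords s φK v)
      (changeCoords s φK w) x := by
  have hform : ∀ (B : Tensor s) (v w : Proxy s) (y : R3),
      tensorApply B v w y = v y ⬝ᵥ (B y *ᵥ w y) := by
    intro B v w y
    simp only [tensorApply, dotProduct, Matrix.mulVec, Finset.mul_sum]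
    exact Finset.sum_congr rfl fun i _ => Finset.sum_congr rfl fun j _ => by ring
  have hd := jacobian_affine_det_ne_zero φK x
  rw [hform, hform, ← weight_mulVec_changeCoords s hd v, ← weight_mulVec_changeCoords s hd w,
    tensorChangeCoords, ← Matrix.mulVec_mulVec, ← Matrix.mulVec_mulVec, Matrix.dotProduct_mulVec _
      (weight s (jacobian φK x))ᵀ, Matrix.vecMul_transpose]

lemma err_eq_errRef (k : ℕ) (φK : R3 ≃ᵃ[ℝ] R3) (f : R3 → ℝ) :
    err k φK f = jacDet φK * errRef k (fun x => f (φK x)) := by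
  rw [← errRef_smul, err, quad, errRef, affinePyramid,
    setIntegral_affine_image φK refPyramid_isOpen, ← integral_const_mul]
  rfl

/-- The Jacobian of an affine map is constant, so the pulled-back components are constant linear
combinations of those of `A`, composed with `φK`. -/
lemma memWInf_tensorChangeCoords {s : Fin 4} {m : ℕ} (φK : R3 ≃ᵃ[ℝ] R3) {A : Tensor s}
    (hA : MemWInfTensor m A (affinePyramid φK)) (i j : Fin (proxyDim s)) :
    MemWInf m (fun x => tensorChangeCoords s φK A x i j) refPyramid ∧
      ContinuousOn (fun x => tensorChangeCoords s φK A x i j) refPyramid := by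
  set W := weight s (LinearMap.toMatrix' (φK.linear : R3 →ₗ[ℝ] R3)) with hW
  have e : (fun x => tensorChangeCoords s φK A x i j) =
      ∑ b, ∑ a, (W a i * W b j) • fun x => A (φK x) a b := by
    funext x
    simp only [tensorChangeCoords, jacobian_affine, ← hW, Matrix.mul_apply, Matrix.transpose_apply,
      Finset.sum_apply, Pi.smul_apply, smul_eq_mul, Finset.sum_mul]
    exact Finset.sum_congr rfl fun b _ => Finset.sum_congr rfl fun a _ => by ring
  rw [e]
  constructor
  · exact MemWInf.sum _ fun b _ => MemWInf.sum _ fun a _ =>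
      ((hA a b).1.comp_affine φK refPyramid_isOpen).const_smul _
  · have : ∀ a b, ContinuousOn (fun x => A (φK x) a b) refPyramid := fun a b =>
      (hA a b).2.comp (affine_contDiff φK).continuous.continuousOn (Set.mapsTo_image _ _)
    have h2 : ContinuousOn (fun x => ∑ b, ∑ a, (W a i * W b j) * A (φK x) a b) refPyramid :=
      continuousOn_finsetSum _ fun b _ => continuousOn_finsetSum _ fun a _ =>
        continuousOn_const.mul (this a b)
    refine h2.congr fun x _ => ?_
    simp

/-- Enlarging each `v i` and `w j` to its full sum decouples the double sum into the product of
three seminorms. -/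
lemma abs_sum_sum_le {n : ℕ} {C : ℝ} (hC : 0 ≤ C) {E a : Fin n → Fin n → ℝ} {v w : Fin n → ℝ}
    (ha : ∀ i j, 0 ≤ a i j) (hv : ∀ i, 0 ≤ v i) (hw : ∀ j, 0 ≤ w j)
    (h : ∀ i j, |E i j| ≤ C * a i j * v i * w j) :
    |∑ i, ∑ j, E i j| ≤ C * (∑ i, ∑ j, a i j) * (∑ i, v i) * ∑ j, w j := by
  have hV : ∀ i, v i ≤ ∑ i, v i := fun i =>
    Finset.single_le_sum (fun i _ => hv i) (Finset.mem_univ i)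
  have hW : ∀ j, w j ≤ ∑ j, w j := fun j =>
    Finset.single_le_sum (fun j _ => hw j) (Finset.mem_univ j)
  generalize ∑ i, v i = V at hV ⊢
  generalize ∑ j, w j = W at hW ⊢
  simp only [Finset.mul_sum, Finset.sum_mul]
  refine (Finset.abs_sum_le_sum_abs _ _).trans (Finset.sum_le_sum fun i _ => ?_)
  refine (Finset.abs_sum_le_sum_abs _ _).trans (Finset.sum_le_sum fun j _ => (h i j).trans ?_)
  have := ha i j
  have hV0 := (hv i).trans (hV i)
  exact mul_le_mul (mul_le_mul_of_nonneg_left (hV i) (by positivity)) (hW j) (hw j)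
    (by positivity)

/-- The error estimate with a constant that may depend on `r`. -/
theorem exists_err_estimate {k r : ℕ} (hr : r ≤ k) : ∃ C, 0 ≤ C ∧
    ∀ (s : Fin 4) (φK : R3 ≃ᵃ[ℝ] R3) (v w : Proxy s) (A : Tensor s),
      v ∈ approxX s r k φK → w ∈ approxP s k φK →
      MemWInfTensor (k + 1) A (affinePyramid φK) →
      |err k φK (tensorApply A v w)| ≤ C * jacDet φK * refTensorSeminorm (k - r + 1) φK A *
        refSeminorm r φK v * refSeminorm 0 φK w := by
  obtain ⟨C, hC, hest⟩ := exists_errRef_estimate hr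
  refine ⟨C, hC, fun s φK v w A hv hw hA => ?_⟩
  choose v' hv' ev using fun i => exists_conicWeighted_eqOn hv i
  choose w' hw' ew using fun i => exists_conicShape_eqOn hw i
  set a : Fin (proxyDim s) → Fin (proxyDim s) → R3 → ℝ := fun i j x =>
    tensorChangeCoords s φK A x i j with ha
  have haW := fun i j => (memWInf_tensorChangeCoords φK hA i j).1
  have haC := fun i j => (memWInf_tensorChangeCoords φK hA i j).2
  have hint : ∀ i j, IntegrableOn (a i j * v' i * w' j) refPyramid := by
    intro i j
    obtain ⟨B₁, hB₁⟩ := (haW i j).bounded refPyramid_isOpen (haC i j)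
    obtain ⟨B₂, hB₂⟩ := conicHom_bounded (conicWeighted_le_conicHom r (hv' i))
    obtain ⟨B₃, hB₃⟩ := conicShape_bounded (hw' j)
    refine integrableOn_refPyramid (B := B₁ * B₂ * B₃) (((haC i j).mul
      (conicHom_contDiffOn (conicWeighted_le_conicHom r (hv' i))).continuousOn).mul
      (conicShape_contDiffOn (hw' j)).continuousOn) fun x hx => ?_
    simp only [Pi.mul_apply, abs_mul]
    have h1 := (abs_nonneg _).trans (hB₁ x hx)
    have h2 := (abs_nonneg _).trans (hB₂ x hx)
    exact mul_le_mul (mul_le_mul (hB₁ x hx) (hB₂ x hx) (abs_nonneg _) h1) (hB₃ x hx)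
      (abs_nonneg _) (by positivity)
  have hE : errRef k (fun x => tensorApply A v w (φK x)) =
      ∑ i, ∑ j, errRef k (a i j * v' i * w' j) := by
    have e1 : Set.EqOn (fun x => tensorApply A v w (φK x))
        (∑ i, ∑ j, a i j * v' i * w' j) refPyramid := by
      intro x hx
      beta_reduce
      rw [tensorApply_affine]
      simp only [tensorApply, Finset.sum_apply, Pi.mul_apply]
      refine Finset.sum_congr rfl fun i _ => Finset.sum_congr rfl fun j _ => ?_
      rw [← ev i hx, ← ew j hx]
    rw [errRef_congr k e1, errRef_sum k _ _ fun i _ => integrable_finsetSum' _ fun j _ => hint i j]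
    exact Finset.sum_congr rfl fun i _ => errRef_sum k _ _ fun j _ => hint i j
  rw [err_eq_errRef, hE, abs_mul, abs_of_pos (jacDet_pos φK)]
  have hsum := abs_sum_sum_le (E := fun i j => errRef k (a i j * v' i * w' j))
    (a := fun i j => wInfSeminorm (k - r + 1) (a i j) refPyramid)
    (v := fun i => hSeminorm r (fun x => changeCoords s φK v x i) refPyramid)
    (w := fun i => hSeminorm 0 (fun x => changeCoords s φK w x i) refPyramid) hC
    (fun i j => wInfSeminorm_nonneg _ _ _) (fun i => hSeminorm_nonneg _ _ _)
    (fun j => hSeminorm_nonneg _ _ _) (fun i j => by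
      rw [hSeminorm_congr refPyramid_isOpen (ev i), hSeminorm_congr refPyramid_isOpen (ew j)]
      exact hest _ _ _ (haW i j) (haC i j) (hv' i) (hw' j))
  refine (mul_le_mul_of_nonneg_left hsum (jacDet_pos φK).le).trans (le_of_eq ?_)
  simp only [refTensorSeminorm, refSeminorm, ha]
  ring

end PyramidFE

/-! ### Uniformity of the constant in `r` -/

theorem mainTheorem5 (k : ℕ) :
    ∃ C : ℝ, ∀ (s : Fin 4) (r : ℕ), r ≤ k → ∀ (φK : PyramidFE.R3 ≃ᵃ[ℝ] PyramidFE.R3)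
      (v w : PyramidFE.Proxy s) (A : PyramidFE.Tensor s),
      v ∈ PyramidFE.approxX s r k φK →
      w ∈ PyramidFE.approxP s k φK →
      PyramidFE.MemWInfTensor (k + 1) A (PyramidFE.affinePyramid φK) →
      |PyramidFE.err k φK (PyramidFE.tensorApply A v w)| ≤
        C * PyramidFE.jacDet φK * PyramidFE.refTensorSeminorm (k - r + 1) φK A *
          PyramidFE.refSeminorm r φK v * PyramidFE.refSeminorm 0 φK w := by
  have hex : ∀ r : ℕ, ∃ C, 0 ≤ C ∧ (r ≤ k →
      ∀ (s : Fin 4) (φK : PyramidFE.R3 ≃ᵃ[ℝ] PyramidFE.R3) (v w : PyramidFE.Proxy s)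
        (A : PyramidFE.Tensor s), v ∈ PyramidFE.approxX s r k φK →
        w ∈ PyramidFE.approxP s k φK →
        PyramidFE.MemWInfTensor (k + 1) A (PyramidFE.affinePyramid φK) →
        |PyramidFE.err k φK (PyramidFE.tensorApply A v w)| ≤
          C * PyramidFE.jacDet φK * PyramidFE.refTensorSeminorm (k - r + 1) φK A *
            PyramidFE.refSeminorm r φK v * PyramidFE.refSeminorm 0 φK w) := by
    intro r
    by_cases hr : r ≤ k
    · obtain ⟨C, hC, h⟩ := PyramidFE.exists_err_estimate hr
      exact ⟨C, hC, fun _ => h⟩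
    -- A dummy constant for `r > k` makes the choice total in `r`.
    · exact ⟨0, le_rfl, fun h => absurd h hr⟩
  choose C hC h using hex
  -- Only finitely many `r` occur, and the constants are nonnegative, so their sum dominates each of
  -- them.
  refine ⟨∑ r ∈ Finset.range (k + 1), C r, fun s r hr φK v w A hv hw hA => ?_⟩
  refine (h r hr s φK v w A hv hw hA).trans ?_
  have h1 : C r ≤ ∑ r ∈ Finset.range (k + 1), C r :=
    Finset.single_le_sum (fun r _ => hC r) (Finset.mem_range.2 (by omega))
  have h2 := (PyramidFE.jacDet_pos φK).le
  have h3 : 0 ≤ PyramidFE.refTensorSeminorm (k - r + 1) φK A :=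
    Finset.sum_nonneg fun i _ => Finset.sum_nonneg fun j _ => PyramidFE.wInfSeminorm_nonneg _ _ _
  have h4 : ∀ (m : ℕ) (u : PyramidFE.Proxy s), 0 ≤ PyramidFE.refSeminorm m φK u := fun m u =>
    Finset.sum_nonneg fun i _ => PyramidFE.hSeminorm_nonneg _ _ _
  have := h4 r v
  have := h4 0 w
  gcongr
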